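/- Let $0<\alpha<1$ and let $E_1>E_2>\cdots$ be the decreasing enumeration of the points of a Poisson point process on $\mathbb R$ with intensity measure $\alpha e^{-\alpha u}\,du$ (the energy landscape $\underline E$). For $E\in\mathbb R$ let $N_E$ be the number of points $E_i\ge E$ (almost surely $N_E<\infty$, and $N_E\ge 2$ once $E$ is sufficiently negative), take the time unit $\tau_0=e^{E}$, and set $x_i=\tau_0e^{-E_i}=e^{E-E_i}$. Given the landscape, and for $N_E\ge 2$, let $Y_E$ be the continuous-time random walk on $\{1,\dots,N_E\}$ with uniform initial distribution which, after arriving at a site $i$, waits an exponential time of mean $\frac{N_E}{N_E-1}x_i^{-1}$ and then jumps to a uniformly chosen site different from $i$; let $\mathbb P_E$ be its law and, for $t,t_w\ge 0$, $$\Pi_E(t,t_w)=\mathbb P_E\bigl(Y_E(s)=Y_E(t_w)\ \text{ for all } s\in[t_w,t_w+t]\bigr).$$ (i) For almost every $\underline E$: for all $t,t_w\ge 0$ and for every piecewise $C^1$ closed curve $\gamma$ in $\mathbb C\setminus[0,1]$ with winding number $1$ around each point of $[0,1]$, $$\lim_{E\downarrow-\infty}\Pi_E(t,t_w)=\frac1{2\pi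 i}\int_\gamma\frac{e^{-t_w\lambda}}{\lambda}\;\frac{\displaystyle\int_0^1\frac{e^{-xt}}{\lambda-x}x^{\alpha-1}\,dx}{\displaystyle\int_0^1\frac{1}{\lambda-x}x^{\alpha-1}\,dx}\;d\lambda .$$ (ii) For almost every $\underline E$: for every $\theta>0$, the limit $\lim_{E\downarrow-\infty}\Pi_E(\theta t_w,t_w)$ exists for all $t_w\ge 0$, and $$\lim_{t_w\uparrow\infty}\ \lim_{E\downarrow-\infty}\Pi_E(\theta t_w,t_w)=\frac{\sin(\pi\alpha)}{\pi}\int_{\frac{\theta}{1+\theta}}^1u^{-\alpha}(1-u)^{\alpha-1}\,du .$$ -/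

import Mathlib

open MeasureTheory ProbabilityTheory Filter Topology Set
open scoped ENNReal NNReal

namespace REMTrap

noncomputable section

/-! ### The energy landscape -/

/-- `M` is a Poisson point process (Poisson random measure) on `ℝ` with intensity measure `Λ`:
the number of points in a Borel set of finite intensity is Poisson distributed with parameter the
intensity of the set, and the numbers of points in pairwise disjoint Borel sets are independent. -/
structure IsPoissonPointProcess {Ω : Type*} [MeasurableSpace Ω] (P : Measure Ω)
    (M : Ω → Measure ℝ) (Λ : Measure ℝ) : Prop where
  measurable : Measurable M
  poisson : ∀ B : Set ℝ, MeasurableSet B → Λ B ≠ ∞ →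
    P.map (fun ω => M ω B) = (poissonMeasure (Λ B).toNNReal).map (Nat.cast : ℕ → ℝ≥0∞)
  indep : ∀ B : ℕ → Set ℝ, (∀ n, MeasurableSet (B n)) → Pairwise (fun m n => Disjoint (B m) (B n)) →
    iIndepFun (fun n ω => M ω (B n)) P

/-- The measure `α e^{-α u} du` on `ℝ`. -/
def intensity (α : ℝ) : Measure ℝ :=
  volume.withDensity fun u => ENNReal.ofReal (α * Real.exp (-α * u))

/-- `E 0 > E 1 > E 2 > ⋯` is the decreasing enumeration of the points of a Poisson point process on
`ℝ` with intensity measure `α e^{-α u} du`. -/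
structure IsLandscape {Ω : Type*} [MeasurableSpace Ω] (P : Measure Ω) (α : ℝ)
    (E : ℕ → Ω → ℝ) : Prop where
  measurable : ∀ i, Measurable (E i)
  decreasing : ∀ᵐ ω ∂P, StrictAnti fun i => E i ω
  poisson : IsPoissonPointProcess P (fun ω => Measure.sum fun i => Measure.dirac (E i ω))
    (intensity α)

/-- The number of points of the landscape `E` that are at least `e`. When `E` is decreasing and tends
to `-∞`, the sites `i` with `e ≤ E i` are exactly those with `i < numSites E e`. -/
def numSites (E : ℕ → ℝ) (e : ℝ) : ℕ := {i | e ≤ E i}.ncard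

/-! ### The random walk, given the rates

The walk on `N = n + 2` sites with parameters `x i > 0` is built from its jump chain and its holding
times: the initial site is uniform; at a site `i` the walk waits an exponential time of mean
`N / (N - 1) * (x i)⁻¹` and then jumps to a uniformly chosen site different from `i`. The randomness
consists of the initial site and of an i.i.d. sequence of pairs (a mean-one exponential time, a
uniform element of `Fin (n + 1)`); the latter is used to choose the next site through the bijection
`i.succAbove` from `Fin (n + 1)` onto the sites other than `i`. -/

/-- The space of sources of randomness of the walk on `n + 2` sites. -/
abbrev Source (n : ℕ) : Type := Fin (n + 2) × (ℕ → ℝ × Fin (n + 1))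

/-- The law of the source of randomness. -/
def sourceLaw (n : ℕ) : Measure (Source n) :=
  (PMF.uniformOfFintype (Fin (n + 2))).toMeasure.prod
    (Measure.infinitePi fun _ : ℕ =>
      (expMeasure 1).prod (PMF.uniformOfFintype (Fin (n + 1))).toMeasure)

/-- The site after `k` jumps. -/
def jumpChain {n : ℕ} (w : Source n) : ℕ → Fin (n + 2)
  | 0 => w.1
  | k + 1 => (jumpChain w k).succAbove (w.2 k).2

/-- The rate `(N - 1) / N * x i` at which the walk on `N = n + 2` sites leaves the site `i`. -/
def exitRate (n : ℕ) (x : ℕ → ℝ) (i : Fin (n + 2)) : ℝ :=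
  ((n : ℝ) + 1) / ((n : ℝ) + 2) * x i

/-- The time of the `k`-th jump (`jumpTime x w 0 = 0`). -/
def jumpTime {n : ℕ} (x : ℕ → ℝ) (w : Source n) (k : ℕ) : ℝ :=
  ∑ l ∈ Finset.range k, (w.2 l).1 / exitRate n x (jumpChain w l)

/-- The position `Y(s)` of the walk at time `s ≥ 0`: it is the site after `k` jumps if the `k`-th
jump occurs at or before time `s` and the next one after time `s`. -/
def walk {n : ℕ} (x : ℕ → ℝ) (w : Source n) (s : ℝ) : Fin (n + 2) :=
  jumpChain w (sInf {k : ℕ | s < jumpTime x w (k + 1)})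

/-- The probability `ℙ(Y(s) = Y(tw) for all s ∈ [tw, tw + t])` for the walk on `N` sites with
parameters `x 0, …, x (N - 1)`. The walk on one site never jumps; for `N = 0` there is no walk and
the value is a convention. -/
def corr : (N : ℕ) → (x : ℕ → ℝ) → (t tw : ℝ) → ℝ
  | 0, _, _, _ => 0
  | 1, _, _, _ => 1
  | n + 2, x, t, tw =>
      (sourceLaw n).real {w | ∀ s ∈ Icc tw (tw + t), walk x w s = walk x w tw}

/-- The correlation function `Π_e(t, tw)` of the trap model on the points `≥ e` of the landscape `E`,
with time unit `τ₀`, that is, with `x i = τ₀ e^{-E i}`. -/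
def landscapeCorr (τ₀ : ℝ) (E : ℕ → ℝ) (e t tw : ℝ) : ℝ :=
  corr (numSites E e) (fun i => τ₀ * Real.exp (-E i)) t tw

/-! ### The contour integral -/

/-- The integral of `f` along the curve `γ : [0, 1] → ℂ`. -/
def pathIntegral (f : ℂ → ℂ) (γ : ℝ → ℂ) : ℂ :=
  ∫ s in (0 : ℝ)..1, f (γ s) * deriv γ s

/-- `γ : [0, 1] → ℂ` is a piecewise continuously differentiable closed curve which does not meet the
segment `[0, 1]` and has winding number `1` around each of its points. -/
structure IsLoopAroundUnitSegment (γ : ℝ → ℂ) : Prop where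
  piecewise : ∃ (n : ℕ) (a : ℕ → ℝ), Monotone a ∧ a 0 = 0 ∧ a n = 1 ∧
    ∀ k < n, ContDiffOn ℝ 1 γ (Icc (a k) (a (k + 1)))
  closed : γ 0 = γ 1
  avoids : ∀ s ∈ Icc (0 : ℝ) 1, ∀ x ∈ Icc (0 : ℝ) 1, γ s ≠ (x : ℂ)
  winding : ∀ x ∈ Icc (0 : ℝ) 1,
    1 / (2 * Real.pi * Complex.I) * pathIntegral (fun z => 1 / (z - (x : ℂ))) γ = 1

/-- The function `∫₀¹ e^{-x t} x^{α - 1} / (z - x) dx` of `z`. -/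
def stieltjes (α t : ℝ) (z : ℂ) : ℂ :=
  ∫ x in (0 : ℝ)..1, ((Real.exp (-x * t) * x ^ (α - 1) : ℝ) : ℂ) / (z - (x : ℂ))

/-- The contour integral
`(2πi)⁻¹ ∫_γ e^{-tw z} / z * (∫₀¹ e^{-x t} x^{α-1} / (z - x) dx) / (∫₀¹ x^{α-1} / (z - x) dx) dz`. -/
def limitCorr (α : ℝ) (γ : ℝ → ℂ) (t tw : ℝ) : ℂ :=
  1 / (2 * Real.pi * Complex.I) *
    pathIntegral (fun z => Complex.exp (-tw * z) / z * (stieltjes α t z / stieltjes α 0 z)) γ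

/-- The ageing function `sin (π α) / π * ∫_{θ/(1+θ)}^1 u^{-α} (1 - u)^{α - 1} du`. -/
def ageing (α θ : ℝ) : ℝ :=
  Real.sin (Real.pi * α) / Real.pi *
    ∫ u in (θ / (1 + θ))..1, u ^ (-α) * (1 - u) ^ (α - 1)

end

end REMTrap

/-!
Why the theorem holds.

*Reduction to a semigroup.* Let `X` be the coordinate function on `[0, 1]`. A mean `ν` on
`C([0, 1])` defines the bounded operator `trapOp ν f = X (ν f - f)`, the generator of a process which waits
at `x` an exponential time of rate `x` and then moves to a point drawn from `ν`. For the walk on `N`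
sites the mean is the empirical mean `ν_N` of the parameters `x i`: a jump to a uniformly chosen
site which may be the current one, at rate `x i`, is a jump to a uniformly chosen other site at rate
`(N - 1) / N * x i`. The decomposition at the first jump determines the probability of staying put
during a time window, and gives `corr N x t tw = ν_N (exp (tw * trapOp ν_N) e^{-t (N - 1) / N X})`
(`corr_eq_empMean_semi`).

*The limit for a typical landscape.* The number of points above `e` is Poisson with parameter
`e^{-α e}`. Chebyshev's inequality and the Borel-Cantelli lemma along levels with `n ^ 4` expected points,
together with monotonicity, show that almost surely the number of points above `e` is asymptotic to
`e^{-α e}`. Hence the distribution function of the parameters tends to `y ^ α`, the empirical means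
tend to `ν f = ∫₀¹ f(x) α x^{α - 1} dx` on moments, thus on `C([0, 1])`, and by dominated
convergence in the exponential series the correlation functions tend to
`ν (exp (tw * trapOp ν) e^{-t X})` (`IsTypical.tendsto_landscapeCorr`). The exceptional null set does not depend on `t` and
`tw`.

*The contour integral.* Put `w = 1 / z`. Then `w` times the quotient of the Cauchy transforms of `f`
and of `1` is `ν ((z + trapOp ν)⁻¹ f)`. The quotient is holomorphic in `w` on the plane slit along
`[1, ∞)`. This domain is star-shaped, so holomorphic functions have primitives there, and only the
winding number about `0` matters: the integral of `z ^ k` times this mean of the resolvent is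
`2πi (-1)^k ν (trapOp ν ^ k f)`. Expanding `e^{-tw z}` identifies the contour integral with the limit
above (`limitCorr_eq`).

*Ageing.* The decomposition at the last jump before time `s` is
`ν (exp (s * trapOp ν) e^{-t X}) = G(s + t) + ∫₀ˢ m(u) G(s - u + t) du`, where `G(r) = ν (e^{-r X})`
is asymptotic to `Γ(1 + α) r^{-α}` and `m` is the renewal density. The Laplace transform of `m` is
`1 / (p ν(1 / (p + X))) - 1`, which is asymptotic to `p^{-α} / (Γ(1 + α) Γ(1 - α))` at `0`.
Karamata's Tauberian argument (`tendsto_intervalIntegral_of_laplace`) turns this into the limit of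
the rescaled integral, and Euler's reflection formula gives the ageing function
(`tendsto_betaMean_semi_ageing`).
-/

namespace REMTrap

noncomputable section

/-! ### The operator of the trap model and its semigroup -/

/-- The continuous real functions on `[0, 1]`, the set of values of the parameters `x i`. -/
abbrev UnitFun : Type := C(unitInterval, ℝ)

-- Shortcuts: instance search does not find the topological ring structure without them.
instance : NormedRing (UnitFun →L[ℝ] UnitFun) := inferInstance

instance : NormedAlgebra ℝ (UnitFun →L[ℝ] UnitFun) := inferInstance

/-- The coordinate function `x ↦ x` on `[0, 1]`. -/
def coord : UnitFun := ⟨fun x => (x : ℝ), continuous_subtype_val⟩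

@[simp] lemma coord_apply (x : unitInterval) : coord x = (x : ℝ) := rfl

lemma coord_nonneg : 0 ≤ coord := fun x => x.2.1

lemma norm_coord_le : ‖coord‖ ≤ 1 :=
  (ContinuousMap.norm_le _ zero_le_one).2 fun x => by
    rw [Real.norm_eq_abs, abs_le]; exact ⟨by linarith [x.2.1, coord_apply x], x.2.2⟩

/-- The operator `f ↦ X (ν f - f)`, where `X` is the coordinate function: the generator of the
process which waits at `x` an exponential time of rate `x` and then moves to a point drawn from
`ν`. -/
def trapOp (ν : UnitFun →L[ℝ] ℝ) : UnitFun →L[ℝ] UnitFun :=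
  ν.smulRight coord - ContinuousLinearMap.mul ℝ UnitFun coord

lemma trapOp_apply (ν : UnitFun →L[ℝ] ℝ) (f : UnitFun) : trapOp ν f = ν f • coord - coord * f := rfl

lemma norm_trapOp_apply_le {ν : UnitFun →L[ℝ] ℝ} (hν : ‖ν‖ ≤ 1) (f : UnitFun) :
    ‖trapOp ν f‖ ≤ 2 * ‖f‖ := by
  rw [trapOp_apply]
  have h1 : ‖ν f‖ ≤ ‖f‖ := by
    simpa using (ν.le_opNorm f).trans (mul_le_mul_of_nonneg_right hν (norm_nonneg f))
  calc ‖ν f • coord - coord * f‖ ≤ ‖ν f • coord‖ + ‖coord * f‖ := norm_sub_le _ _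
    _ ≤ ‖f‖ * 1 + 1 * ‖f‖ := by
      gcongr
      · rw [norm_smul]
        exact mul_le_mul h1 norm_coord_le (norm_nonneg _) (norm_nonneg _)
      · exact (norm_mul_le _ _).trans (mul_le_mul_of_nonneg_right norm_coord_le (norm_nonneg _))
    _ = 2 * ‖f‖ := by ring

lemma norm_trapOp_pow_le {ν : UnitFun →L[ℝ] ℝ} (hν : ‖ν‖ ≤ 1) (f : UnitFun) (k : ℕ) :
    ‖(trapOp ν ^ k) f‖ ≤ 2 ^ k * ‖f‖ := by
  induction k with
  | zero => simp
  | succ k ih =>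
    rw [pow_succ' (trapOp ν), mul_apply_eq_comp]
    calc _ ≤ 2 * ‖(trapOp ν ^ k) f‖ := norm_trapOp_apply_le hν _
      _ ≤ 2 * (2 ^ k * ‖f‖) := by gcongr
      _ = _ := by ring

/-- The norm-continuous semigroup generated by the bounded operator `trapOp ν`. -/
def semi (ν : UnitFun →L[ℝ] ℝ) (s : ℝ) : UnitFun →L[ℝ] UnitFun :=
  NormedSpace.exp (s • trapOp ν)

lemma hasSum_semi (ν : UnitFun →L[ℝ] ℝ) (s : ℝ) (f : UnitFun) :
    HasSum (fun k : ℕ => (s ^ k / (k.factorial : ℝ)) • (trapOp ν ^ k) f) (semi ν s f) := by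
  have h := NormedSpace.exp_series_hasSum_exp' (𝕂 := ℝ) (s • trapOp ν)
  have h2 := h.mapL (ContinuousLinearMap.apply ℝ UnitFun f)
  have h3 : (fun k : ℕ => (s ^ k / (k.factorial : ℝ)) • (trapOp ν ^ k) f)
      = fun k => (ContinuousLinearMap.apply ℝ UnitFun f)
        ((k.factorial : ℝ)⁻¹ • (s • trapOp ν) ^ k) := by
    funext k
    simp [smul_pow, smul_smul, div_eq_inv_mul]
  rw [h3]
  exact h2

@[simp] lemma semi_zero (ν : UnitFun →L[ℝ] ℝ) : semi ν 0 = 1 := by simp [semi]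

lemma hasDerivAt_semi (ν : UnitFun →L[ℝ] ℝ) (s : ℝ) :
    HasDerivAt (semi ν) (semi ν s * trapOp ν) s := hasDerivAt_exp_smul_const _ _

lemma hasDerivAt_semi' (ν : UnitFun →L[ℝ] ℝ) (s : ℝ) :
    HasDerivAt (semi ν) (trapOp ν * semi ν s) s := hasDerivAt_exp_smul_const' _ _

lemma continuous_semi (ν : UnitFun →L[ℝ] ℝ) : Continuous (semi ν) :=
  continuous_iff_continuousAt.2 fun s => (hasDerivAt_semi ν s).continuousAt

/-- The semigroups depend continuously on the functional: weak convergence of the functionals is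
enough, because each term of the exponential series converges (`trapOp` contains only one
application of the functional, whose values are numbers) and the series are dominated uniformly. -/
theorem tendsto_semi {ι : Type*} {l : Filter ι} {ν : ι → UnitFun →L[ℝ] ℝ} {μ : UnitFun →L[ℝ] ℝ}
    {f : ι → UnitFun} {g : UnitFun} (hν : ∀ᶠ i in l, ‖ν i‖ ≤ 1)
    (hlim : ∀ h, Tendsto (fun i => ν i h) l (𝓝 (μ h))) (hf : Tendsto f l (𝓝 g)) (s : ℝ) :
    Tendsto (fun i => ν i (semi (ν i) s (f i))) l (𝓝 (μ (semi μ s g))) := by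
  have key : ∀ {F : ι → UnitFun} {G : UnitFun}, Tendsto F l (𝓝 G) →
      Tendsto (fun i => ν i (F i)) l (𝓝 (μ G)) := by
    intro F G hF
    have h0 : Tendsto (fun i => ν i (F i - G)) l (𝓝 0) := by
      refine squeeze_zero_norm' (a := fun i => ‖F i - G‖) ?_
        (tendsto_iff_norm_sub_tendsto_zero.1 hF)
      filter_upwards [hν] with i hi
      simpa using ((ν i).le_opNorm (F i - G)).trans
        (mul_le_mul_of_nonneg_right hi (norm_nonneg _))
    simpa using h0.add (hlim G)
  have hpow : ∀ k : ℕ, Tendsto (fun i => (trapOp (ν i) ^ k) (f i)) l (𝓝 ((trapOp μ ^ k) g)) := by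
    intro k
    induction k with
    | zero => simpa using hf
    | succ k ih =>
      simp only [pow_succ', mul_apply_eq_comp, trapOp_apply]
      exact ((key ih).smul_const _).sub (ih.const_mul _)
  obtain ⟨C, hC⟩ : ∃ C, ∀ᶠ i in l, ‖f i‖ ≤ C := by
    refine ⟨‖g‖ + 1, ?_⟩
    filter_upwards [hf.norm.eventually_lt_const (lt_add_one ‖g‖)] with i hi using hi.le
  have hs : ∀ (ν : UnitFun →L[ℝ] ℝ) (f : UnitFun),
      ν (semi ν s f) = ∑' k : ℕ, s ^ k / (k.factorial : ℝ) * ν ((trapOp ν ^ k) f) := by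
    intro ν f
    rw [← ((hasSum_semi ν s f).mapL ν).tsum_eq]
    simp
  simp only [hs]
  refine tendsto_tsum_of_dominated_convergence
    (bound := fun k : ℕ => (2 * |s|) ^ k / (k.factorial : ℝ) * C) ?_ ?_ ?_
  · exact (Real.summable_pow_div_factorial _).mul_right C
  · exact fun k => (key (hpow k)).const_mul _
  · filter_upwards [hν, hC] with i hi hCi k
    rw [norm_mul, norm_div, norm_pow, Real.norm_eq_abs, Real.norm_natCast, mul_pow]
    calc |s| ^ k / (k.factorial : ℝ) * ‖ν i ((trapOp (ν i) ^ k) (f i))‖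
        ≤ |s| ^ k / (k.factorial : ℝ) * (1 * (2 ^ k * C)) := by
          gcongr
          refine ((ν i).le_opNorm _).trans (mul_le_mul hi ?_ (norm_nonneg _) zero_le_one)
          exact (norm_trapOp_pow_le hi _ k).trans (by gcongr)
      _ = _ := by ring

/-- By the Weierstrass approximation theorem, bounded functionals converge if their moments do. -/
theorem tendsto_of_tendsto_monomials {ι : Type*} {l : Filter ι} {ν : ι → UnitFun →L[ℝ] ℝ}
    {μ : UnitFun →L[ℝ] ℝ} {C : ℝ} (hν : ∀ᶠ i in l, ‖ν i‖ ≤ C)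
    (hlim : ∀ k : ℕ, Tendsto (fun i => ν i (coord ^ k)) l (𝓝 (μ (coord ^ k)))) (f : UnitFun) :
    Tendsto (fun i => ν i f) l (𝓝 (μ f)) := by
  have hpoly : ∀ p : Polynomial ℝ, Tendsto (fun i => ν i (p.toContinuousMapOn unitInterval)) l
      (𝓝 (μ (p.toContinuousMapOn unitInterval))) := by
    intro p
    induction p using Polynomial.induction_on' with
    | add p q hp hq =>
      have : (p + q).toContinuousMapOn unitInterval
        = p.toContinuousMapOn unitInterval + q.toContinuousMapOn unitInterval := by
        ext; simp
      simp only [this, map_add]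
      exact hp.add hq
    | monomial n a =>
      have : (Polynomial.monomial n a).toContinuousMapOn unitInterval = a • coord ^ n := by
        ext x; simp
      simp only [this, map_smul]
      exact (hlim n).const_smul a
  rw [Metric.tendsto_nhds]
  intro ε hε
  set K : ℝ := |C| + ‖μ‖ + 1 with hK
  have hKpos : 0 < K := by positivity
  have hmem : f ∈ (polynomialFunctions unitInterval).topologicalClosure := by
    rw [show (polynomialFunctions unitInterval).topologicalClosure = ⊤ from
      polynomialFunctions_closure_eq_top']
    trivial
  obtain ⟨g, hg, hfg⟩ := Metric.mem_closure_iff.1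
    (show f ∈ closure (polynomialFunctions unitInterval : Set UnitFun) from hmem)
    (ε / (2 * K)) (by positivity)
  obtain ⟨p, -, rfl⟩ := hg
  filter_upwards [hν, (Metric.tendsto_nhds.1 (hpoly p)) (ε / 2) (by positivity)] with i hi hpi
  set g : UnitFun := p.toContinuousMapOn unitInterval
  have hfg' : ‖f - g‖ < ε / (2 * K) := by rwa [← dist_eq_norm]
  have e1 : ν i f - μ f = ν i (f - g) - μ (f - g) + (ν i g - μ g) := by
    simp only [map_sub]; ring
  rw [Real.dist_eq, e1]
  have h1 : |ν i (f - g)| ≤ |C| * ‖f - g‖ := ((ν i).le_opNorm _).trans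
    (mul_le_mul_of_nonneg_right (hi.trans (le_abs_self C)) (norm_nonneg _))
  have h2 : |μ (f - g)| ≤ ‖μ‖ * ‖f - g‖ := μ.le_opNorm _
  have h3 : K * ‖f - g‖ < ε / 2 := by
    have := mul_lt_mul_of_pos_left hfg' hKpos
    rwa [show K * (ε / (2 * K)) = ε / 2 by field_simp] at this
  have h4 : |ν i g - μ g| < ε / 2 := hpi
  have h5 := abs_add_le (ν i (f - g) - μ (f - g)) (ν i g - μ g)
  have h6 := abs_sub (ν i (f - g)) (μ (f - g))
  nlinarith [norm_nonneg (f - g)]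

/-! ### The walk is constant on a time window -/

section Paths

variable {n : ℕ} {x : ℕ → ℝ} {w : Source n}

/-- The walk does not jump during `(s, s + t]`: `s` and `s + t` lie between the same two consecutive
jump times. Almost surely this is the event in the definition of `corr`, see
`forall_walk_eq_iff_quiet`. -/
def Quiet {n : ℕ} (x : ℕ → ℝ) (t s : ℝ) (w : Source n) : Prop :=
  ∃ k, jumpTime x w k ≤ s ∧ s + t < jumpTime x w (k + 1)

lemma jumpTime_succ (k : ℕ) :
    jumpTime x w (k + 1) = jumpTime x w k + (w.2 k).1 / exitRate n x (jumpChain w k) :=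
  Finset.sum_range_succ _ _

@[simp] lemma jumpTime_zero : jumpTime x w 0 = 0 := Finset.sum_range_zero _

lemma strictMono_jumpTime (hr : ∀ i, 0 < exitRate n x i) (hw : ∀ l, 0 < (w.2 l).1) :
    StrictMono (jumpTime x w) :=
  strictMono_nat_of_lt_succ fun k => by
    rw [jumpTime_succ]
    exact lt_add_of_pos_right _ (div_pos (hw k) (hr _))

/-- The walk does not explode: its rates are bounded by the sum of the finitely many rates. -/
lemma tendsto_jumpTime (hr : ∀ i, 0 < exitRate n x i) (hw : ∀ l, 0 < (w.2 l).1)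
    (hlim : Tendsto (fun k => ∑ l ∈ Finset.range k, (w.2 l).1) atTop atTop) :
    Tendsto (jumpTime x w) atTop atTop := by
  set R : ℝ := ∑ i, exitRate n x i with hR
  have hiR : ∀ i, exitRate n x i ≤ R := fun i =>
    Finset.single_le_sum (f := fun i => exitRate n x i) (fun j _ => (hr j).le) (Finset.mem_univ i)
  have hRpos : 0 < R := (hr 0).trans_le (hiR 0)
  refine tendsto_atTop_mono (fun k => ?_) (hlim.atTop_div_const hRpos)
  rw [Finset.sum_div]
  exact Finset.sum_le_sum fun l _ => div_le_div_of_nonneg_left (hw l).le (hr _) (hiR _)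

lemma walk_eq_jumpChain (hT : StrictMono (jumpTime x w)) {k : ℕ} {u : ℝ}
    (h1 : jumpTime x w k ≤ u) (h2 : u < jumpTime x w (k + 1)) : walk x w u = jumpChain w k := by
  have : IsLeast {k : ℕ | u < jumpTime x w (k + 1)} k := by
    refine ⟨h2, fun j hj => ?_⟩
    by_contra! hlt
    have : jumpTime x w (j + 1) ≤ jumpTime x w k := hT.monotone hlt
    exact absurd hj (by simpa using this.trans h1)
  rw [walk, this.csInf_eq]

lemma exists_jumpTime_le_lt (hlim : Tendsto (jumpTime x w) atTop atTop) {u : ℝ} (hu : 0 ≤ u) :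
    ∃ k, jumpTime x w k ≤ u ∧ u < jumpTime x w (k + 1) := by
  classical
  have hex : ∃ k, u < jumpTime x w k := (hlim.eventually_gt_atTop u).exists
  have hpos : Nat.find hex ≠ 0 := fun h0 => by
    have := Nat.find_spec hex
    rw [h0, jumpTime_zero] at this
    linarith
  obtain ⟨k, hk⟩ := Nat.exists_eq_succ_of_ne_zero hpos
  refine ⟨k, not_lt.1 (Nat.find_min hex (by omega)), ?_⟩
  have := Nat.find_spec hex
  rwa [hk] at this

lemma forall_walk_eq_iff_quiet (hT : StrictMono (jumpTime x w))
    (hlim : Tendsto (jumpTime x w) atTop atTop) {t s : ℝ} (ht : 0 ≤ t) (hs : 0 ≤ s) :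
    (∀ u ∈ Icc s (s + t), walk x w u = walk x w s) ↔ Quiet x t s w := by
  constructor
  · intro h
    obtain ⟨k, hk1, hk2⟩ := exists_jumpTime_le_lt hlim hs
    refine ⟨k, hk1, ?_⟩
    by_contra! hle
    have h1 := h _ ⟨hk2.le, hle⟩
    rw [walk_eq_jumpChain hT le_rfl (hT (Nat.lt_succ_self (k + 1))),
      walk_eq_jumpChain hT hk1 hk2] at h1
    -- the jump chain never stays at its site
    exact Fin.succAbove_ne _ _ h1
  · rintro ⟨k, hk1, hk2⟩ u ⟨hu1, hu2⟩
    rw [walk_eq_jumpChain hT (hk1.trans hu1) (hu2.trans_lt hk2),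
      walk_eq_jumpChain hT hk1 (by linarith)]

/-- The sequence with first entry `p.1` followed by `p.2`; uncurried, so that it can be used as a
map from a product of measure spaces. -/
def consSeq {β : Type*} (p : β × (ℕ → β)) : ℕ → β
  | 0 => p.1
  | k + 1 => p.2 k

lemma jumpChain_cons (i : Fin (n + 2)) (a : ℝ × Fin (n + 1)) (q : ℕ → ℝ × Fin (n + 1)) (k : ℕ) :
    jumpChain ((i, consSeq (a, q)) : Source n) (k + 1)
      = jumpChain ((i.succAbove a.2, q) : Source n) k := by
  induction k with
  | zero => rfl
  | succ k ih =>
    rw [jumpChain, ih]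
    rfl

lemma jumpTime_cons (i : Fin (n + 2)) (a : ℝ × Fin (n + 1)) (q : ℕ → ℝ × Fin (n + 1)) (k : ℕ) :
    jumpTime x ((i, consSeq (a, q)) : Source n) (k + 1)
      = a.1 / exitRate n x i + jumpTime x ((i.succAbove a.2, q) : Source n) k := by
  rw [jumpTime, Finset.sum_range_succ', add_comm, jumpTime]
  congr 1
  exact Finset.sum_congr rfl fun l _ => by rw [jumpChain_cons]; rfl

lemma jumpTime_nonneg (hr : ∀ i, 0 < exitRate n x i) (hw : ∀ l, 0 < (w.2 l).1) (k : ℕ) :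
    0 ≤ jumpTime x w k :=
  Finset.sum_nonneg fun l _ => div_nonneg (hw l).le (hr _).le

/-- The event `Quiet` in terms of the first holding time and of the walk started afresh after the
first jump. -/
lemma quiet_cons (hr : ∀ i, 0 < exitRate n x i) {t s : ℝ} (hs : 0 ≤ s) (ht : 0 ≤ t)
    (i : Fin (n + 2)) (a : ℝ × Fin (n + 1)) {q : ℕ → ℝ × Fin (n + 1)}
    (hq : ∀ l, 0 < (q l).1) :
    Quiet x t s ((i, consSeq (a, q)) : Source n) ↔
      if a.1 ≤ exitRate n x i * s then
        Quiet x t (s - a.1 / exitRate n x i) ((i.succAbove a.2, q) : Source n)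
      else exitRate n x i * (s + t) < a.1 := by
  have hi := hr i
  have hdiv : a.1 ≤ exitRate n x i * s ↔ a.1 / exitRate n x i ≤ s := by
    rw [div_le_iff₀ hi, mul_comm]
  have hdiv' : exitRate n x i * (s + t) < a.1 ↔ s + t < a.1 / exitRate n x i := by
    rw [lt_div_iff₀ hi, mul_comm]
  rw [hdiv']
  split_ifs with h <;> rw [hdiv] at h
  · constructor
    · rintro ⟨k, hk1, hk2⟩
      rcases k with _ | k
      · rw [jumpTime_cons, jumpTime_zero] at hk2
        linarith
      · rw [jumpTime_cons] at hk1 hk2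
        exact ⟨k, by linarith, by linarith⟩
    · rintro ⟨k, hk1, hk2⟩
      refine ⟨k + 1, ?_, ?_⟩ <;> rw [jumpTime_cons] <;> linarith
  · constructor
    · rintro ⟨k, hk1, hk2⟩
      rcases k with _ | k
      · rw [jumpTime_cons, jumpTime_zero] at hk2
        linarith
      · rw [jumpTime_cons] at hk1
        have := jumpTime_nonneg (w := ((i.succAbove a.2, q) : Source n)) hr hq k
        linarith
    · intro h2
      refine ⟨0, by simpa using hs, ?_⟩
      rw [jumpTime_cons, jumpTime_zero]
      linarith

end Paths

/-! ### The law of the source of randomness -/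

instance : IsProbabilityMeasure (expMeasure 1) := isProbabilityMeasure_expMeasure one_pos

lemma integral_expMeasure_one (f : ℝ → ℝ) :
    ∫ ξ, f ξ ∂(expMeasure 1) = ∫ ξ in Ioi (0 : ℝ), Real.exp (-ξ) * f ξ := by
  have hm : Measurable (gammaPDF 1 1) := (measurable_gammaPDFReal 1 1).ennreal_ofReal
  rw [expMeasure, gammaMeasure, integral_withDensity_eq_integral_toReal_smul hm
    (Eventually.of_forall fun ξ => by simp [gammaPDF]), ← integral_indicator measurableSet_Ioi]
  refine integral_congr_ae ?_
  filter_upwards [compl_mem_ae_iff.2 (measure_singleton (0 : ℝ))] with ξ hξ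
  rcases lt_or_gt_of_ne hξ with h | h
  · simp [gammaPDF, gammaPDFReal, not_le.2 h, h.le]
  · simp [gammaPDF, gammaPDFReal, h.le, mem_Ioi.2 h, Real.exp_nonneg]

lemma expMeasure_one_ae_pos : ∀ᵐ ξ ∂(expMeasure 1), 0 < ξ := by
  have h := cdf_expMeasure_eq one_pos 0
  rw [cdf_eq_real] at h
  have h2 : (expMeasure 1) (Iic 0) = 0 := by
    simpa [measureReal_def, ENNReal.toReal_eq_zero_iff] using h
  rw [ae_iff]
  simpa [Iic] using h2

/-- A holding time in units of its mean, and a choice among the `n + 1` other sites. -/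
abbrev Marks (n : ℕ) : Type := ℝ × Fin (n + 1)

/-- The law of the pair governing one jump. -/
def markLaw (n : ℕ) : Measure (Marks n) :=
  (expMeasure 1).prod (PMF.uniformOfFintype (Fin (n + 1))).toMeasure

instance (n : ℕ) : IsProbabilityMeasure (markLaw n) := by unfold markLaw; infer_instance

/-- The law of the i.i.d. sequence governing the jumps. -/
def seqLaw (n : ℕ) : Measure (ℕ → Marks n) := Measure.infinitePi fun _ => markLaw n

instance (n : ℕ) : IsProbabilityMeasure (seqLaw n) := by unfold seqLaw; infer_instance

lemma sourceLaw_eq (n : ℕ) :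
    sourceLaw n = (PMF.uniformOfFintype (Fin (n + 2))).toMeasure.prod (seqLaw n) := rfl

instance (n : ℕ) : IsProbabilityMeasure (sourceLaw n) := by rw [sourceLaw_eq]; infer_instance

lemma measurable_consSeq {β : Type*} [MeasurableSpace β] :
    Measurable (consSeq : β × (ℕ → β) → ℕ → β) := by
  refine measurable_pi_lambda _ fun k => ?_
  rcases k with _ | k
  · exact measurable_fst
  · exact (measurable_pi_apply k).comp measurable_snd

/-- Regeneration: the first entry of an i.i.d. sequence is independent of the shifted sequence. -/
lemma map_consSeq_infinitePi {β : Type*} [MeasurableSpace β] (ρ : Measure β)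
    [IsProbabilityMeasure ρ] :
    (ρ.prod (Measure.infinitePi fun _ : ℕ => ρ)).map consSeq
      = Measure.infinitePi fun _ : ℕ => ρ := by
  refine Measure.eq_infinitePi _ fun s t ht => ?_
  rw [Measure.map_apply measurable_consSeq
    (MeasurableSet.pi s.countable_toSet fun i _ => ht i)]
  classical
  set s' : Finset ℕ := s.preimage (· + 1) (add_left_injective 1).injOn with hs'
  have hpre : consSeq ⁻¹' (Set.pi (s : Set ℕ) t)
      = (if 0 ∈ s then t 0 else univ) ×ˢ Set.pi (s' : Set ℕ) (fun k => t (k + 1)) := by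
    ext ⟨a, q⟩
    simp only [mem_preimage, Set.mem_pi, mem_prod, hs', Finset.coe_preimage, Finset.mem_coe]
    constructor
    · intro h
      refine ⟨?_, fun k hk => h (k + 1) hk⟩
      split_ifs with h0
      · exact h 0 h0
      · trivial
    · rintro ⟨h1, h2⟩ k hk
      rcases k with _ | k
      · rw [if_pos hk] at h1; exact h1
      · exact h2 k hk
  rw [hpre, Measure.prod_prod, Measure.infinitePi_pi (μ := fun _ : ℕ => ρ) (fun i _ => ht _)]
  have hprod : ∏ i ∈ s', ρ (t (i + 1)) = ∏ i ∈ s.erase 0, ρ (t i) := by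
    refine Finset.prod_bij (fun i _ => i + 1) ?_ ?_ ?_ ?_
    · intro i hi; simpa [hs'] using hi
    · intro i _ j _ h; simpa using h
    · intro j hj
      rw [Finset.mem_erase] at hj
      exact ⟨j - 1, by simpa [hs', Nat.sub_add_cancel (Nat.pos_of_ne_zero hj.1)] using hj.2,
        Nat.sub_add_cancel (Nat.pos_of_ne_zero hj.1)⟩
    · intro i _; rfl
  rw [hprod]
  split_ifs with h0
  · exact Finset.mul_prod_erase s (fun i => ρ (t i)) h0
  · rw [measure_univ, one_mul, Finset.erase_eq_of_notMem h0]

lemma ae_seqLaw_pos (n : ℕ) : ∀ᵐ q ∂(seqLaw n), ∀ l, 0 < (q l).1 := by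
  rw [ae_all_iff]
  intro l
  have h1 : ∀ᵐ a ∂(markLaw n), 0 < a.1 :=
    Measure.quasiMeasurePreserving_fst.ae expMeasure_one_ae_pos
  exact (measurePreserving_eval_infinitePi (fun _ : ℕ => markLaw n) l).quasiMeasurePreserving.ae h1

lemma integrable_id_expMeasure_one : Integrable (fun ξ : ℝ => ξ) (expMeasure 1) := by
  have hm : Measurable (gammaPDF 1 1) := (measurable_gammaPDFReal 1 1).ennreal_ofReal
  rw [expMeasure, gammaMeasure, integrable_withDensity_iff hm
    (Eventually.of_forall fun ξ => by simp [gammaPDF])]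
  have h : IntegrableOn (fun ξ : ℝ => Real.exp (-ξ) * ξ ^ ((2 : ℝ) - 1)) (Ioi 0) :=
    Real.GammaIntegral_convergent two_pos
  rw [← integrable_indicator_iff measurableSet_Ioi] at h
  refine h.congr ?_
  filter_upwards [compl_mem_ae_iff.2 (measure_singleton (0 : ℝ))] with ξ hξ
  rcases lt_or_gt_of_ne hξ with h | h
  · simp [gammaPDF, gammaPDFReal, not_le.2 h, h.le]
  · simp only [indicator, mem_Ioi, h, if_true, gammaPDF, gammaPDFReal, h.le]
    rw [show (2 : ℝ) - 1 = 1 by norm_num, Real.rpow_one]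
    simp [Real.exp_nonneg, mul_comm]

/-- By the strong law of large numbers, the sum of the holding times diverges. -/
lemma ae_seqLaw_tendsto (n : ℕ) : ∀ᵐ q ∂(seqLaw n),
    Tendsto (fun k => ∑ l ∈ Finset.range k, (q l).1) atTop atTop := by
  have hmp : ∀ i, MeasurePreserving (fun q : ℕ → Marks n => (q i).1) (seqLaw n) (expMeasure 1) :=
    fun i => measurePreserving_fst.comp
      (measurePreserving_eval_infinitePi (fun _ : ℕ => markLaw n) i)
  have hind : iIndepFun (fun (i : ℕ) (q : ℕ → Marks n) => (q i).1) (seqLaw n) :=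
    iIndepFun_infinitePi (P := fun _ : ℕ => markLaw n) (X := fun _ a => a.1)
      (fun _ => measurable_fst)
  have hlaw := strong_law_ae_real (fun (i : ℕ) (q : ℕ → Marks n) => (q i).1)
    ((hmp 0).integrable_comp_of_integrable integrable_id_expMeasure_one)
    (fun i j hij => hind.indepFun hij)
    (fun i => ⟨(hmp i).measurable.aemeasurable, (hmp 0).measurable.aemeasurable,
      by rw [(hmp i).map_eq, (hmp 0).map_eq]⟩)
  have hpos : 0 < ∫ q, (q 0).1 ∂(seqLaw n) := by
    have h1 : ∫ q, (q 0).1 ∂(seqLaw n) = ∫ ξ, ξ ∂(expMeasure 1) := by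
      rw [← (hmp 0).map_eq]
      exact (integral_map (hmp 0).measurable.aemeasurable aestronglyMeasurable_id).symm
    have h2 := Real.Gamma_eq_integral two_pos
    rw [Real.Gamma_two, show (2 : ℝ) - 1 = 1 by norm_num] at h2
    rw [h1, integral_expMeasure_one]
    simp only [Real.rpow_one] at h2
    rw [← h2]
    exact one_pos
  filter_upwards [hlaw] with q hq
  have h2 := hq.pos_mul_atTop hpos tendsto_natCast_atTop_atTop
  refine h2.congr' ?_
  filter_upwards [eventually_gt_atTop 0] with k hk
  have : (k : ℝ) ≠ 0 := by positivity
  field_simp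

/-! ### Positivity of the semigroup -/

/-- The functional `ν` is the integral against a probability measure, expressed as positivity and
normalization. -/
structure IsMean (ν : UnitFun →L[ℝ] ℝ) : Prop where
  nonneg : ∀ f : UnitFun, 0 ≤ f → 0 ≤ ν f
  one : ν 1 = 1

lemma IsMean.mono {ν : UnitFun →L[ℝ] ℝ} (hν : IsMean ν) {f g : UnitFun} (h : f ≤ g) :
    ν f ≤ ν g := by
  have := hν.nonneg (g - f) (sub_nonneg.2 h)
  rw [map_sub] at this
  linarith

lemma IsMean.norm_le_one {ν : UnitFun →L[ℝ] ℝ} (hν : IsMean ν) : ‖ν‖ ≤ 1 := by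
  refine ν.opNorm_le_bound zero_le_one fun f => ?_
  have hf : ∀ x, |f x| ≤ ‖f‖ := fun x => f.norm_coe_le_norm x
  have h1 : ν f ≤ ν (‖f‖ • (1 : UnitFun)) :=
    hν.mono fun x => by simpa using (abs_le.1 (hf x)).2
  have h2 : ν (-(‖f‖ • (1 : UnitFun))) ≤ ν f :=
    hν.mono fun x => by simpa using (abs_le.1 (hf x)).1
  rw [map_neg] at h2
  rw [map_smul, hν.one] at h1 h2
  rw [Real.norm_eq_abs, abs_le]
  simp only [smul_eq_mul, mul_one] at h1 h2
  exact ⟨by linarith, by linarith⟩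

lemma isClosed_nonneg : IsClosed {f : UnitFun | 0 ≤ f} := by
  have : {f : UnitFun | 0 ≤ f} = ⋂ x : unitInterval, {f | 0 ≤ f x} := by
    ext f; simp [ContinuousMap.le_def]
  rw [this]
  exact isClosed_iInter fun x => isClosed_le continuous_const (continuous_eval_const x)

/-- The shift by the identity makes the generator of the exponential a positive operator. -/
lemma semi_eq_exp_smul (ν : UnitFun →L[ℝ] ℝ) (s : ℝ) :
    semi ν s = Real.exp (-s) • NormedSpace.exp (s • (trapOp ν + 1)) := by
  have h1 : s • trapOp ν = algebraMap ℝ (UnitFun →L[ℝ] UnitFun) (-s) + s • (trapOp ν + 1) := by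
    rw [Algebra.algebraMap_eq_smul_one, smul_add, neg_smul]; abel
  let _ : NormedAlgebra ℚ (UnitFun →L[ℝ] UnitFun) := NormedAlgebra.restrictScalars ℚ ℝ _
  rw [semi, h1, NormedSpace.exp_add_of_commute (Algebra.commutes _ _),
    ← NormedSpace.algebraMap_exp_comm, ← Real.exp_eq_exp_ℝ, ← Algebra.smul_def]

/-- The semigroup preserves positivity because the operator `trapOp ν + 1`, that is
`f ↦ ν(f) X + (1 - X) f`, does. -/
lemma IsMean.semi_nonneg {ν : UnitFun →L[ℝ] ℝ} (hν : IsMean ν) {s : ℝ} (hs : 0 ≤ s) {f : UnitFun}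
    (hf : 0 ≤ f) : 0 ≤ semi ν s f := by
  have hpow : ∀ k : ℕ, 0 ≤ ((trapOp ν + 1) ^ k) f := by
    intro k
    induction k with
    | zero => simpa using hf
    | succ k ih =>
      rw [pow_succ', mul_apply_eq_comp]
      set g := ((trapOp ν + 1) ^ k) f
      have h1 := hν.nonneg g ih
      have h2 : (trapOp ν + 1) g = ν g • coord + (1 - coord) * g := by
        rw [add_apply, trapOp_apply]
        simp; ring
      rw [h2]
      intro x
      have h3 : 0 ≤ g x := ih x
      have h4 := x.2.1
      have h5 := x.2.2
      show (0 : ℝ) ≤ ν g * (x : ℝ) + (1 - (x : ℝ)) * g x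
      exact add_nonneg (mul_nonneg h1 h4) (mul_nonneg (by linarith) h3)
  rw [semi_eq_exp_smul, smul_apply]
  have h := (NormedSpace.exp_series_hasSum_exp' (𝕂 := ℝ) (s • (trapOp ν + 1))).mapL
    (ContinuousLinearMap.apply ℝ UnitFun f)
  have h0 : 0 ≤ NormedSpace.exp (s • (trapOp ν + 1)) f := by
    refine isClosed_nonneg.mem_of_tendsto h (Eventually.of_forall fun t => ?_)
    rw [mem_ofPred_eq]
    refine Finset.sum_nonneg fun k _ => ?_
    have : (ContinuousLinearMap.apply ℝ UnitFun f)
        (((k.factorial : ℝ))⁻¹ • (s • (trapOp ν + 1)) ^ k)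
        = ((k.factorial : ℝ)⁻¹ * s ^ k) • ((trapOp ν + 1) ^ k) f := by
      rw [smul_pow, smul_smul]
      rfl
    rw [this]
    exact smul_nonneg (by positivity) (hpow k)
  exact smul_nonneg (Real.exp_nonneg _) h0

lemma IsMean.semi_one {ν : UnitFun →L[ℝ] ℝ} (hν : IsMean ν) (s : ℝ) : semi ν s 1 = 1 := by
  have h0 : trapOp ν 1 = 0 := by rw [trapOp_apply, hν.one]; simp
  have h := hasSum_semi ν s 1
  refine h.unique ?_
  convert! hasSum_single (f := fun k : ℕ => (s ^ k / (k.factorial : ℝ)) • (trapOp ν ^ k) 1) 0 ?_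
  · simp
  · intro k hk
    obtain ⟨j, rfl⟩ := Nat.exists_eq_succ_of_ne_zero hk
    simp [pow_succ, h0]

lemma IsMean.semi_le_one {ν : UnitFun →L[ℝ] ℝ} (hν : IsMean ν) {s : ℝ} (hs : 0 ≤ s) {f : UnitFun}
    (hf : f ≤ 1) : semi ν s f ≤ 1 := by
  have := hν.semi_nonneg hs (sub_nonneg.2 hf)
  rw [map_sub, hν.semi_one] at this
  exact sub_nonneg.1 this

lemma hasDerivAt_semi_apply (ν : UnitFun →L[ℝ] ℝ) (f : UnitFun) (s : ℝ) :
    HasDerivAt (fun s => semi ν s f) (trapOp ν (semi ν s f)) s := by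
  have := (hasDerivAt_semi' ν s).clm_apply (hasDerivAt_const s f)
  simpa using this

/-- The function `x ↦ e^{-t x}`, the probability of no jump during a time `t` at `x`. -/
def expFun (t : ℝ) : UnitFun := ⟨fun x => Real.exp (-t * x), by fun_prop⟩

@[simp] lemma expFun_apply (t : ℝ) (x : unitInterval) : expFun t x = Real.exp (-t * x) := rfl

lemma expFun_nonneg (t : ℝ) : 0 ≤ expFun t := fun _ => (Real.exp_pos _).le

lemma expFun_le_one {t : ℝ} (ht : 0 ≤ t) : expFun t ≤ 1 := fun x => by
  have := mul_nonneg ht x.2.1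
  simpa using this

/-! ### Regeneration at the first jump -/

section Regeneration

variable {n : ℕ} {x : ℕ → ℝ}

lemma measurable_jumpChain (k : ℕ) : Measurable fun w : Source n => jumpChain w k := by
  induction k with
  | zero => exact measurable_fst
  | succ k ih =>
    have h : Measurable fun w : Source n => (jumpChain w k, (w.2 k).2) :=
      ih.prodMk (measurable_snd.comp ((measurable_pi_apply k).comp measurable_snd))
    exact (Measurable.of_discrete
      (f := fun p : Fin (n + 2) × Fin (n + 1) => p.1.succAbove p.2)).comp h

lemma measurable_jumpTime (x : ℕ → ℝ) (k : ℕ) : Measurable fun w : Source n => jumpTime x w k := by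
  refine Finset.measurable_fun_sum _ fun l _ => ?_
  refine (measurable_fst.comp ((measurable_pi_apply l).comp measurable_snd)).div ?_
  exact (Measurable.of_discrete (f := fun i : Fin (n + 2) => exitRate n x i)).comp
    (measurable_jumpChain l)

lemma measurableSet_quiet (x : ℕ → ℝ) (t : ℝ) :
    MeasurableSet {p : ℝ × Source n | Quiet x t p.1 p.2} := by
  have : {p : ℝ × Source n | Quiet x t p.1 p.2} = ⋃ k : ℕ,
      {p | jumpTime x p.2 k ≤ p.1} ∩ {p | p.1 + t < jumpTime x p.2 (k + 1)} := by
    ext p; simp [Quiet]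
  rw [this]
  exact MeasurableSet.iUnion fun k =>
    (measurableSet_le ((measurable_jumpTime x k).comp measurable_snd) measurable_fst).inter
      (measurableSet_lt (measurable_fst.add_const t)
        ((measurable_jumpTime x (k + 1)).comp measurable_snd))

/-- The probability that the walk started at `i` does not jump during `(s, s + t]`. -/
def quietProb (x : ℕ → ℝ) (t : ℝ) (i : Fin (n + 2)) (s : ℝ) : ℝ :=
  (seqLaw n).real {q | Quiet x t s ((i, q) : Source n)}

lemma measurable_quietProb (x : ℕ → ℝ) (t : ℝ) (i : Fin (n + 2)) :
    Measurable (quietProb x t i) := by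
  have h : MeasurableSet {p : ℝ × (ℕ → Marks n) | Quiet x t p.1 ((i, p.2) : Source n)} :=
    (measurable_fst.prodMk (measurable_const.prodMk measurable_snd)) (measurableSet_quiet x t)
  exact (measurable_measure_prodMk_left h).ennreal_toReal

lemma measurableSet_quiet_right (x : ℕ → ℝ) (t s : ℝ) (i : Fin (n + 2)) :
    MeasurableSet {q | Quiet x t s ((i, q) : Source n)} :=
  (measurable_const.prodMk (measurable_const.prodMk measurable_id)) (measurableSet_quiet x t)

lemma quietProb_nonneg (t : ℝ) (i : Fin (n + 2)) (s : ℝ) : 0 ≤ quietProb x t i s :=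
  measureReal_nonneg

lemma quietProb_le_one (t : ℝ) (i : Fin (n + 2)) (s : ℝ) : quietProb x t i s ≤ 1 :=
  measureReal_le_one

/-- The integrand of the first-jump decomposition, as a function of the first holding time `ξ` in
units of its mean: if the first jump occurs before time `s`, the average over its target of `u` at
the remaining time; otherwise the indicator of a jump after time `s + t`. -/
def firstJump (x : ℕ → ℝ) (t : ℝ) (u : Fin (n + 2) → ℝ → ℝ) (i : Fin (n + 2)) (s ξ : ℝ) : ℝ :=
  if ξ ≤ exitRate n x i * s then
    ((n : ℝ) + 1)⁻¹ * ∑ c, u (i.succAbove c) (s - ξ / exitRate n x i)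
  else if exitRate n x i * (s + t) < ξ then 1 else 0

/-- The first-jump decomposition of the probability of not jumping during a time window. -/
lemma quietProb_eq (hr : ∀ i, 0 < exitRate n x i) {t s : ℝ} (hs : 0 ≤ s) (ht : 0 ≤ t)
    (i : Fin (n + 2)) :
    quietProb x t i s = ∫ ξ, firstJump x t (quietProb x t) i s ξ ∂(expMeasure 1) := by
  set A := {q | Quiet x t s ((i, q) : Source n)} with hA
  have hAm : MeasurableSet A := measurableSet_quiet_right x t s i
  have hBm : MeasurableSet (consSeq ⁻¹' A) := measurable_consSeq hAm
  have h1 : quietProb x t i s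
      = ∫ a, (seqLaw n).real (Prod.mk a ⁻¹' (consSeq ⁻¹' A)) ∂(markLaw n) := by
    have h := map_consSeq_infinitePi (markLaw n)
    rw [quietProb, ← hA, measureReal_def, seqLaw, ← h, Measure.map_apply measurable_consSeq hAm,
      Measure.prod_apply hBm, ← integral_toReal (measurable_measure_prodMk_left hBm).aemeasurable
        (Eventually.of_forall fun a => measure_lt_top _ _), h]
    rfl
  have h2 : ∀ a : Marks n, (seqLaw n).real (Prod.mk a ⁻¹' (consSeq ⁻¹' A))
      = if a.1 ≤ exitRate n x i * s then
          quietProb x t (i.succAbove a.2) (s - a.1 / exitRate n x i)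
        else if exitRate n x i * (s + t) < a.1 then 1 else 0 := by
    intro a
    have h3 : Prod.mk a ⁻¹' (consSeq ⁻¹' A) =ᵐ[seqLaw n]
        {q | if a.1 ≤ exitRate n x i * s then
            Quiet x t (s - a.1 / exitRate n x i) ((i.succAbove a.2, q) : Source n)
          else exitRate n x i * (s + t) < a.1} := by
      filter_upwards [ae_seqLaw_pos n] with q hq
      exact propext (quiet_cons hr hs ht i a hq)
    rw [measureReal_congr h3]
    by_cases h4 : a.1 ≤ exitRate n x i * s
    · simp [h4, quietProb]
    · by_cases h5 : exitRate n x i * (s + t) < a.1 <;> simp [h4, h5]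
  have hint : Integrable (fun a : Marks n => (seqLaw n).real (Prod.mk a ⁻¹' (consSeq ⁻¹' A)))
      (markLaw n) :=
    Integrable.of_bound (measurable_measure_prodMk_left hBm).ennreal_toReal.aestronglyMeasurable 1
      (Eventually.of_forall fun a => by
        rw [Real.norm_of_nonneg measureReal_nonneg]; exact measureReal_le_one)
  rw [h1, markLaw, integral_prod _ hint]
  refine integral_congr_ae (Eventually.of_forall fun ξ => ?_)
  simp only [h2]
  rw [PMF.integral_eq_sum]
  simp only [firstJump, PMF.uniformOfFintype_apply, Fintype.card_fin, smul_eq_mul]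
  have hc : (((n + 1 : ℕ) : ℝ≥0∞)⁻¹).toReal = ((n : ℝ) + 1)⁻¹ := by
    rw [ENNReal.toReal_inv, ENNReal.toReal_natCast, Nat.cast_succ]
  rw [hc, ← Finset.mul_sum]
  have hn : ((n : ℝ) + 1) ≠ 0 := by positivity
  split_ifs
  · rfl
  · simp [hn]
  · simp

lemma integrable_firstJump {t : ℝ} {s : ℝ} (hr : ∀ i, 0 < exitRate n x i)
    {u : Fin (n + 2) → ℝ → ℝ} (hu : ∀ i, Measurable (u i))
    (hb : ∀ i, ∀ s, 0 ≤ s → |u i s| ≤ 1) (i : Fin (n + 2)) :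
    Integrable (firstJump x t u i s) (expMeasure 1) := by
  refine Integrable.of_bound (C := 1) (Measurable.aestronglyMeasurable ?_)
    (Eventually.of_forall fun ξ => ?_)
  · refine Measurable.ite (measurableSet_le measurable_id measurable_const) ?_
      (Measurable.ite (measurableSet_lt measurable_const measurable_id) measurable_const
        measurable_const)
    refine measurable_const.mul (Finset.measurable_fun_sum _ fun c _ => ?_)
    exact (hu _).comp (measurable_const.sub (measurable_id.div_const _))
  · rw [firstJump, Real.norm_eq_abs]
    split_ifs with h
    · have h0 : 0 ≤ s - ξ / exitRate n x i := by
        rw [sub_nonneg, div_le_iff₀ (hr i), mul_comm]; exact h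
      rw [abs_mul, abs_of_nonneg (by positivity : (0 : ℝ) ≤ ((n : ℝ) + 1)⁻¹)]
      calc _ ≤ ((n : ℝ) + 1)⁻¹ * ∑ c : Fin (n + 1), (1 : ℝ) := by
            gcongr
            exact (Finset.abs_sum_le_sum_abs _ _).trans
              (Finset.sum_le_sum fun c _ => hb _ _ h0)
        _ = 1 := by
            have hn : ((n : ℝ) + 1) ≠ 0 := by positivity
            simp [hn]
    · simp
    · simp

lemma measureReal_expMeasure_Iic {a : ℝ} (ha : 0 ≤ a) :
    (expMeasure 1).real (Iic a) = 1 - Real.exp (-a) := by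
  rw [← cdf_eq_real, cdf_expMeasure_eq one_pos, if_pos ha, one_mul]

/-- The first-jump equation has at most one bounded solution: on a bounded time interval it is a
contraction, the factor being a bound for the probability of a jump in this interval. -/
lemma eq_of_firstJump (hr : ∀ i, 0 < exitRate n x i) {t : ℝ}
    {u v : Fin (n + 2) → ℝ → ℝ} (hu : ∀ i, Measurable (u i)) (hv : ∀ i, Measurable (v i))
    (hub : ∀ i, ∀ s, 0 ≤ s → |u i s| ≤ 1) (hvb : ∀ i, ∀ s, 0 ≤ s → |v i s| ≤ 1)
    (hueq : ∀ i, ∀ s, 0 ≤ s → u i s = ∫ ξ, firstJump x t u i s ξ ∂(expMeasure 1))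
    (hveq : ∀ i, ∀ s, 0 ≤ s → v i s = ∫ ξ, firstJump x t v i s ξ ∂(expMeasure 1))
    (i : Fin (n + 2)) {s : ℝ} (hs : 0 ≤ s) : u i s = v i s := by
  set R : ℝ := ∑ i, exitRate n x i with hR
  have hiR : ∀ i, exitRate n x i ≤ R := fun i =>
    Finset.single_le_sum (f := fun i => exitRate n x i) (fun j _ => (hr j).le) (Finset.mem_univ i)
  set κ : ℝ := 1 - Real.exp (-(R * s)) with hκ
  have hR0 : 0 ≤ R := (hr 0).le.trans (hiR 0)
  have hκ0 : 0 ≤ κ := by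
    rw [hκ, sub_nonneg, Real.exp_le_one_iff]
    nlinarith
  have hκ1 : κ < 1 := by rw [hκ]; linarith [Real.exp_pos (-(R * s))]
  have key : ∀ k : ℕ, ∀ i, ∀ s', 0 ≤ s' → s' ≤ s → |u i s' - v i s'| ≤ 2 * κ ^ k := by
    intro k
    induction k with
    | zero =>
      intro i s' hs' _
      have h1 := abs_sub (u i s') (v i s')
      linarith [hub i s' hs', hvb i s' hs', h1]
    | succ k ih =>
      intro i s' hs' hs's
      have hri := hr i
      rw [hueq i s' hs', hveq i s' hs', ← integral_sub (integrable_firstJump hr hu hub i)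
        (integrable_firstJump hr hv hvb i)]
      have hle : ∀ᵐ ξ ∂(expMeasure 1), ‖firstJump x t u i s' ξ - firstJump x t v i s' ξ‖
          ≤ (Iic (exitRate n x i * s')).indicator (fun _ => 2 * κ ^ k) ξ := by
        filter_upwards [expMeasure_one_ae_pos] with ξ hξ
        by_cases h : ξ ≤ exitRate n x i * s'
        · have hd : 0 ≤ s' - ξ / exitRate n x i := by
            rw [sub_nonneg, div_le_iff₀ hri, mul_comm]; exact h
          have hd2 : s' - ξ / exitRate n x i ≤ s := by
            have := div_nonneg hξ.le hri.le
            linarith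
          rw [indicator_of_mem (mem_Iic.2 h), firstJump, firstJump, if_pos h, if_pos h, ← mul_sub,
            ← Finset.sum_sub_distrib, Real.norm_eq_abs, abs_mul,
            abs_of_nonneg (by positivity : (0 : ℝ) ≤ ((n : ℝ) + 1)⁻¹)]
          calc _ ≤ ((n : ℝ) + 1)⁻¹ * ∑ c : Fin (n + 1), 2 * κ ^ k := by
                gcongr
                exact (Finset.abs_sum_le_sum_abs _ _).trans
                  (Finset.sum_le_sum fun c _ => ih _ _ hd hd2)
            _ = 2 * κ ^ k := by
                have hn : ((n : ℝ) + 1) ≠ 0 := by positivity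
                simp only [Finset.sum_const, Finset.card_univ, Fintype.card_fin, nsmul_eq_mul]
                push_cast
                field_simp
        · rw [indicator_of_notMem (by simpa using h), firstJump, firstJump, if_neg h, if_neg h,
            sub_self, norm_zero]
      calc |∫ ξ, (firstJump x t u i s' ξ - firstJump x t v i s' ξ) ∂(expMeasure 1)|
          ≤ ∫ ξ, (Iic (exitRate n x i * s')).indicator (fun _ => 2 * κ ^ k) ξ ∂(expMeasure 1) :=
            norm_integral_le_of_norm_le ((integrable_const _).indicator measurableSet_Iic) hle
        _ = (1 - Real.exp (-(exitRate n x i * s'))) * (2 * κ ^ k) := by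
            rw [integral_indicator_const _ measurableSet_Iic,
              measureReal_expMeasure_Iic (mul_nonneg hri.le hs'), smul_eq_mul]
        _ ≤ κ * (2 * κ ^ k) := by
            refine mul_le_mul_of_nonneg_right ?_ (by positivity)
            rw [hκ]
            have := mul_le_mul (hiR i) hs's hs' hR0
            gcongr
        _ = 2 * κ ^ (k + 1) := by ring
  have hlim : Tendsto (fun k : ℕ => 2 * κ ^ k) atTop (𝓝 (2 * 0)) :=
    (tendsto_pow_atTop_nhds_zero_of_lt_one hκ0 hκ1).const_mul 2
  rw [mul_zero] at hlim
  have h0 := ge_of_tendsto' hlim fun k => key k i s hs le_rfl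
  exact sub_eq_zero.1 (abs_nonpos_iff.1 h0)

end Regeneration

/-! ### The correlation function of the walk and the semigroup -/

/-- The parameter of the site `i` as a point of `[0, 1]`; parameters outside of `[0, 1]`, which do
not occur for the sites of the walk, are projected onto it. -/
def site (x : ℕ → ℝ) (i : ℕ) : unitInterval := projIcc 0 1 zero_le_one (x i)

lemma coe_site {x : ℕ → ℝ} {i : ℕ} (h0 : 0 ≤ x i) (h1 : x i ≤ 1) : (site x i : ℝ) = x i := by
  rw [site, projIcc_of_mem _ ⟨h0, h1⟩]

/-- The empirical mean of the first `N` parameters. -/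
def empMean (N : ℕ) (x : ℕ → ℝ) : UnitFun →L[ℝ] ℝ :=
  (N : ℝ)⁻¹ • ∑ i ∈ Finset.range N, ContinuousMap.evalCLM ℝ (site x i)

lemma empMean_apply (N : ℕ) (x : ℕ → ℝ) (f : UnitFun) :
    empMean N x f = (N : ℝ)⁻¹ * ∑ i ∈ Finset.range N, f (site x i) := by
  simp [empMean]

lemma isMean_empMean {N : ℕ} (hN : 0 < N) (x : ℕ → ℝ) : IsMean (empMean N x) := by
  constructor
  · intro f hf
    rw [empMean_apply]
    exact mul_nonneg (by positivity) (Finset.sum_nonneg fun i _ => hf _)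
  · have : (N : ℝ) ≠ 0 := by positivity
    rw [empMean_apply]
    simp [this]

section

variable {n : ℕ} {x : ℕ → ℝ}

/-- The semigroup of the empirical mean solves the first-jump equation. This is the Kolmogorov
backward equation in integrated form. -/
lemma semi_site_eq (hx0 : ∀ i < n + 2, 0 < x i) (hx1 : ∀ i < n + 2, x i ≤ 1)
    {f : UnitFun} {t : ℝ} (ht : 0 ≤ t)
    (hf : ∀ i : Fin (n + 2), f (site x i) = Real.exp (-(exitRate n x i * t)))
    (i : Fin (n + 2)) {s : ℝ} (hs : 0 ≤ s) :
    semi (empMean (n + 2) x) s f (site x i) = ∫ ξ, firstJump x t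
      (fun j s => semi (empMean (n + 2) x) s f (site x j)) i s ξ ∂(expMeasure 1) := by
  set ν := empMean (n + 2) x with hν
  set v : Fin (n + 2) → ℝ → ℝ := fun j s => semi ν s f (site x j) with hv
  have hr : 0 < exitRate n x i := by
    rw [exitRate]; have := hx0 i i.2; positivity
  set r := exitRate n x i with hrdef
  have hvd : ∀ s, HasDerivAt (v i)
      (r * (((n : ℝ) + 1)⁻¹ * ∑ c, v (i.succAbove c) s - v i s)) s := by
    intro s
    have h1 := (ContinuousMap.evalCLM ℝ (site x i)).hasFDerivAt.comp_hasDerivAt s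
      (hasDerivAt_semi_apply ν f s)
    convert! h1 using 1
    rw [ContinuousMap.evalCLM_apply, trapOp_apply, ContinuousMap.sub_apply,
      ContinuousMap.smul_apply, ContinuousMap.mul_apply, coord_apply,
      coe_site (hx0 i i.2).le (hx1 i i.2), hν, empMean_apply, Finset.sum_range, ← hν,
      Fin.sum_univ_succAbove _ i, hrdef, exitRate, smul_eq_mul]
    have hn1 : ((n : ℝ) + 1) ≠ 0 := by positivity
    have hn2 : ((n : ℝ) + 2) ≠ 0 := by positivity
    push_cast
    simp only [hv]
    field_simp
    ring
  have hvc : ∀ j, Continuous (v j) := fun j =>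
    (continuous_eval_const (site x j)).comp
      ((ContinuousLinearMap.apply ℝ UnitFun f).continuous.comp (continuous_semi ν))
  have hrs : 0 ≤ r * s := mul_nonneg hr.le hs
  have hrt : 0 ≤ r * (s + t) := by positivity
  set a : ℝ → ℝ := fun ξ => ((n : ℝ) + 1)⁻¹ * ∑ c, v (i.succAbove c) (s - ξ / r) with ha
  have hac : Continuous a := by
    refine continuous_const.mul (continuous_finsetSum _ fun c _ => (hvc _).comp ?_)
    fun_prop
  -- either the first jump occurs before `s`, or the first holding time exceeds the window
  have hsplit : ∀ ξ, firstJump x t v i s ξ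
      = (Iic (r * s)).indicator a ξ + (Ioi (r * (s + t))).indicator (fun _ => (1 : ℝ)) ξ := by
    intro ξ
    rw [firstJump, ← hrdef]
    by_cases h : ξ ≤ r * s
    · have h2 : ¬ r * (s + t) < ξ := by nlinarith
      simp [h, h2, ha, indicator]
    · by_cases h2 : r * (s + t) < ξ <;> simp [h, h2, indicator]
  have hI1 : ∫ ξ, (Iic (r * s)).indicator a ξ ∂(expMeasure 1)
      = ∫ ξ in (0 : ℝ)..(r * s), Real.exp (-ξ) * a ξ := by
    rw [integral_expMeasure_one, intervalIntegral.integral_of_le hrs,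
      ← integral_indicator measurableSet_Ioi, ← integral_indicator measurableSet_Ioc]
    congr 1
    ext ξ
    by_cases h1 : 0 < ξ <;> by_cases h2 : ξ ≤ r * s <;> simp [indicator, h1, h2]
  have hint1 : Integrable ((Iic (r * s)).indicator a) (expMeasure 1) := by
    obtain ⟨C, hC⟩ := (isCompact_Icc (a := (0 : ℝ)) (b := r * s)).exists_bound_of_continuousOn
      hac.continuousOn
    refine Integrable.of_bound (C := max C 0)
      (hac.measurable.indicator measurableSet_Iic).aestronglyMeasurable ?_
    filter_upwards [expMeasure_one_ae_pos] with ξ hξ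
    by_cases h : ξ ≤ r * s
    · rw [indicator_of_mem (mem_Iic.2 h)]
      exact (hC ξ ⟨hξ.le, h⟩).trans (le_max_left _ _)
    · rw [indicator_of_notMem (by simpa using h), norm_zero]
      exact le_max_right _ _
  have hI2 : ∫ ξ, (Ioi (r * (s + t))).indicator (fun _ => (1 : ℝ)) ξ ∂(expMeasure 1)
      = Real.exp (-(r * (s + t))) := by
    rw [integral_indicator_const _ measurableSet_Ioi, ← compl_Iic,
      measureReal_compl measurableSet_Iic, measureReal_expMeasure_Iic hrt]
    simp
  simp only [hsplit]
  rw [integral_add hint1 ((integrable_const _).indicator measurableSet_Ioi), hI1, hI2]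
  -- `e^{-ξ} v_i(s - ξ / r)` is a primitive of `- e^{-ξ} a(ξ)`
  have hder : ∀ ξ ∈ uIcc 0 (r * s), HasDerivAt (fun ξ => -(Real.exp (-ξ) * v i (s - ξ / r)))
      (Real.exp (-ξ) * a ξ) ξ := by
    intro ξ _
    have h1 : HasDerivAt (fun ξ => s - ξ / r) (-(1 / r)) ξ :=
      ((hasDerivAt_id ξ).div_const r).const_sub s
    have h2 := (hvd (s - ξ / r)).comp ξ h1
    have h3 : HasDerivAt (fun ξ : ℝ => Real.exp (-ξ)) (-Real.exp (-ξ)) ξ := by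
      simpa using (hasDerivAt_neg ξ).exp
    convert! (h3.mul h2).neg using 1
    simp only [ha, Function.comp]
    field_simp
    ring
  have hcont : Continuous fun ξ => Real.exp (-ξ) * a ξ := by fun_prop
  rw [intervalIntegral.integral_eq_sub_of_hasDerivAt hder (hcont.intervalIntegrable _ _)]
  have h0 : v i 0 = Real.exp (-(r * t)) := by
    rw [hv, hrdef]
    simp only [semi_zero]
    exact hf i
  have h1 : s - r * s / r = 0 := by field_simp; ring
  rw [h1, h0, ← Real.exp_add]
  simp only [neg_zero, Real.exp_zero, zero_div, sub_zero, one_mul, hv]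
  ring_nf

/-- The correlation function of the walk is the empirical mean of its semigroup, applied to the
probability of not jumping during a time `t`. The factor `(N - 1) / N` of the rates appears only in
this probability, since the empirical mean lets the process jump to its current site. -/
theorem corr_eq_empMean_semi (hx0 : ∀ i < n + 2, 0 < x i) (hx1 : ∀ i < n + 2, x i ≤ 1)
    {t tw : ℝ} (ht : 0 ≤ t) (htw : 0 ≤ tw) :
    corr (n + 2) x t tw = empMean (n + 2) x
      (semi (empMean (n + 2) x) tw (expFun (((n : ℝ) + 1) / ((n : ℝ) + 2) * t))) := by
  have hr : ∀ i : Fin (n + 2), 0 < exitRate n x i := fun i => by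
    rw [exitRate]; have := hx0 i i.2; positivity
  have hmean : IsMean (empMean (n + 2) x) := isMean_empMean (by omega) x
  set t' := ((n : ℝ) + 1) / ((n : ℝ) + 2) * t with ht'
  have ht'0 : 0 ≤ t' := by positivity
  set f := expFun t' with hf
  have hquiet : ∀ i : Fin (n + 2), quietProb x t i tw
      = semi (empMean (n + 2) x) tw f (site x i) := by
    intro i
    refine eq_of_firstJump hr (t := t) (u := quietProb x t)
      (v := fun j s => semi (empMean (n + 2) x) s f (site x j))
      (fun j => measurable_quietProb x t j) (fun j => ?_) (fun j s _ => ?_) (fun j s hs => ?_)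
      (fun j s hs => quietProb_eq hr hs ht j) (fun j s hs => ?_) i htw
    · exact ((continuous_eval_const (site x j)).comp
        ((ContinuousLinearMap.apply ℝ UnitFun f).continuous.comp
          (continuous_semi _))).measurable
    · rw [abs_of_nonneg (quietProb_nonneg t j s)]
      exact quietProb_le_one t j s
    · have h1 : 0 ≤ semi (empMean (n + 2) x) s f (site x j) :=
        hmean.semi_nonneg hs (expFun_nonneg t') (site x j)
      have h2 : semi (empMean (n + 2) x) s f (site x j) ≤ 1 :=
        hmean.semi_le_one hs (expFun_le_one ht'0) (site x j)
      rwa [abs_of_nonneg h1]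
    · refine semi_site_eq hx0 hx1 ht (fun k => ?_) j hs
      rw [hf, expFun_apply, coe_site (hx0 k k.2).le (hx1 k k.2), exitRate, ht']
      ring_nf
  have hae : {w : Source n | ∀ s ∈ Icc tw (tw + t), walk x w s = walk x w tw}
      =ᵐ[sourceLaw n] {w | Quiet x t tw w} := by
    have h1 : ∀ᵐ w ∂(sourceLaw n), ∀ l, 0 < (w.2 l).1 :=
      Measure.quasiMeasurePreserving_snd.ae (ae_seqLaw_pos n)
    have h2 : ∀ᵐ w ∂(sourceLaw n),
        Tendsto (fun k => ∑ l ∈ Finset.range k, (w.2 l).1) atTop atTop :=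
      Measure.quasiMeasurePreserving_snd.ae (ae_seqLaw_tendsto n)
    filter_upwards [h1, h2] with w hw1 hw2
    exact propext (forall_walk_eq_iff_quiet (strictMono_jumpTime hr hw1)
      (tendsto_jumpTime hr hw1 hw2) ht htw)
  have hm : MeasurableSet {w : Source n | Quiet x t tw w} :=
    (measurable_const.prodMk measurable_id) (measurableSet_quiet x t)
  rw [corr, measureReal_congr hae, measureReal_def, sourceLaw_eq, Measure.prod_apply hm,
    ← integral_toReal (measurable_measure_prodMk_left hm).aemeasurable
      (Eventually.of_forall fun a => measure_lt_top _ _), PMF.integral_eq_sum, empMean_apply,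
      Finset.sum_range, Finset.mul_sum]
  refine Finset.sum_congr rfl fun i _ => ?_
  rw [← hquiet i, PMF.uniformOfFintype_apply, ENNReal.toReal_inv, Fintype.card_fin,
    ENNReal.toReal_natCast]
  rfl

end

/-! ### Concentration of the Poisson distribution -/

/-- The variance of the Poisson distribution. -/
lemma hasSum_poisson_sq (r : ℝ≥0) :
    HasSum (fun k : ℕ => Real.exp (-r) * (r : ℝ) ^ k / k.factorial * ((k : ℝ) - r) ^ 2) r := by
  set p : ℕ → ℝ := fun k => Real.exp (-r) * (r : ℝ) ^ k / k.factorial with hp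
  have h0 : HasSum p 1 := hasSum_one_poissonMeasure r
  have hstep : ∀ k : ℕ, ((k : ℝ) + 1) * p (k + 1) = r * p k := by
    intro k
    have h1 : ((k : ℝ) + 1) ≠ 0 := by positivity
    have h2 : (k.factorial : ℝ) ≠ 0 := by positivity
    simp only [hp, Nat.factorial_succ, pow_succ]
    push_cast
    field_simp
  have h1 : HasSum (fun k : ℕ => (k : ℝ) * p k) r := by
    rw [← hasSum_nat_add_iff' 1]
    simpa [hstep] using h0.mul_left (r : ℝ)
  have h2 : HasSum (fun k : ℕ => (k : ℝ) ^ 2 * p k) (r * (r + 1)) := by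
    rw [← hasSum_nat_add_iff' 1]
    have h := (h1.add h0).mul_left (r : ℝ)
    have hfun : (fun k : ℕ => ((k + 1 : ℕ) : ℝ) ^ 2 * p (k + 1))
        = fun k : ℕ => (r : ℝ) * ((k : ℝ) * p k + p k) := by
      funext k
      push_cast
      linear_combination ((k : ℝ) + 1) * hstep k
    rw [hfun]
    simpa using h
  have h3 := (h2.sub (h1.mul_left (2 * (r : ℝ)))).add (h0.mul_left ((r : ℝ) ^ 2))
  have hfun : (fun k : ℕ => p k * ((k : ℝ) - r) ^ 2)
      = fun k : ℕ => (k : ℝ) ^ 2 * p k - 2 * r * (k * p k) + (r : ℝ) ^ 2 * p k := by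
    funext k
    ring
  rw [hfun]
  convert! h3 using 1
  ring

/-- Chebyshev's inequality for the Poisson distribution. -/
lemma poissonMeasure_abs_sub_ge_le (r : ℝ≥0) {δ : ℝ} (hδ : 0 < δ) :
    poissonMeasure r {k : ℕ | δ ≤ |(k : ℝ) - r|} ≤ ENNReal.ofReal (r / δ ^ 2) := by
  have hs := hasSum_poisson_sq r
  have hint : Integrable (fun k : ℕ => ((k : ℝ) - r) ^ 2) (poissonMeasure r) := by
    rw [integrable_poissonMeasure_iff]
    refine hs.summable.congr fun k => ?_
    rw [Real.norm_of_nonneg (sq_nonneg _)]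
  have hval : ∫ k, ((k : ℝ) - r) ^ 2 ∂(poissonMeasure r) = r := by
    rw [integral_poissonMeasure]
    exact hs.tsum_eq
  have h := mul_meas_ge_le_integral_of_nonneg (μ := poissonMeasure r)
    (Eventually.of_forall fun k : ℕ => sq_nonneg ((k : ℝ) - r)) hint (δ ^ 2)
  rw [hval] at h
  have hset : {k : ℕ | δ ^ 2 ≤ ((k : ℝ) - r) ^ 2} = {k : ℕ | δ ≤ |(k : ℝ) - r|} := by
    ext k
    simp only [mem_ofPred_eq]
    rw [← sq_abs ((k : ℝ) - r), sq_le_sq₀ hδ.le (abs_nonneg _)]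
  rw [hset] at h
  rw [ENNReal.le_ofReal_iff_toReal_le (measure_ne_top _ _) (by positivity),
    le_div_iff₀ (by positivity), mul_comm]
  exact h

lemma intensity_Ici {α : ℝ} (hα : 0 < α) (e : ℝ) :
    intensity α (Ici e) = ENNReal.ofReal (Real.exp (-α * e)) := by
  have h1 : IntegrableOn (fun u => α * Real.exp (-α * u)) (Ioi e) :=
    (integrableOn_exp_mul_Ioi (by linarith) e).const_mul α
  rw [intensity, withDensity_apply _ measurableSet_Ici, setLIntegral_congr Ioi_ae_eq_Ici.symm,
    ← ofReal_integral_eq_lintegral_ofReal h1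
      (Eventually.of_forall fun u => mul_nonneg hα.le (Real.exp_nonneg _)),
    integral_const_mul, integral_exp_mul_Ioi (by linarith)]
  congr 1
  field_simp

lemma sum_dirac_Ici (E : ℕ → ℝ) (e : ℝ) :
    (Measure.sum fun i => Measure.dirac (E i)) (Ici e) = ({i | e ≤ E i}.encard : ℝ≥0∞) := by
  rw [Measure.sum_apply _ measurableSet_Ici, ← ENNReal.tsum_set_one,
    tsum_subtype {i | e ≤ E i} fun _ => (1 : ℝ≥0∞)]
  refine tsum_congr fun i => ?_
  rw [Measure.dirac_apply' _ measurableSet_Ici]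
  rfl

/-- The level above which the expected number of points is `n ^ 4`. This power makes the probability
of a deviation by `n ^ 3` summable, while the numbers at consecutive levels are still asymptotic to
each other. -/
def level (α : ℝ) (n : ℕ) : ℝ := -(4 / α) * Real.log n

lemma exp_level {α : ℝ} (hα : 0 < α) {n : ℕ} (hn : 0 < n) :
    Real.exp (-α * level α n) = (n : ℝ) ^ 4 := by
  have : (0 : ℝ) < n := by positivity
  rw [level, show -α * (-(4 / α) * Real.log n) = Real.log n * (4 : ℕ) by push_cast; field_simp,
    Real.exp_mul, Real.exp_log this, Real.rpow_natCast]

/-- The Borel-Cantelli lemma along the levels. Finiteness is recorded separately because `numSites`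
is `0` by convention for infinitely many points. -/
lemma ae_eventually_numSites_level {Ω : Type*} [MeasurableSpace Ω] {P : Measure Ω}
    {α : ℝ} (hα : 0 < α) {E : ℕ → Ω → ℝ} (hE : IsLandscape P α E) :
    ∀ᵐ ω ∂P, ∀ᶠ n : ℕ in atTop, {i | level α n ≤ E i ω}.Finite ∧
      |(numSites (fun i => E i ω) (level α n) : ℝ) - (n : ℝ) ^ 4| < (n : ℝ) ^ 3 := by
  set good : ℕ → Set ℝ≥0∞ := fun n => Nat.cast '' {k : ℕ | |(k : ℝ) - (n : ℝ) ^ 4| < (n : ℝ) ^ 3}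
  set M : Ω → Measure ℝ := fun ω => Measure.sum fun i => Measure.dirac (E i ω)
  have hgood : ∀ n, MeasurableSet (good n) := fun n => ((Set.to_countable _).image _).measurableSet
  have hbound : ∀ n : ℕ, 0 < n → P {ω | M ω (Ici (level α n)) ∉ good n}
      ≤ ENNReal.ofReal (1 / (n : ℝ) ^ 2) := by
    intro n hn
    have hI : intensity α (Ici (level α n)) = ENNReal.ofReal ((n : ℝ) ^ 4) := by
      rw [intensity_Ici hα, exp_level hα hn]
    have h := hE.poisson.poisson (Ici (level α n)) measurableSet_Ici (by rw [hI]; simp)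
    have hmeas : Measurable fun ω => M ω (Ici (level α n)) :=
      (Measure.measurable_coe measurableSet_Ici).comp hE.poisson.measurable
    have h2 : P {ω | M ω (Ici (level α n)) ∉ good n}
        = (P.map fun ω => M ω (Ici (level α n))) (good n)ᶜ := by
      rw [Measure.map_apply hmeas (hgood n).compl]; rfl
    rw [h2, h, Measure.map_apply (Measurable.of_discrete) (hgood n).compl, hI]
    set r : ℝ≥0 := (ENNReal.ofReal ((n : ℝ) ^ 4)).toNNReal
    have hr : (r : ℝ) = (n : ℝ) ^ 4 := by
      show (ENNReal.ofReal ((n : ℝ) ^ 4)).toReal = _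
      rw [ENNReal.toReal_ofReal (by positivity)]
    have hset : (Nat.cast : ℕ → ℝ≥0∞) ⁻¹' (good n)ᶜ = {k : ℕ | (n : ℝ) ^ 3 ≤ |(k : ℝ) - r|} := by
      ext k
      simp [good, hr]
    rw [hset]
    refine (poissonMeasure_abs_sub_ge_le r (by positivity)).trans (ENNReal.ofReal_le_ofReal ?_)
    rw [hr]
    have : (0 : ℝ) < n := by positivity
    refine le_of_eq ?_
    field_simp
  have hsum : ∑' n : ℕ, P {ω | M ω (Ici (level α (n + 1))) ∉ good (n + 1)} ≠ ∞ := by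
    have hs : Summable fun n : ℕ => 1 / ((n + 1 : ℕ) : ℝ) ^ 2 :=
      (summable_nat_add_iff 1).2 (Real.summable_one_div_nat_pow.2 one_lt_two)
    refine ne_top_of_le_ne_top hs.tsum_ofReal_ne_top (ENNReal.tsum_le_tsum fun n => ?_)
    exact_mod_cast hbound (n + 1) n.succ_pos
  have hBC := ae_eventually_notMem hsum
  filter_upwards [hBC] with ω hω
  rw [← map_add_atTop_eq_nat 1, eventually_map]
  filter_upwards [hω] with n hn
  obtain ⟨k, hk, hkn⟩ := not_not.1 hn
  have hcard : ((k : ℕ∞) : ℝ≥0∞) = ({i | level α (n + 1 : ℕ) ≤ E i ω}.encard : ℝ≥0∞) := by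
    rw [← sum_dirac_Ici, ← hkn]; rfl
  have hcard2 : {i | level α (n + 1 : ℕ) ≤ E i ω}.encard = k := by
    exact_mod_cast hcard.symm
  refine ⟨finite_of_encard_eq_coe hcard2, ?_⟩
  rw [numSites, ncard, hcard2]
  exact hk

/-! ### The number of sites of a typical landscape -/

section Typical

variable {α : ℝ} {E : ℕ → ℝ}

/-- The properties of a landscape, valid almost surely, on which the convergence of the correlation
functions depends. -/
structure IsTypical (α : ℝ) (E : ℕ → ℝ) : Prop where
  strictAnti : StrictAnti E
  near : ∀ᶠ n : ℕ in atTop, {i | level α n ≤ E i}.Finite ∧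
    |(numSites E (level α n) : ℝ) - (n : ℝ) ^ 4| < (n : ℝ) ^ 3

lemma tendsto_level (hα : 0 < α) : Tendsto (level α) atTop atBot := by
  have h : Tendsto (fun n : ℕ => Real.log n) atTop atTop :=
    Real.tendsto_log_atTop.comp tendsto_natCast_atTop_atTop
  exact h.const_mul_atTop_of_neg (by have : 0 < 4 / α := by positivity
                                     linarith)

lemma IsTypical.finite (hE : IsTypical α E) (hα : 0 < α) (e : ℝ) : {i | e ≤ E i}.Finite := by
  obtain ⟨n, hn1, hn2⟩ := (hE.near.and ((tendsto_level hα).eventually_le_atBot e)).exists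
  exact hn1.1.subset fun i hi => hn2.trans hi

lemma IsTypical.lt_numSites_iff (hE : IsTypical α E) (hα : 0 < α) (e : ℝ) (i : ℕ) :
    i < numSites E e ↔ e ≤ E i := by
  classical
  have hfin := hE.finite hα e
  obtain ⟨m, hm⟩ : ∃ m, ¬ e ≤ E m := by
    by_contra! hall
    exact Set.infinite_univ (hfin.subset fun i _ => hall i)
  have hex : ∃ m, ¬ e ≤ E m := ⟨m, hm⟩
  have hset : {i | e ≤ E i} = (Finset.range (Nat.find hex) : Set ℕ) := by
    ext i
    simp only [mem_ofPred_eq, Finset.coe_range, mem_Iio]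
    constructor
    · intro hi
      by_contra hle
      exact Nat.find_spec hex (hi.trans (hE.strictAnti.antitone (not_lt.1 hle)))
    · intro hi
      exact not_not.1 (Nat.find_min hex hi)
  have hN : numSites E e = Nat.find hex := by
    rw [numSites, hset, ncard_coe_finset, Finset.card_range]
  rw [hN]
  have := Set.ext_iff.1 hset i
  simpa using this.symm

lemma IsTypical.numSites_anti (hE : IsTypical α E) (hα : 0 < α) : Antitone (numSites E) :=
  fun e _ hee => ncard_le_ncard (fun _ hi => hee.trans hi) (hE.finite hα e)

lemma IsTypical.tendsto_numSites_mul_exp (hE : IsTypical α E) (hα : 0 < α) :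
    Tendsto (fun e => (numSites E e : ℝ) * Real.exp (α * e)) atBot (𝓝 1) := by
  -- the level `e` lies between the levels with indices `k e + 1` and `k e`
  set k : ℝ → ℕ := fun e => ⌊Real.exp (-(α / 4) * e)⌋₊ with hk
  have hexp : Tendsto (fun e => Real.exp (-(α / 4) * e)) atBot atTop :=
    Real.tendsto_exp_atTop.comp (tendsto_id.const_mul_atBot_of_neg (by linarith))
  have hkt : Tendsto k atBot atTop := tendsto_nat_floor_atTop.comp hexp
  set lo : ℕ → ℝ := fun n => ((n : ℝ) ^ 4 - (n : ℝ) ^ 3) / ((n : ℝ) + 1) ^ 4 with hlo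
  set hi : ℕ → ℝ := fun n => (((n : ℝ) + 1) ^ 4 + ((n : ℝ) + 1) ^ 3) / (n : ℝ) ^ 4 with hhi
  have hinv : Tendsto (fun n : ℕ => ((n : ℝ))⁻¹) atTop (𝓝 0) := tendsto_inv_atTop_nhds_zero_nat
  have hlot : Tendsto lo atTop (𝓝 1) := by
    have h : Tendsto (fun n : ℕ => (1 - ((n : ℝ))⁻¹) / (1 + ((n : ℝ))⁻¹) ^ 4) atTop
        (𝓝 ((1 - 0) / (1 + 0) ^ 4)) :=
      (hinv.const_sub 1).div ((hinv.const_add 1).pow 4) (by norm_num)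
    norm_num at h
    refine h.congr' ?_
    filter_upwards [eventually_gt_atTop 0] with n hn
    have : (0 : ℝ) < n := by positivity
    simp only [hlo]
    field_simp
  have hhit : Tendsto hi atTop (𝓝 1) := by
    have h : Tendsto (fun n : ℕ => (1 + (n : ℝ)⁻¹) ^ 4 + (1 + (n : ℝ)⁻¹) ^ 3 * (n : ℝ)⁻¹) atTop
        (𝓝 ((1 + 0) ^ 4 + (1 + 0) ^ 3 * 0)) :=
      ((hinv.const_add 1).pow 4).add (((hinv.const_add 1).pow 3).mul hinv)
    norm_num at h
    refine h.congr' ?_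
    filter_upwards [eventually_gt_atTop 0] with n hn
    have : (0 : ℝ) < n := by positivity
    simp only [hhi]
    field_simp
  have hbounds : ∀ᶠ e in atBot, lo (k e) ≤ (numSites E e : ℝ) * Real.exp (α * e) ∧
      (numSites E e : ℝ) * Real.exp (α * e) ≤ hi (k e) := by
    filter_upwards [hkt.eventually hE.near,
      (tendsto_add_atTop_nat 1).comp hkt |>.eventually hE.near,
      hkt.eventually (eventually_gt_atTop 0)] with e h1 h2 hpos
    set n := k e with hn
    have hn0 : (0 : ℝ) < n := by exact_mod_cast hpos
    set L := Real.exp (-(α / 4) * e) with hL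
    have hL0 : 0 < L := Real.exp_pos _
    have hnL : (n : ℝ) ≤ L := Nat.floor_le hL0.le
    have hLn : L < (n : ℝ) + 1 := Nat.lt_floor_add_one L
    have hlogL : Real.log L = -(α / 4) * e := Real.log_exp _
    have he1 : e ≤ level α n := by
      have h3 : Real.log n ≤ -(α / 4) * e := hlogL ▸ Real.log_le_log hn0 hnL
      rw [level]
      have : e = -(4 / α) * (-(α / 4) * e) := by field_simp
      rw [this]
      exact mul_le_mul_of_nonpos_left h3 (by have : 0 < 4 / α := by positivity
                                             linarith)
    have he2 : level α (n + 1 : ℕ) ≤ e := by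
      have h3 : -(α / 4) * e ≤ Real.log ((n + 1 : ℕ) : ℝ) := by
        push_cast; exact hlogL ▸ Real.log_le_log hL0 hLn.le
      rw [level]
      have : e = -(4 / α) * (-(α / 4) * e) := by field_simp
      rw [this]
      exact mul_le_mul_of_nonpos_left h3 (by have : 0 < 4 / α := by positivity
                                             linarith)
    have hA : (n : ℝ) ^ 4 - (n : ℝ) ^ 3 ≤ numSites E e := by
      have h3 : (numSites E (level α n) : ℝ) ≤ numSites E e := by
        exact_mod_cast hE.numSites_anti hα he1
      linarith [(abs_lt.1 h1.2).1]
    have hB : (numSites E e : ℝ) ≤ ((n : ℝ) + 1) ^ 4 + ((n : ℝ) + 1) ^ 3 := by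
      have h3 : (numSites E e : ℝ) ≤ numSites E (level α (n + 1 : ℕ)) := by
        exact_mod_cast hE.numSites_anti hα he2
      have h4 := (abs_lt.1 h2.2).2
      simp only [Function.comp, ← hn] at h4
      push_cast at h4 h3
      linarith
    have hexpL : Real.exp (α * e) = (L ^ 4)⁻¹ := by
      rw [hL, ← Real.exp_nat_mul, ← Real.exp_neg]
      congr 1
      push_cast
      ring
    rw [hexpL, ← div_eq_mul_inv]
    have hn1 : (1 : ℝ) ≤ n := by exact_mod_cast hpos
    constructor
    · refine div_le_div₀ (Nat.cast_nonneg _) hA (by positivity) ?_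
      gcongr
    · refine div_le_div₀ (by positivity) hB (by positivity) ?_
      gcongr
  exact tendsto_of_tendsto_of_tendsto_of_le_of_le' (hlot.comp hkt) (hhit.comp hkt)
    (hbounds.mono fun _ h => h.1) (hbounds.mono fun _ h => h.2)

lemma IsTypical.tendsto_numSites (hE : IsTypical α E) (hα : 0 < α) :
    Tendsto (numSites E) atBot atTop := by
  rw [← tendsto_natCast_atTop_iff (R := ℝ)]
  have h1 := hE.tendsto_numSites_mul_exp hα
  have h2 : Tendsto (fun e => Real.exp (-(α * e))) atBot atTop :=
    Real.tendsto_exp_atTop.comp (tendsto_neg_atBot_atTop.comp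
      (tendsto_id.const_mul_atBot hα))
  refine (h1.pos_mul_atTop one_pos h2).congr fun e => ?_
  rw [mul_assoc, ← Real.exp_add, add_neg_cancel, Real.exp_zero, mul_one]

/-- The proportion of the points above `e` whose parameter is at most `y` tends to `y ^ α`. -/
lemma IsTypical.tendsto_cdf (hE : IsTypical α E) (hα : 0 < α) {y : ℝ} (hy : 0 < y) :
    Tendsto (fun e => (numSites E (e - Real.log y) : ℝ) / numSites E e) atBot (𝓝 (y ^ α)) := by
  have h1 := hE.tendsto_numSites_mul_exp hα
  have h2 : Tendsto (fun e : ℝ => e - Real.log y) atBot atBot :=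
    tendsto_atBot_add_const_right _ _ tendsto_id
  have h3 := ((h1.comp h2).div h1 one_ne_zero).mul_const (y ^ α)
  rw [div_one, one_mul] at h3
  refine h3.congr' ?_
  filter_upwards [(hE.tendsto_numSites hα).eventually_gt_atTop 0] with e he
  have he' : (0 : ℝ) < numSites E e := by exact_mod_cast he
  have h4 : Real.exp (α * (e - Real.log y)) = Real.exp (α * e) / y ^ α := by
    rw [Real.rpow_def_of_pos hy, ← Real.exp_sub]
    congr 1
    ring
  have h5 : 0 < y ^ α := Real.rpow_pos_of_pos hy α
  simp only [Function.comp, Pi.div_apply, h4]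
  have := Real.exp_pos (α * e)
  field_simp

end Typical

/-! ### The limiting mean -/

lemma intervalIntegrable_beta {α : ℝ} (hα : 0 < α) {g : ℝ → ℝ} (hg : Continuous g) (a b : ℝ) :
    IntervalIntegrable (fun x => g x * x ^ (α - 1)) volume a b :=
  (intervalIntegral.intervalIntegrable_rpow' (by linarith)).continuousOn_mul hg.continuousOn

/-- The mean `f ↦ ∫₀¹ f(x) α x^{α - 1} dx`. -/
def betaMean (α : ℝ) (hα : 0 < α) : UnitFun →L[ℝ] ℝ :=
  LinearMap.mkContinuous
    { toFun := fun f => α * ∫ x in (0 : ℝ)..1, IccExtend zero_le_one f x * x ^ (α - 1)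
      map_add' := fun f g => by
        rw [← mul_add, ← intervalIntegral.integral_add
          (intervalIntegrable_beta hα f.continuous.Icc_extend' 0 1)
          (intervalIntegrable_beta hα g.continuous.Icc_extend' 0 1)]
        simp only [IccExtend, Function.comp, ContinuousMap.add_apply, add_mul]
      map_smul' := fun c f => by
        simp only [IccExtend, Function.comp, ContinuousMap.smul_apply, smul_eq_mul, mul_assoc,
          intervalIntegral.integral_const_mul, RingHom.id_apply]
        ring }
    1 fun f => by
      have hle : ‖∫ x in (0 : ℝ)..1, IccExtend zero_le_one f x * x ^ (α - 1)‖
          ≤ ∫ x in (0 : ℝ)..1, ‖f‖ * x ^ (α - 1) := by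
        refine intervalIntegral.norm_integral_le_of_norm_le zero_le_one
          (ae_of_all _ fun x hx => ?_)
          (intervalIntegrable_beta hα continuous_const 0 1)
        rw [norm_mul, Real.norm_of_nonneg (Real.rpow_nonneg hx.1.le _)]
        exact mul_le_mul_of_nonneg_right (f.norm_coe_le_norm _) (Real.rpow_nonneg hx.1.le _)
      rw [intervalIntegral.integral_const_mul, integral_rpow (Or.inl (by linarith))] at hle
      simp only [LinearMap.coe_mk, AddHom.coe_mk, norm_mul, Real.norm_of_nonneg hα.le, one_mul]
      calc α * ‖∫ x in (0 : ℝ)..1, IccExtend zero_le_one f x * x ^ (α - 1)‖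
          ≤ α * (‖f‖ * ((1 ^ (α - 1 + 1) - 0 ^ (α - 1 + 1)) / (α - 1 + 1))) := by gcongr
        _ = ‖f‖ := by
          rw [sub_add_cancel, Real.one_rpow, Real.zero_rpow hα.ne']
          field_simp
          ring

lemma betaMean_apply {α : ℝ} (hα : 0 < α) (f : UnitFun) :
    betaMean α hα f = α * ∫ x in (0 : ℝ)..1, IccExtend zero_le_one f x * x ^ (α - 1) := rfl

/-- The mean of a function which is given on `[0, 1]` by a formula. -/
lemma betaMean_eq {α : ℝ} (hα : 0 < α) {f : UnitFun} {g : ℝ → ℝ}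
    (h : ∀ x : unitInterval, f x = g x) :
    betaMean α hα f = α * ∫ x in (0 : ℝ)..1, g x * x ^ (α - 1) := by
  rw [betaMean_apply]
  congr 1
  refine intervalIntegral.integral_congr fun x hx => ?_
  rw [uIcc_of_le zero_le_one] at hx
  simp only [IccExtend_of_mem zero_le_one f hx, h]

lemma isMean_betaMean {α : ℝ} (hα : 0 < α) : IsMean (betaMean α hα) := by
  constructor
  · intro f hf
    rw [betaMean_apply]
    refine mul_nonneg hα.le (intervalIntegral.integral_nonneg zero_le_one fun x hx => ?_)
    exact mul_nonneg (hf _) (Real.rpow_nonneg hx.1 _)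
  · rw [betaMean_eq hα (g := fun _ => 1) fun _ => rfl]
    simp only [one_mul]
    rw [integral_rpow (Or.inl (by linarith)), sub_add_cancel, Real.one_rpow, Real.zero_rpow hα.ne']
    field_simp
    ring

lemma betaMean_coord_pow {α : ℝ} (hα : 0 < α) (k : ℕ) :
    betaMean α hα (coord ^ k) = α / (k + α) := by
  rw [betaMean_eq hα (g := fun x => x ^ k) fun x => by simp]
  have : ∫ x in (0 : ℝ)..1, x ^ k * x ^ (α - 1) = ∫ x in (0 : ℝ)..1, x ^ ((k : ℝ) + α - 1) := by
    refine intervalIntegral.integral_congr_ae (ae_of_all _ fun x hx => ?_)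
    rw [uIoc_of_le zero_le_one] at hx
    rw [← Real.rpow_natCast, ← Real.rpow_add hx.1]
    ring_nf
  have hk : (0 : ℝ) < k + α := by positivity
  rw [this, integral_rpow (Or.inl (by linarith)), sub_add_cancel, Real.one_rpow,
    Real.zero_rpow hk.ne']
  field_simp
  ring

/-! ### Convergence of the empirical means -/

/-- The layer-cake formula for `1 - x ^ k`, which expresses moments through the distribution
function. -/
lemma integral_indicator_Ici_pow (k : ℕ) {x : ℝ} (hx0 : 0 ≤ x) (hx1 : x ≤ 1) :
    ∫ y in (0 : ℝ)..1, (k * y ^ (k - 1)) * (Ici x).indicator 1 y = 1 - x ^ k := by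
  have h1 : ∫ y in x..1, (k : ℝ) * y ^ (k - 1) = 1 ^ k - x ^ k :=
    intervalIntegral.integral_eq_sub_of_hasDerivAt (f := fun y : ℝ => y ^ k)
      (fun y _ => hasDerivAt_pow k y)
      ((by fun_prop : Continuous fun y : ℝ => (k : ℝ) * y ^ (k - 1)).intervalIntegrable _ _)
  rw [one_pow] at h1
  rw [← h1, intervalIntegral.integral_of_le zero_le_one, intervalIntegral.integral_of_le hx1,
    integral_Ioc_eq_integral_Ioo, integral_Ioc_eq_integral_Ioo,
    ← integral_indicator measurableSet_Ioo, ← integral_indicator measurableSet_Ioo]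
  refine integral_congr_ae ?_
  filter_upwards [compl_mem_ae_iff.2 (measure_singleton x)] with y hy
  have hy' : y ≠ x := hy
  by_cases h : x < y
  · have h0 : 0 < y := hx0.trans_lt h
    by_cases h2 : y < 1 <;> simp [indicator, h, h0, h2, h.le]
  · have h' : ¬ x ≤ y := fun h3 => h (lt_of_le_of_ne h3 hy'.symm)
    simp [indicator, h, h']

section

variable {α : ℝ} {E : ℕ → ℝ}

/-- The parameters `e^{e - E i}` of the landscape `E` at the level `e`, with time unit `exp e`. -/
def params (E : ℕ → ℝ) (e : ℝ) : ℕ → ℝ := fun i => Real.exp e * Real.exp (-E i)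

lemma params_pos (E : ℕ → ℝ) (e : ℝ) (i : ℕ) : 0 < params E e i := by
  unfold params; positivity

lemma params_le_iff {e : ℝ} {i : ℕ} {y : ℝ} (hy : 0 < y) :
    params E e i ≤ y ↔ e - Real.log y ≤ E i := by
  rw [params, ← Real.exp_add, ← Real.le_log_iff_exp_le hy]
  constructor <;> intro h <;> linarith

lemma IsTypical.params_le_one (hE : IsTypical α E) (hα : 0 < α) {e : ℝ} {i : ℕ}
    (hi : i < numSites E e) : params E e i ≤ 1 := by
  rw [params_le_iff one_pos, Real.log_one, sub_zero]
  exact (hE.lt_numSites_iff hα e i).1 hi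

lemma IsTypical.empMean_coord_pow (hE : IsTypical α E) (hα : 0 < α) {e : ℝ}
    (hN : 0 < numSites E e) (k : ℕ) :
    empMean (numSites E e) (params E e) (coord ^ k)
      = 1 - ∫ y in (0 : ℝ)..1, (k * y ^ (k - 1)) *
        ((numSites E (e - Real.log y) : ℝ) / numSites E e) := by
  have hN' : (0 : ℝ) < numSites E e := by exact_mod_cast hN
  have h1 : ∀ i ∈ Finset.range (numSites E e), (coord ^ k) (site (params E e) i)
      = 1 - ∫ y in (0 : ℝ)..1, (k * y ^ (k - 1)) * (Ici (params E e i)).indicator 1 y := by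
    intro i hi
    have hi' := hE.params_le_one hα (Finset.mem_range.1 hi)
    rw [integral_indicator_Ici_pow k (params_pos E e i).le hi', ContinuousMap.pow_apply,
      coord_apply, coe_site (params_pos E e i).le hi']
    ring
  have hint : ∀ i ∈ Finset.range (numSites E e), IntervalIntegrable
      (fun y : ℝ => (k * y ^ (k - 1)) * (Ici (params E e i)).indicator 1 y) volume 0 1 := by
    intro i _
    have h2 : (fun y : ℝ => (k * y ^ (k - 1)) * (Ici (params E e i)).indicator (1 : ℝ → ℝ) y)
        = (Ici (params E e i)).indicator fun y : ℝ => (k : ℝ) * y ^ (k - 1) := by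
      ext y
      by_cases h : params E e i ≤ y <;> simp [indicator, h]
    rw [h2, intervalIntegrable_iff]
    have h3 : IntervalIntegrable (fun y : ℝ => (k : ℝ) * y ^ (k - 1)) volume 0 1 :=
      (by fun_prop : Continuous fun y : ℝ => (k : ℝ) * y ^ (k - 1)).intervalIntegrable _ _
    exact (intervalIntegrable_iff.1 h3).indicator measurableSet_Ici
  rw [empMean_apply, Finset.sum_congr rfl h1, Finset.sum_sub_distrib,
    ← intervalIntegral.integral_finsetSum hint, mul_sub]
  congr 1
  · simp [hN'.ne']
  · rw [← intervalIntegral.integral_const_mul]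
    refine intervalIntegral.integral_congr_ae (ae_of_all _ fun y hy => ?_)
    rw [uIoc_of_le zero_le_one] at hy
    have hcount : ∑ i ∈ Finset.range (numSites E e), (Ici (params E e i)).indicator (1 : ℝ → ℝ) y
        = numSites E (e - Real.log y) := by
      have h2 : ∀ i, (Ici (params E e i)).indicator (1 : ℝ → ℝ) y
          = if i < numSites E (e - Real.log y) then 1 else 0 := by
        intro i
        have : params E e i ≤ y ↔ i < numSites E (e - Real.log y) := by
          rw [params_le_iff hy.1, hE.lt_numSites_iff hα]
        by_cases h : params E e i ≤ y
        · simp [indicator, h, this.1 h]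
        · simp [indicator, h, mt this.2 h]
      have hle : numSites E (e - Real.log y) ≤ numSites E e := by
        refine hE.numSites_anti hα ?_
        have := Real.log_nonpos hy.1.le hy.2
        linarith
      simp only [h2]
      rw [← Finset.sum_filter, Finset.sum_const, nsmul_eq_mul, mul_one]
      congr 1
      rw [show (Finset.range (numSites E e)).filter (fun i => i < numSites E (e - Real.log y))
        = Finset.range (numSites E (e - Real.log y)) by ext i; simp; omega, Finset.card_range]
    rw [← Finset.mul_sum, hcount]
    field_simp

lemma IsTypical.tendsto_empMean (hE : IsTypical α E) (hα : 0 < α) (f : UnitFun) :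
    Tendsto (fun e => empMean (numSites E e) (params E e) f) atBot (𝓝 (betaMean α hα f)) := by
  have hpos : ∀ᶠ e in atBot, 0 < numSites E e := (hE.tendsto_numSites hα).eventually_gt_atTop 0
  refine tendsto_of_tendsto_monomials (C := 1)
    (hpos.mono fun e he => (isMean_empMean he _).norm_le_one) (fun k => ?_) f
  have hlim : Tendsto (fun e => 1 - ∫ y in (0 : ℝ)..1, (k * y ^ (k - 1)) *
        ((numSites E (e - Real.log y) : ℝ) / numSites E e)) atBot
      (𝓝 (1 - ∫ y in (0 : ℝ)..1, (k * y ^ (k - 1)) * y ^ α)) := by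
    refine Tendsto.const_sub 1 ?_
    refine intervalIntegral.tendsto_integral_filter_of_dominated_convergence
      (fun _ => (k : ℝ)) ?_ ?_ intervalIntegrable_const ?_
    · refine Eventually.of_forall fun e => Measurable.aestronglyMeasurable ?_
      have hm : Measurable fun y : ℝ => (numSites E (e - Real.log y) : ℝ) := by
        have h1 : Antitone fun a : ℝ => (numSites E a : ℝ) := fun a b hab => by
          exact Nat.cast_le.2 (hE.numSites_anti hα hab)
        exact h1.measurable.comp (measurable_const.sub Real.measurable_log)
      exact (by fun_prop : Measurable fun y : ℝ => (k : ℝ) * y ^ (k - 1)).mul (hm.div_const _)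
    · refine hpos.mono fun e he => ae_of_all _ fun y hy => ?_
      rw [uIoc_of_le zero_le_one] at hy
      have he' : (0 : ℝ) < numSites E e := by exact_mod_cast he
      have h1 : (numSites E (e - Real.log y) : ℝ) / numSites E e ≤ 1 := by
        rw [div_le_one he']
        have := Real.log_nonpos hy.1.le hy.2
        exact_mod_cast hE.numSites_anti hα (by linarith)
      have h2 : y ^ (k - 1) ≤ 1 := pow_le_one₀ hy.1.le hy.2
      have h3 : 0 ≤ y ^ (k - 1) := pow_nonneg hy.1.le _
      rw [Real.norm_of_nonneg (by positivity)]
      calc (k : ℝ) * y ^ (k - 1) * ((numSites E (e - Real.log y) : ℝ) / numSites E e)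
          ≤ k * 1 * 1 := by gcongr
        _ = k := by ring
    · refine ae_of_all _ fun y hy => ?_
      rw [uIoc_of_le zero_le_one] at hy
      exact (hE.tendsto_cdf hα hy.1).const_mul _
  have hval : 1 - ∫ y in (0 : ℝ)..1, (k * y ^ (k - 1)) * y ^ α = betaMean α hα (coord ^ k) := by
    rw [betaMean_coord_pow]
    have h1 : ∫ y in (0 : ℝ)..1, (k * y ^ (k - 1)) * y ^ α
        = ∫ y in (0 : ℝ)..1, k * y ^ ((k : ℝ) + α - 1) := by
      refine intervalIntegral.integral_congr_ae (ae_of_all _ fun y hy => ?_)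
      rw [uIoc_of_le zero_le_one] at hy
      rcases k with _ | k
      · simp
      · rw [mul_assoc, Nat.add_sub_cancel, ← Real.rpow_natCast, ← Real.rpow_add hy.1]
        push_cast
        ring_nf
    have hk : (0 : ℝ) < k + α := by positivity
    rw [h1, intervalIntegral.integral_const_mul, integral_rpow (Or.inl (by linarith)),
      sub_add_cancel, Real.one_rpow, Real.zero_rpow hk.ne']
    field_simp
    ring
  rw [← hval]
  refine hlim.congr' ?_
  filter_upwards [hpos] with e he
  rw [hE.empMean_coord_pow hα he]

/-- The correlation functions of a typical landscape converge, for all times simultaneously. -/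
theorem IsTypical.tendsto_landscapeCorr (hE : IsTypical α E) (hα : 0 < α) {t tw : ℝ}
    (ht : 0 ≤ t) (htw : 0 ≤ tw) :
    Tendsto (fun e => landscapeCorr (Real.exp e) E e t tw) atBot
      (𝓝 (betaMean α hα (semi (betaMean α hα) tw (expFun t)))) := by
  have hN := hE.tendsto_numSites hα
  have hexp : Continuous expFun := ContinuousMap.continuous_of_continuous_uncurry _ (by
    show Continuous fun p : ℝ × unitInterval => Real.exp (-p.1 * p.2)
    fun_prop)
  have hfun : Tendsto (fun e => expFun (((numSites E e : ℝ) - 1) / numSites E e * t)) atBot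
      (𝓝 (expFun t)) := by
    refine (hexp.tendsto t).comp ?_
    have h1 : Tendsto (fun N : ℕ => ((N : ℝ) - 1) / N * t) atTop (𝓝 t) := by
      have h2 : Tendsto (fun N : ℕ => (1 - (N : ℝ)⁻¹) * t) atTop (𝓝 ((1 - 0) * t)) :=
        (tendsto_inv_atTop_nhds_zero_nat.const_sub 1).mul_const t
      rw [sub_zero, one_mul] at h2
      refine h2.congr' ?_
      filter_upwards [eventually_gt_atTop 0] with N hN
      have : (N : ℝ) ≠ 0 := by positivity
      field_simp
    exact h1.comp hN
  have hlim := tendsto_semi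
    ((hN.eventually_gt_atTop 0).mono fun e he => (isMean_empMean he (params E e)).norm_le_one)
    (hE.tendsto_empMean hα) hfun tw
  refine hlim.congr' ?_
  filter_upwards [hN.eventually_ge_atTop 2] with e he
  obtain ⟨n, hn⟩ := Nat.exists_eq_add_of_le' he
  have h1 : ∀ i < n + 2, params E e i ≤ 1 := fun i hi => hE.params_le_one hα (hn ▸ hi)
  rw [landscapeCorr, hn]
  have h2 := corr_eq_empMean_semi (fun i _ => params_pos E e i) h1 ht htw
  rw [show (fun i => Real.exp e * Real.exp (-E i)) = params E e from rfl, h2]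
  push_cast
  ring_nf

end

/-! ### Holomorphic functions on the slit domain -/

/-- The plane slit along `[1, ∞)`; star-shaped about `0`. -/
def slit : Set ℂ := {w | 1 - w ∈ Complex.slitPlane}

lemma isOpen_slit : IsOpen slit :=
  Complex.isOpen_slitPlane.preimage (continuous_const.sub continuous_id)

lemma one_sub_mul_mem_slitPlane {w : ℂ} (hw : w ∈ slit) {s : ℝ} (hs : s ∈ Icc (0 : ℝ) 1) :
    1 - (s : ℂ) * w ∈ Complex.slitPlane := by
  have h := Complex.starConvex_one_slitPlane hw (a := 1 - s) (b := s) (by linarith [hs.2]) hs.1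
    (by ring)
  convert! h using 1
  simp only [Complex.real_smul]
  push_cast
  ring

lemma mul_mem_slit {w : ℂ} (hw : w ∈ slit) {s : ℝ} (hs : s ∈ Icc (0 : ℝ) 1) : (s : ℂ) * w ∈ slit :=
  one_sub_mul_mem_slitPlane hw hs

lemma one_sub_mul_ne_zero {w : ℂ} (hw : w ∈ slit) {s : ℝ} (hs : s ∈ Icc (0 : ℝ) 1) :
    1 - (s : ℂ) * w ≠ 0 :=
  Complex.slitPlane_ne_zero (one_sub_mul_mem_slitPlane hw hs)

/-- Differentiation under the integral sign, for a kernel which is continuous up to the end points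
and an integrable weight, which may be singular. -/
lemma hasDerivAt_integral_param {ρ : ℝ → ℝ} (hρ : IntervalIntegrable ρ volume 0 1)
    {U : Set ℂ} (hU : IsOpen U) {K K' : ℝ → ℂ → ℂ}
    (hK : ContinuousOn (Function.uncurry K) (Icc 0 1 ×ˢ U))
    (hK' : ContinuousOn (Function.uncurry K') (Icc 0 1 ×ˢ U))
    (hd : ∀ s ∈ Icc (0 : ℝ) 1, ∀ w ∈ U, HasDerivAt (K s) (K' s w) w) {w : ℂ} (hw : w ∈ U) :
    HasDerivAt (fun w => ∫ s in (0 : ℝ)..1, (ρ s : ℂ) * K s w)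
      (∫ s in (0 : ℝ)..1, (ρ s : ℂ) * K' s w) w := by
  obtain ⟨ε, hε, hball⟩ := Metric.nhds_basis_closedBall.mem_iff.1 (hU.mem_nhds hw)
  obtain ⟨C, hC⟩ := (isCompact_Icc.prod (isCompact_closedBall w ε)).exists_bound_of_continuousOn
    (hK'.mono (prod_mono_right hball))
  have hρc : IntervalIntegrable (fun s => (ρ s : ℂ)) volume 0 1 := by
    rw [intervalIntegrable_iff] at hρ ⊢
    exact hρ.ofReal
  have hsub : uIoc (0 : ℝ) 1 ⊆ Icc 0 1 := by
    rw [uIoc_of_le zero_le_one]; exact Ioc_subset_Icc_self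
  have hslice : ∀ {G : ℝ → ℂ → ℂ}, ContinuousOn (Function.uncurry G) (Icc 0 1 ×ˢ U) → ∀ v ∈ U,
      ContinuousOn (fun s => G s v) (Icc 0 1) := fun hG v hv =>
    hG.comp (continuousOn_id.prodMk continuousOn_const) fun s hs => ⟨hs, hv⟩
  have hint : ∀ {G : ℝ → ℂ → ℂ}, ContinuousOn (Function.uncurry G) (Icc 0 1 ×ˢ U) → ∀ v ∈ U,
      IntervalIntegrable (fun s => (ρ s : ℂ) * G s v) volume 0 1 := fun hG v hv =>
    hρc.mul_continuousOn (by rw [uIcc_of_le zero_le_one]; exact hslice hG v hv)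
  refine (intervalIntegral.hasDerivAt_integral_of_dominated_loc_of_deriv_le
    (F := fun w s => (ρ s : ℂ) * K s w) (F' := fun w s => (ρ s : ℂ) * K' s w)
    (bound := fun s => |ρ s| * C) (Metric.closedBall_mem_nhds w hε) ?_ (hint hK w hw)
    (intervalIntegrable_iff.1 (hint hK' w hw)).aestronglyMeasurable ?_
    (hρ.abs.mul_const C) ?_).2
  · filter_upwards [hU.mem_nhds hw] with v hv
    exact (intervalIntegrable_iff.1 (hint hK v hv)).aestronglyMeasurable
  · refine ae_of_all _ fun s hs v hv => ?_
    rw [norm_mul, Complex.norm_real, Real.norm_eq_abs]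
    exact mul_le_mul_of_nonneg_left (hC (s, v) ⟨hsub hs, hv⟩) (abs_nonneg _)
  · exact ae_of_all _ fun s hs v hv => (hd s (hsub hs) v (hball hv)).const_mul _

/-- A holomorphic function `φ` on the slit plane has the primitive `w ↦ ∫₀¹ φ(s w) w ds`, since the
slit plane is star-shaped about `0`. -/
lemma exists_primitive_slit {φ : ℂ → ℂ} (hφ : DifferentiableOn ℂ φ slit) :
    ∃ Φ : ℂ → ℂ, ∀ w ∈ slit, HasDerivAt Φ (φ w) w := by
  have hφ' : ContinuousOn (deriv φ) slit := (hφ.deriv isOpen_slit).continuousOn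
  have hm : MapsTo (fun p : ℝ × ℂ => (p.1 : ℂ) * p.2) (Icc (0 : ℝ) 1 ×ˢ slit) slit :=
    fun p hp => mul_mem_slit hp.2 hp.1
  have hmul : Continuous fun p : ℝ × ℂ => (p.1 : ℂ) * p.2 := by fun_prop
  have hsnd : Continuous fun p : ℝ × ℂ => p.2 := continuous_snd
  have hd : ∀ s ∈ Icc (0 : ℝ) 1, ∀ w ∈ slit, HasDerivAt (fun w => φ (s * w) * w)
      (φ (s * w) + s * w * deriv φ (s * w)) w := by
    intro s hs w hw
    have h1 := (hφ.differentiableAt (isOpen_slit.mem_nhds (mul_mem_slit hw hs))).hasDerivAt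
    have h2 : HasDerivAt (fun w : ℂ => (s : ℂ) * w) (s : ℂ) w := by
      simpa using (hasDerivAt_id w).const_mul (s : ℂ)
    convert! (h1.comp w h2).mul (hasDerivAt_id w) using 1
    simp only [Function.comp, id]
    ring
  refine ⟨fun w => ∫ s in (0 : ℝ)..1, ((fun _ => 1 : ℝ → ℝ) s : ℂ) * (φ (s * w) * w),
    fun w hw => ?_⟩
  have h := hasDerivAt_integral_param (ρ := fun _ => 1) intervalIntegrable_const isOpen_slit
    (K := fun s w => φ (s * w) * w) (K' := fun s w => φ (s * w) + s * w * deriv φ (s * w))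
    ((hφ.continuousOn.comp hmul.continuousOn hm).mul hsnd.continuousOn)
    ((hφ.continuousOn.comp hmul.continuousOn hm).add
      (hmul.continuousOn.mul (hφ'.comp hmul.continuousOn hm))) hd hw
  convert! h using 1
  -- the derivative is the integral of the derivative of `s ↦ s φ(s w)`
  have hder : ∀ s ∈ uIcc (0 : ℝ) 1, HasDerivAt (fun s : ℝ => (s : ℂ) * φ (s * w))
      (φ (s * w) + s * w * deriv φ (s * w)) s := by
    intro s hs
    rw [uIcc_of_le zero_le_one] at hs
    have h1 := (hφ.differentiableAt (isOpen_slit.mem_nhds (mul_mem_slit hw hs))).hasDerivAt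
    have h2 : HasDerivAt (fun s : ℝ => (s : ℂ) * w) w s := by
      simpa using (Complex.ofRealCLM.hasDerivAt (x := s)).mul_const w
    have h3 : HasDerivAt (fun s : ℝ => (s : ℂ)) 1 s := Complex.ofRealCLM.hasDerivAt
    convert! h3.mul (h1.comp s h2) using 1
    simp only [Function.comp]
    ring
  have hc : ContinuousOn (fun s : ℝ => φ (s * w) + s * w * deriv φ (s * w)) (uIcc (0 : ℝ) 1) := by
    rw [uIcc_of_le zero_le_one]
    have h4 : Continuous fun s : ℝ => (s : ℂ) * w := by fun_prop
    exact (hφ.continuousOn.comp h4.continuousOn fun s hs => mul_mem_slit hw hs).add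
      (h4.continuousOn.mul (hφ'.comp h4.continuousOn fun s hs => mul_mem_slit hw hs))
  simp only [Complex.ofReal_one, one_mul]
  rw [intervalIntegral.integral_eq_sub_of_hasDerivAt hder hc.intervalIntegrable]
  simp

/-! ### The Cauchy transform -/

section

variable {α : ℝ}

/-- The Cauchy transform `∫₀¹ f(x) x^{α - 1} / (1 - x w) dx` in the variable `w = 1 / z`. -/
def cauchy (α : ℝ) (f : UnitFun) (w : ℂ) : ℂ :=
  ∫ x in (0 : ℝ)..1, ((IccExtend zero_le_one f x * x ^ (α - 1) : ℝ) : ℂ) * (1 - x * w)⁻¹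

lemma continuousOn_kernel : ContinuousOn (fun p : ℝ × ℂ => (1 - (p.1 : ℂ) * p.2)⁻¹)
    (Icc (0 : ℝ) 1 ×ˢ slit) :=
  ContinuousOn.inv₀ (by fun_prop) fun p hp => one_sub_mul_ne_zero hp.2 hp.1

lemma intervalIntegrable_cauchy (hα : 0 < α) (f : UnitFun) {w : ℂ} (hw : w ∈ slit) :
    IntervalIntegrable (fun x : ℝ => ((IccExtend zero_le_one f x * x ^ (α - 1) : ℝ) : ℂ)
      * (1 - x * w)⁻¹) volume 0 1 := by
  have h1 : IntervalIntegrable (fun x : ℝ => ((IccExtend zero_le_one f x * x ^ (α - 1) : ℝ) : ℂ))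
      volume 0 1 := by
    have h := intervalIntegrable_beta hα (f.continuous.Icc_extend' (h := zero_le_one)) 0 1
    rw [intervalIntegrable_iff] at h ⊢
    exact h.ofReal
  refine h1.mul_continuousOn ?_
  rw [uIcc_of_le zero_le_one]
  exact continuousOn_kernel.comp (f := fun x : ℝ => (x, w))
    (continuousOn_id.prodMk continuousOn_const) fun x hx => ⟨hx, hw⟩

lemma differentiableOn_cauchy (hα : 0 < α) (f : UnitFun) :
    DifferentiableOn ℂ (cauchy α f) slit := by
  intro w hw
  have hx : Continuous fun p : ℝ × ℂ => (p.1 : ℂ) := by fun_prop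
  have hK' : ContinuousOn (fun p : ℝ × ℂ => (p.1 : ℂ) * ((1 - (p.1 : ℂ) * p.2)⁻¹) ^ 2)
      (Icc (0 : ℝ) 1 ×ˢ slit) := hx.continuousOn.mul (continuousOn_kernel.pow 2)
  refine (hasDerivAt_integral_param (intervalIntegrable_beta hα f.continuous.Icc_extend' 0 1)
    isOpen_slit (K := fun x w => (1 - x * w)⁻¹) (K' := fun x w => x * ((1 - x * w)⁻¹) ^ 2)
    continuousOn_kernel hK' (fun x hx v hv => ?_)
    hw).differentiableAt.differentiableWithinAt
  have h1 : HasDerivAt (fun v : ℂ => 1 - (x : ℂ) * v) (-(x : ℂ)) v := by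
    simpa using ((hasDerivAt_id v).const_mul (x : ℂ)).const_sub 1
  convert! h1.inv (one_sub_mul_ne_zero hv hx) using 1
  field_simp

/-- The integrand has values in an open half plane: the right half plane for real `w`, and the upper
or the lower one otherwise. -/
lemma cauchy_one_ne_zero (hα : 0 < α) {w : ℂ} (hw : w ∈ slit) : cauchy α 1 w ≠ 0 := by
  obtain ⟨c, hc⟩ : ∃ c : ℂ, ∀ x ∈ Ioo (0 : ℝ) 1, 0 < (c * (1 - x * w)⁻¹).re := by
    by_cases him : w.im = 0
    · refine ⟨1, fun x hx => ?_⟩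
      have hm := one_sub_mul_mem_slitPlane hw ⟨hx.1.le, hx.2.le⟩
      have h0 := one_sub_mul_ne_zero hw (s := x) ⟨hx.1.le, hx.2.le⟩
      have hre : 0 < (1 - x * w).re := by
        rcases Complex.mem_slitPlane_iff.1 hm with h | h
        · exact h
        · simp [him] at h
      rw [one_mul, Complex.inv_re]
      exact div_pos hre (Complex.normSq_pos.2 h0)
    · refine ⟨-Complex.I * w.im, fun x hx => ?_⟩
      have h0 := one_sub_mul_ne_zero hw (s := x) ⟨hx.1.le, hx.2.le⟩
      have h1 := Complex.normSq_pos.2 h0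
      have h2 : (-Complex.I * w.im * (1 - x * w)⁻¹).re
          = w.im ^ 2 * x / Complex.normSq (1 - x * w) := by
        simp [Complex.mul_re, Complex.mul_im, Complex.inv_re, Complex.inv_im]
        ring
      rw [h2]
      have := hx.1
      positivity
  intro h0
  have hint := intervalIntegrable_cauchy hα 1 hw
  have h1 : ∫ x in (0 : ℝ)..1, (c * (((IccExtend zero_le_one (1 : UnitFun) x * x ^ (α - 1) : ℝ) : ℂ)
      * (1 - x * w)⁻¹)).re = 0 := by
    have h2 := (hint.const_mul c)
    have h3 := Complex.reCLM.intervalIntegral_comp_comm h2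
    simp only [Complex.reCLM_apply] at h3
    rw [h3, intervalIntegral.integral_const_mul]
    change (c * cauchy α 1 w).re = 0
    rw [h0, mul_zero, Complex.zero_re]
  have hpos : 0 < ∫ x in (0 : ℝ)..1,
      (c * (((IccExtend zero_le_one (1 : UnitFun) x * x ^ (α - 1) : ℝ) : ℂ)
      * (1 - x * w)⁻¹)).re := by
    refine intervalIntegral.intervalIntegral_pos_of_pos_on ?_ (fun x hx => ?_) one_pos
    · have h2 := hint.const_mul c
      rw [intervalIntegrable_iff] at h2 ⊢
      exact h2.re
    · have h4 : IccExtend zero_le_one (1 : UnitFun) x = (1 : ℝ) := rfl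
      rw [h4, one_mul, mul_left_comm, Complex.re_ofReal_mul]
      exact mul_pos (Real.rpow_pos_of_pos hx.1 _) (hc x hx)
  exact hpos.ne' h1

/-- The normalized Cauchy transform. For `w = 1 / z`, the value `w * ratio α f w` is the limiting
mean of the resolvent `(z + trapOp ν)⁻¹ f`; this is used only in the form of `ratio_eq`. -/
def ratio (α : ℝ) (f : UnitFun) (w : ℂ) : ℂ := cauchy α f w / cauchy α 1 w

lemma differentiableOn_ratio (hα : 0 < α) (f : UnitFun) : DifferentiableOn ℂ (ratio α f) slit :=
  (differentiableOn_cauchy hα f).div (differentiableOn_cauchy hα 1)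
    fun _ hw => cauchy_one_ne_zero hα hw

/-- The identity `1 / (1 - x w) = 1 + w x / (1 - x w)`, integrated. -/
lemma cauchy_eq (hα : 0 < α) (f : UnitFun) {w : ℂ} (hw : w ∈ slit) :
    cauchy α f w = (betaMean α hα f : ℂ) / α + w * cauchy α (coord * f) w := by
  have hα' : (α : ℂ) ≠ 0 := by exact_mod_cast hα.ne'
  have h1 : (betaMean α hα f : ℂ) / α
      = ∫ x in (0 : ℝ)..1, ((IccExtend zero_le_one f x * x ^ (α - 1) : ℝ) : ℂ) := by
    rw [betaMean_apply, intervalIntegral.integral_ofReal]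
    push_cast
    field_simp
  have hint : IntervalIntegrable (fun x : ℝ => ((IccExtend zero_le_one f x * x ^ (α - 1) : ℝ) : ℂ))
      volume 0 1 := by
    have h := intervalIntegrable_beta hα (f.continuous.Icc_extend' (h := zero_le_one)) 0 1
    rw [intervalIntegrable_iff] at h ⊢
    exact h.ofReal
  rw [h1, cauchy, cauchy, ← intervalIntegral.integral_const_mul,
    ← intervalIntegral.integral_add hint
      ((intervalIntegrable_cauchy hα (coord * f) hw).const_mul w)]
  refine intervalIntegral.integral_congr fun x hx => ?_
  rw [uIcc_of_le zero_le_one] at hx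
  have h2 : IccExtend zero_le_one (coord * f) x = x * IccExtend zero_le_one f x := by
    rw [IccExtend_of_mem _ _ hx, IccExtend_of_mem _ _ hx]
    rfl
  have h3 := one_sub_mul_ne_zero hw hx
  simp only [h2]
  push_cast
  field_simp
  ring

lemma cauchy_sub (hα : 0 < α) (f g : UnitFun) {w : ℂ} (hw : w ∈ slit) :
    cauchy α (f - g) w = cauchy α f w - cauchy α g w := by
  rw [cauchy, cauchy, cauchy, ← intervalIntegral.integral_sub (intervalIntegrable_cauchy hα f hw)
    (intervalIntegrable_cauchy hα g hw)]
  congr 1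
  ext x
  rw [show IccExtend zero_le_one (f - g) x = IccExtend zero_le_one f x - IccExtend zero_le_one g x
    from rfl]
  push_cast
  ring

lemma cauchy_smul (c : ℝ) (f : UnitFun) (w : ℂ) : cauchy α (c • f) w = c * cauchy α f w := by
  rw [cauchy, cauchy, ← intervalIntegral.integral_const_mul]
  congr 1
  ext x
  rw [show IccExtend zero_le_one (c • f) x = c * IccExtend zero_le_one f x from rfl]
  push_cast
  ring

/-- The resolvent identity: with `R f = w * ratio α f w` and `w = 1 / z`, it says
`z * R f + R (trapOp ν f) = ν f`. -/
lemma ratio_eq (hα : 0 < α) (f : UnitFun) {w : ℂ} (hw : w ∈ slit) :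
    ratio α f w = betaMean α hα f - w * ratio α (trapOp (betaMean α hα) f) w := by
  have h0 := cauchy_one_ne_zero hα hw
  have h1 := cauchy_eq hα f hw
  have h2 := cauchy_eq hα 1 hw
  rw [(isMean_betaMean hα).one, mul_one] at h2
  rw [ratio, ratio, trapOp_apply, cauchy_sub hα _ _ hw, cauchy_smul]
  have hα' : (α : ℂ) ≠ 0 := by exact_mod_cast hα.ne'
  rw [eq_sub_iff_add_eq, ← mul_div_assoc, ← add_div, div_eq_iff h0]
  push_cast at h2
  linear_combination h1 - (betaMean α hα f : ℂ) * h2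

end

/-! ### Integrals along a loop around the unit segment -/

/-- The complement of the segment `[0, 1]` in the complex plane. -/
def offSegment : Set ℂ := {z | ∀ x ∈ Icc (0 : ℝ) 1, z ≠ x}

lemma ne_zero_of_mem_offSegment {z : ℂ} (hz : z ∈ offSegment) : z ≠ 0 := by
  simpa using hz 0 ⟨le_rfl, zero_le_one⟩

/-- Inversion maps the complement of the segment into the slit plane. -/
lemma inv_mem_slit {z : ℂ} (hz : z ∈ offSegment) : z⁻¹ ∈ slit := by
  have hz0 := ne_zero_of_mem_offSegment hz
  by_contra h
  have h1 : ¬(0 < (1 - z⁻¹).re ∨ (1 - z⁻¹).im ≠ 0) := fun h2 => h (Complex.mem_slitPlane_iff.2 h2)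
  push Not at h1
  obtain ⟨hre, him⟩ := h1
  set r : ℝ := (z⁻¹).re with hr
  have h2 : z⁻¹ = (r : ℂ) := by
    apply Complex.ext
    · simp [hr]
    · simpa using him
  have h3 : 1 ≤ r := by
    rw [Complex.sub_re, Complex.one_re] at hre
    linarith
  have h4 : z = ((r⁻¹ : ℝ) : ℂ) := by
    rw [Complex.ofReal_inv, ← h2, inv_inv]
  exact hz r⁻¹ ⟨by positivity, inv_le_one_of_one_le₀ h3⟩ h4

namespace IsLoopAroundUnitSegment

variable {γ : ℝ → ℂ}

lemma mem_offSegment (hγ : IsLoopAroundUnitSegment γ) {s : ℝ} (hs : s ∈ Icc (0 : ℝ) 1) :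
    γ s ∈ offSegment := hγ.avoids s hs

lemma continuousOn (hγ : IsLoopAroundUnitSegment γ) : ContinuousOn γ (Icc 0 1) := by
  obtain ⟨n, a, hmono, h0, h1, hC⟩ := hγ.piecewise
  have key : ∀ k ≤ n, ContinuousOn γ (Icc (a 0) (a k)) := by
    intro k
    induction k with
    | zero => intro _; simp
    | succ k ih =>
      intro hk
      rw [← Icc_union_Icc_eq_Icc (hmono k.zero_le) (hmono k.le_succ)]
      exact (ih (by omega)).union_of_isClosed (hC k (by omega)).continuousOn isClosed_Icc
        isClosed_Icc
  simpa [h0, h1] using key n le_rfl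

lemma intervalIntegrable_deriv (hγ : IsLoopAroundUnitSegment γ) :
    IntervalIntegrable (deriv γ) volume 0 1 := by
  obtain ⟨n, a, hmono, h0, h1, hC⟩ := hγ.piecewise
  rw [← h0, ← h1]
  refine IntervalIntegrable.trans_iterate fun k hk => ?_
  rcases (hmono k.le_succ).eq_or_lt with heq | hlt
  · rw [Nat.succ_eq_add_one] at heq
    rw [heq]
  · have hc : ContinuousOn (derivWithin γ (Icc (a k) (a (k + 1)))) (Icc (a k) (a (k + 1))) :=
      (hC k hk).continuousOn_derivWithin (uniqueDiffOn_Icc hlt) le_rfl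
    have hI : IntervalIntegrable (derivWithin γ (Icc (a k) (a (k + 1)))) volume (a k) (a (k + 1)) :=
      ContinuousOn.intervalIntegrable (by rwa [uIcc_of_le hlt.le])
    rw [intervalIntegrable_iff_integrableOn_Ioo_of_le hlt.le] at hI ⊢
    refine hI.congr_fun (fun s hs => ?_) measurableSet_Ioo
    exact derivWithin_of_mem_nhds (Icc_mem_nhds hs.1 hs.2)

/-- The curve is differentiable except at the break points. -/
lemma exists_countable_hasDerivAt (hγ : IsLoopAroundUnitSegment γ) :
    ∃ S : Set ℝ, S.Countable ∧ ∀ s ∈ Ioo (0 : ℝ) 1 \ S, HasDerivAt γ (deriv γ s) s := by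
  classical
  obtain ⟨n, a, hmono, h0, h1, hC⟩ := hγ.piecewise
  refine ⟨range a, countable_range a, fun s hs => ?_⟩
  obtain ⟨⟨hs0, hs1⟩, hsa⟩ := hs
  have hne : ∀ k, a k ≠ s := fun k hk => hsa ⟨k, hk⟩
  have hex : ∃ k, s < a k := ⟨n, by rwa [h1]⟩
  have hpos : Nat.find hex ≠ 0 := fun h => by
    have := Nat.find_spec hex
    rw [h, h0] at this
    linarith
  obtain ⟨k, hk⟩ := Nat.exists_eq_succ_of_ne_zero hpos
  have hlt : a k < s := lt_of_le_of_ne (not_lt.1 (Nat.find_min hex (by omega))) (hne k)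
  have hgt : s < a (k + 1) := by
    have := Nat.find_spec hex
    rwa [hk] at this
  have hkn : k < n := by
    have : Nat.find hex ≤ n := Nat.find_min' hex (by rwa [h1])
    omega
  exact (((hC k hkn).differentiableOn one_ne_zero).differentiableAt
    (Icc_mem_nhds hlt hgt)).hasDerivAt

lemma intervalIntegrable (hγ : IsLoopAroundUnitSegment γ) {G : ℂ → ℂ}
    (hG : ContinuousOn G offSegment) :
    IntervalIntegrable (fun s => G (γ s) * deriv γ s) volume 0 1 := by
  refine hγ.intervalIntegrable_deriv.continuousOn_mul ?_
  rw [uIcc_of_le zero_le_one]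
  exact hG.comp hγ.continuousOn fun s hs => hγ.mem_offSegment hs

lemma pathIntegral_eq_zero (hγ : IsLoopAroundUnitSegment γ) {F G : ℂ → ℂ}
    (hF : ∀ z ∈ offSegment, HasDerivAt F (G z) z) (hG : ContinuousOn G offSegment) :
    pathIntegral G γ = 0 := by
  obtain ⟨S, hS, hd⟩ := hγ.exists_countable_hasDerivAt
  have hFc : ContinuousOn F offSegment := fun z hz => (hF z hz).continuousAt.continuousWithinAt
  rw [pathIntegral, integral_eq_of_hasDerivAt_off_countable_of_le (fun s => F (γ s)) _ zero_le_one
    hS (hFc.comp hγ.continuousOn fun s hs => hγ.mem_offSegment hs) (fun s hs => ?_)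
    (hγ.intervalIntegrable hG), hγ.closed, sub_self]
  exact (hF _ (hγ.mem_offSegment ⟨hs.1.1.le, hs.1.2.le⟩)).comp s (hd s hs)

lemma pathIntegral_pow (hγ : IsLoopAroundUnitSegment γ) (k : ℕ) :
    pathIntegral (fun z => z ^ k) γ = 0 := by
  refine hγ.pathIntegral_eq_zero (F := fun z => z ^ (k + 1) / (k + 1)) (fun z _ => ?_) (by fun_prop)
  have h := (hasDerivAt_pow (k + 1) z).div_const ((k : ℂ) + 1)
  have hk : (k : ℂ) + 1 ≠ 0 := by exact_mod_cast k.succ_ne_zero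
  convert! h using 1
  push_cast
  field_simp

variable {α : ℝ}

lemma continuousOn_ratio_inv (hα : 0 < α) (f : UnitFun) :
    ContinuousOn (fun z : ℂ => ratio α f z⁻¹) offSegment :=
  (differentiableOn_ratio hα f).continuousOn.comp
    (continuousOn_inv₀.mono fun _ hz => ne_zero_of_mem_offSegment hz) fun _ hz => inv_mem_slit hz

lemma continuousOn_inv_offSegment : ContinuousOn (fun z : ℂ => z⁻¹) offSegment :=
  continuousOn_inv₀.mono fun _ hz => ne_zero_of_mem_offSegment hz

/-- By the resolvent identity the integrand is `ν(f) / z` minus a function of the form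
`φ(1 / z) / z ^ 2` with `φ` holomorphic on the slit plane, which has a primitive. -/
lemma pathIntegral_ratio (hα : 0 < α) (hγ : IsLoopAroundUnitSegment γ) (f : UnitFun) :
    pathIntegral (fun z => z⁻¹ * ratio α f z⁻¹) γ = 2 * Real.pi * Complex.I * betaMean α hα f := by
  set g := trapOp (betaMean α hα) f with hg
  obtain ⟨Φ, hΦ⟩ := exists_primitive_slit (differentiableOn_ratio hα g)
  have hGc : ContinuousOn (fun z : ℂ => -(z ^ 2)⁻¹ * ratio α g z⁻¹) offSegment := by
    refine ContinuousOn.mul (ContinuousOn.neg ?_) (continuousOn_ratio_inv hα g)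
    exact ContinuousOn.inv₀ (continuous_pow 2).continuousOn fun z hz =>
      pow_ne_zero 2 (ne_zero_of_mem_offSegment hz)
  have hrem : pathIntegral (fun z => -(z ^ 2)⁻¹ * ratio α g z⁻¹) γ = 0 := by
    refine hγ.pathIntegral_eq_zero (F := fun z => Φ z⁻¹) (fun z hz => ?_) hGc
    have h := (hΦ z⁻¹ (inv_mem_slit hz)).comp z (hasDerivAt_inv (ne_zero_of_mem_offSegment hz))
    convert! h using 1
    ring
  have hwind := hγ.winding 0 ⟨le_rfl, zero_le_one⟩
  simp only [Complex.ofReal_zero, sub_zero, one_div] at hwind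
  have hpi : (2 * Real.pi * Complex.I : ℂ) ≠ 0 := Complex.two_pi_I_ne_zero
  rw [inv_mul_eq_iff_eq_mul₀ hpi, mul_one] at hwind
  have hsplit : pathIntegral (fun z => z⁻¹ * ratio α f z⁻¹) γ
      = betaMean α hα f * pathIntegral (fun z => z⁻¹) γ
        + pathIntegral (fun z => -(z ^ 2)⁻¹ * ratio α g z⁻¹) γ := by
    rw [pathIntegral, pathIntegral, pathIntegral, ← intervalIntegral.integral_const_mul,
      ← intervalIntegral.integral_add]
    · refine intervalIntegral.integral_congr fun s hs => ?_
      rw [uIcc_of_le zero_le_one] at hs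
      have hz := hγ.mem_offSegment hs
      have hz0 := ne_zero_of_mem_offSegment hz
      simp only [ratio_eq hα f (inv_mem_slit hz)]
      field_simp
      ring
    · exact (hγ.intervalIntegrable continuousOn_inv_offSegment).const_mul _
    · exact hγ.intervalIntegrable hGc
  rw [hsplit, hrem, hwind]
  ring

/-- The moments of the resolvent along the loop, by iterating the resolvent identity. -/
lemma pathIntegral_pow_mul_ratio (hα : 0 < α) (hγ : IsLoopAroundUnitSegment γ) (k : ℕ)
    (f : UnitFun) :
    pathIntegral (fun z => z ^ k * (z⁻¹ * ratio α f z⁻¹)) γ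
      = 2 * Real.pi * Complex.I *
        ((-1) ^ k * betaMean α hα ((trapOp (betaMean α hα) ^ k) f)) := by
  induction k generalizing f with
  | zero => simpa using hγ.pathIntegral_ratio hα f
  | succ k ih =>
    set g := trapOp (betaMean α hα) f with hg
    have hsplit : pathIntegral (fun z => z ^ (k + 1) * (z⁻¹ * ratio α f z⁻¹)) γ
        = betaMean α hα f * pathIntegral (fun z => z ^ k) γ
          - pathIntegral (fun z => z ^ k * (z⁻¹ * ratio α g z⁻¹)) γ := by
      rw [pathIntegral, pathIntegral, pathIntegral, ← intervalIntegral.integral_const_mul,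
        ← intervalIntegral.integral_sub]
      · refine intervalIntegral.integral_congr fun s hs => ?_
        rw [uIcc_of_le zero_le_one] at hs
        have hz := hγ.mem_offSegment hs
        have hz0 := ne_zero_of_mem_offSegment hz
        simp only [ratio_eq hα f (inv_mem_slit hz)]
        field_simp
        ring
      · exact (hγ.intervalIntegrable (continuous_pow k).continuousOn).const_mul _
      · exact hγ.intervalIntegrable (G := fun z => z ^ k * (z⁻¹ * ratio α g z⁻¹))
          ((continuous_pow k).continuousOn.mul
            (continuousOn_inv_offSegment.mul (continuousOn_ratio_inv hα g)))
    rw [hsplit, hγ.pathIntegral_pow, ih g, pow_succ (trapOp (betaMean α hα)), mul_apply_eq_comp,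
      ← hg]
    ring

end IsLoopAroundUnitSegment

lemma stieltjes_eq (α t : ℝ) {z : ℂ} (hz : z ∈ offSegment) :
    stieltjes α t z = z⁻¹ * cauchy α (expFun t) z⁻¹ := by
  have hz0 := ne_zero_of_mem_offSegment hz
  rw [stieltjes, cauchy, ← intervalIntegral.integral_const_mul]
  refine intervalIntegral.integral_congr fun x hx => ?_
  rw [uIcc_of_le zero_le_one] at hx
  have h1 : IccExtend zero_le_one (expFun t) x = Real.exp (-x * t) := by
    rw [IccExtend_of_mem _ _ hx, expFun_apply]
    ring_nf
  have h2 := one_sub_mul_ne_zero (inv_mem_slit hz) hx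
  have h3 : z - x ≠ 0 := sub_ne_zero.2 (hz x hx)
  have h4 : 1 - (x : ℂ) * z⁻¹ = (z - x) * z⁻¹ := by field_simp
  simp only [h1, h4]
  field_simp

/-- The contour integral is the limit of the correlation functions: a holomorphic functional
calculus in which `e^{-tw z}` is expanded into a power series. The integral does not depend on the
loop. -/
theorem limitCorr_eq {α : ℝ} (hα : 0 < α) {γ : ℝ → ℂ} (hγ : IsLoopAroundUnitSegment γ) (t tw : ℝ) :
    limitCorr α γ t tw = (betaMean α hα (semi (betaMean α hα) tw (expFun t)) : ℝ) := by
  set f := expFun t with hf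
  set ν := betaMean α hα with hν
  have hpi : (2 * Real.pi * Complex.I : ℂ) ≠ 0 := Complex.two_pi_I_ne_zero
  obtain ⟨R, hR⟩ := isCompact_Icc.exists_bound_of_continuousOn hγ.continuousOn
  have hR0 : 0 ≤ R := (norm_nonneg _).trans (hR 0 ⟨le_rfl, zero_le_one⟩)
  set G : ℂ → ℂ := fun z => z⁻¹ * ratio α f z⁻¹ with hG
  have hGc : ContinuousOn G offSegment :=
    IsLoopAroundUnitSegment.continuousOn_inv_offSegment.mul
      (IsLoopAroundUnitSegment.continuousOn_ratio_inv hα f)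
  have hint := hγ.intervalIntegrable hGc
  have hsum : HasSum (fun k : ℕ => ∫ s in (0 : ℝ)..1,
        ((-tw) ^ k / (k.factorial : ℝ) : ℂ) * (γ s ^ k * G (γ s) * deriv γ s))
      (∫ s in (0 : ℝ)..1, Complex.exp (-tw * γ s) * G (γ s) * deriv γ s) := by
    have hbsum : Summable fun k : ℕ => (|tw| * R) ^ k / (k.factorial : ℝ) :=
      Real.summable_pow_div_factorial _
    refine intervalIntegral.hasSum_integral_of_dominated_convergence
      (fun k s => (|tw| * R) ^ k / (k.factorial : ℝ) * ‖G (γ s) * deriv γ s‖) (fun k => ?_)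
      (fun k => ae_of_all _ fun s hs => ?_) (ae_of_all _ fun s _ => hbsum.mul_right _) ?_
      (ae_of_all _ fun s _ => ?_)
    · have h1 : ContinuousOn (fun z => z ^ k * G z) offSegment :=
        ContinuousOn.mul (by fun_prop) hGc
      exact (intervalIntegrable_iff.1
        ((hγ.intervalIntegrable h1).const_mul _)).aestronglyMeasurable
    · rw [uIoc_of_le zero_le_one] at hs
      have h1 := hR s ⟨hs.1.le, hs.2⟩
      rw [mul_assoc, norm_mul, norm_mul, norm_div, norm_pow, norm_pow, norm_neg,
        Complex.norm_real, Complex.norm_real, Real.norm_natCast, Real.norm_eq_abs, ← mul_assoc,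
        mul_pow, mul_div_right_comm]
      gcongr
    · simp only [tsum_mul_right]
      exact hint.norm.const_mul _
    · have h1 := (NormedSpace.exp_series_hasSum_exp' (𝕂 := ℂ) (-tw * γ s)).mul_right
        (G (γ s) * deriv γ s)
      rw [← Complex.exp_eq_exp_ℂ] at h1
      convert! h1 using 1
      · ext k
        simp only [smul_eq_mul, mul_pow]
        push_cast
        field_simp
      · ring
  have hval : ∀ k : ℕ, ∫ s in (0 : ℝ)..1,
        ((-tw) ^ k / (k.factorial : ℝ) : ℂ) * (γ s ^ k * G (γ s) * deriv γ s)
      = 2 * Real.pi * Complex.I *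
        ((tw ^ k / (k.factorial : ℝ) * ν ((trapOp ν ^ k) f) : ℝ) : ℂ) := by
    intro k
    have h1 := hγ.pathIntegral_pow_mul_ratio hα k f
    rw [pathIntegral, ← hν] at h1
    set X : ℝ := ν ((trapOp ν ^ k) f)
    rw [intervalIntegral.integral_const_mul, h1, neg_pow]
    have h2 : ((-1 : ℂ) ^ k) * (-1) ^ k = 1 := by rw [← mul_pow]; simp
    push_cast
    linear_combination (2 * Real.pi * Complex.I * (tw ^ k / (k.factorial : ℂ) * X)) * h2
  simp only [hval] at hsum
  have hsum2 : HasSum (fun k : ℕ =>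
      ((tw ^ k / (k.factorial : ℝ) * ν ((trapOp ν ^ k) f) : ℝ) : ℂ)) (ν (semi ν tw f) : ℝ) := by
    have h1 := (hasSum_semi ν tw f).mapL ν
    simp only [map_smul, smul_eq_mul] at h1
    exact Complex.hasSum_ofReal.2 h1
  have huniq := hsum.unique (hsum2.mul_left (2 * Real.pi * Complex.I))
  rw [limitCorr, pathIntegral]
  have hcongr : ∫ s in (0 : ℝ)..1, Complex.exp (-tw * γ s) / γ s
        * (stieltjes α t (γ s) / stieltjes α 0 (γ s)) * deriv γ s
      = ∫ s in (0 : ℝ)..1, Complex.exp (-tw * γ s) * G (γ s) * deriv γ s := by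
    refine intervalIntegral.integral_congr fun s hs => ?_
    rw [uIcc_of_le zero_le_one] at hs
    have hz := hγ.mem_offSegment hs
    have hz0 := ne_zero_of_mem_offSegment hz
    have h1 : expFun 0 = 1 := by ext x; simp
    have h2 := cauchy_one_ne_zero hα (inv_mem_slit hz)
    simp only [stieltjes_eq α _ hz, h1, hG, ratio, ← hf]
    field_simp
  rw [hcongr, huniq]
  field_simp

/-! ### The renewal structure of the semigroup -/

/-- The function `expFun t` as an exponential in the Banach algebra `C([0, 1])`, which makes it
differentiable in `t` for the supremum norm. -/
lemma expFun_eq_exp (t : ℝ) : expFun t = NormedSpace.exp (t • (-coord)) := by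
  let _ : NormedAlgebra ℚ UnitFun := NormedAlgebra.restrictScalars ℚ ℝ _
  ext x
  have h := NormedSpace.map_exp (ContinuousMap.evalAlgHom ℝ ℝ x) (continuous_eval_const x)
    (t • (-coord))
  have h2 : (ContinuousMap.evalAlgHom ℝ ℝ x) (t • (-coord)) = -t * x := by
    simp
  rw [h2, ← Real.exp_eq_exp_ℝ] at h
  exact h.symm

lemma hasDerivAt_expFun (t : ℝ) : HasDerivAt expFun (-(coord * expFun t)) t := by
  have h := hasDerivAt_exp_smul_const' (𝕂 := ℝ) (-coord : UnitFun) t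
  rw [← expFun_eq_exp, neg_mul] at h
  exact h.congr_of_eventuallyEq (Eventually.of_forall expFun_eq_exp)

variable {ν : UnitFun →L[ℝ] ℝ}

lemma IsMean.abs_semi_le (hν : IsMean ν) {s : ℝ} (hs : 0 ≤ s) (f : UnitFun) :
    |ν (semi ν s f)| ≤ ‖f‖ := by
  have hf : ∀ x, |f x| ≤ ‖f‖ := fun x => f.norm_coe_le_norm x
  have h1 : 0 ≤ ‖f‖ • (1 : UnitFun) - f := sub_nonneg.2 fun x => by
    simpa using (abs_le.1 (hf x)).2
  have h2 : 0 ≤ ‖f‖ • (1 : UnitFun) + f := fun x => by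
    have := (abs_le.1 (hf x)).1
    show (0 : ℝ) ≤ ‖f‖ * 1 + f x
    linarith
  have h3 := hν.nonneg _ (hν.semi_nonneg hs h1)
  have h4 := hν.nonneg _ (hν.semi_nonneg hs h2)
  rw [map_sub, map_smul, hν.semi_one, map_sub, map_smul, hν.one] at h3
  rw [map_add, map_smul, hν.semi_one, map_add, map_smul, hν.one] at h4
  simp only [smul_eq_mul, mul_one] at h3 h4
  rw [abs_le]
  exact ⟨by linarith, by linarith⟩

/-- The renewal density: the rate at which the process started from `ν` jumps at time `u`. -/
def jumpDensity (ν : UnitFun →L[ℝ] ℝ) (u : ℝ) : ℝ := ν (semi ν u coord)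

lemma continuous_semi_apply (ν : UnitFun →L[ℝ] ℝ) (f : UnitFun) :
    Continuous fun u => ν (semi ν u f) :=
  ν.continuous.comp ((ContinuousLinearMap.apply ℝ UnitFun f).continuous.comp (continuous_semi ν))

lemma continuous_jumpDensity : Continuous (jumpDensity ν) := continuous_semi_apply ν coord

lemma IsMean.jumpDensity_nonneg (hν : IsMean ν) {u : ℝ} (hu : 0 ≤ u) : 0 ≤ jumpDensity ν u :=
  hν.nonneg _ (hν.semi_nonneg hu coord_nonneg)

lemma IsMean.jumpDensity_le_one (hν : IsMean ν) {u : ℝ} (hu : 0 ≤ u) : jumpDensity ν u ≤ 1 :=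
  (le_abs_self _).trans ((hν.abs_semi_le hu coord).trans norm_coord_le)

lemma continuous_mean_expFun : Continuous fun r => ν (expFun r) :=
  ν.continuous.comp (continuous_iff_continuousAt.2 fun r => (hasDerivAt_expFun r).continuousAt)

/-- The decomposition at the last jump before time `s`, which is Duhamel's formula for `trapOp ν` as
a perturbation of the multiplication by `-X`. -/
lemma mean_semi_expFun (ν : UnitFun →L[ℝ] ℝ) (s t : ℝ) :
    ν (semi ν s (expFun t)) = ν (expFun (s + t))
      + ∫ u in (0 : ℝ)..s, jumpDensity ν u * ν (expFun (s - u + t)) := by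
  have hder : ∀ u ∈ uIcc 0 s, HasDerivAt (fun u => ν (semi ν u (expFun (s - u + t))))
      (jumpDensity ν u * ν (expFun (s - u + t))) u := by
    intro u _
    have h1 : HasDerivAt (fun u : ℝ => s - u + t) (-1) u := by
      simpa using ((hasDerivAt_id u).const_sub s).add_const t
    have h2 := (hasDerivAt_expFun (s - u + t)).scomp u h1
    have h3 := ν.hasFDerivAt.comp_hasDerivAt u ((hasDerivAt_semi ν u).clm_apply h2)
    convert! h3 using 1
    set e := expFun (s - u + t) with he
    have h4 : (semi ν u * trapOp ν) e = semi ν u (ν e • coord - coord * e) := rfl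
    simp only [Function.comp, ← he]
    rw [h4, ← map_add, show ν e • coord - coord * e + (-1 : ℝ) • -(coord * e) = ν e • coord by
      simp, map_smul, map_smul, smul_eq_mul, mul_comm]
    rfl
  have hc : Continuous fun u => jumpDensity ν u * ν (expFun (s - u + t)) :=
    continuous_jumpDensity.mul (continuous_mean_expFun.comp (by fun_prop))
  rw [intervalIntegral.integral_eq_sub_of_hasDerivAt hder (hc.intervalIntegrable _ _)]
  simp

/-- The function `x ↦ 1 / (p + x)`, the Laplace transform of `t ↦ e^{-t x}`. -/
def invFun (p : ℝ) (hp : 0 < p) : UnitFun :=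
  ⟨fun x => (p + x)⁻¹, Continuous.inv₀ (by fun_prop) fun x => by have := x.2.1; positivity⟩

lemma invFun_apply {p : ℝ} (hp : 0 < p) (x : unitInterval) : invFun p hp x = (p + x)⁻¹ := rfl

lemma mul_invFun {p : ℝ} (hp : 0 < p) : p • invFun p hp + coord * invFun p hp = 1 := by
  ext x
  have h : p + (x : ℝ) ≠ 0 := by have := x.2.1; positivity
  simp only [ContinuousMap.add_apply, ContinuousMap.smul_apply, ContinuousMap.mul_apply,
    invFun_apply, coord_apply, smul_eq_mul, ContinuousMap.one_apply]
  field_simp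

lemma IsMean.invFun_pos (hν : IsMean ν) {p : ℝ} (hp : 0 < p) : 0 < ν (invFun p hp) := by
  have h1 : (p + 1)⁻¹ • (1 : UnitFun) ≤ invFun p hp := fun x => by
    have h0 := x.2.1
    have h1 := x.2.2
    show (p + 1)⁻¹ * 1 ≤ (p + (x : ℝ))⁻¹
    rw [mul_one]
    gcongr
  have h2 := hν.mono h1
  rw [map_smul, hν.one, smul_eq_mul, mul_one] at h2
  exact lt_of_lt_of_le (by positivity) h2

lemma tendsto_exp_neg_mul_of_bounded {p C : ℝ} (hp : 0 < p) {F : ℝ → ℝ}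
    (hF : ∀ u, 0 ≤ u → |F u| ≤ C) :
    Tendsto (fun u => -(Real.exp (-(p * u)) * F u)) atTop (𝓝 0) := by
  have h1 : Tendsto (fun u : ℝ => Real.exp (-(p * u))) atTop (𝓝 0) :=
    Real.tendsto_exp_neg_atTop_nhds_zero.comp (tendsto_id.const_mul_atTop hp)
  have h2 := h1.mul_const C
  rw [zero_mul] at h2
  refine squeeze_zero_norm' ?_ h2
  filter_upwards [eventually_ge_atTop 0] with u hu
  rw [norm_neg, norm_mul, Real.norm_of_nonneg (Real.exp_nonneg _)]
  exact mul_le_mul_of_nonneg_left (hF u hu) (Real.exp_nonneg _)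

lemma hasDerivAt_exp_neg_mul (p u : ℝ) :
    HasDerivAt (fun u => Real.exp (-(p * u))) (-p * Real.exp (-(p * u))) u := by
  have := (((hasDerivAt_id u).const_mul p).neg).exp
  convert! this using 1
  simp only [id, Pi.neg_apply]
  ring

/-- The Laplace transform of the renewal density, from the solution
`f = X (p + X)⁻¹ / (p ν((p + X)⁻¹))` of `p f - trapOp ν f = X`. -/
lemma IsMean.integral_exp_mul_jumpDensity (hν : IsMean ν) {p : ℝ} (hp : 0 < p) :
    ∫ u in Ioi (0 : ℝ), Real.exp (-(p * u)) * jumpDensity ν u = (p * ν (invFun p hp))⁻¹ - 1 := by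
  set q := p * ν (invFun p hp) with hq
  have hq0 : 0 < q := mul_pos hp (hν.invFun_pos hp)
  set c := ν (coord * invFun p hp) with hc
  have hqc : q + c = 1 := by
    have := congrArg ν (mul_invFun hp)
    rwa [map_add, map_smul, hν.one, smul_eq_mul] at this
  set f := q⁻¹ • (coord * invFun p hp) with hf
  have hνf : ν f = q⁻¹ * c := by rw [hf, map_smul, smul_eq_mul]
  have hres : p • f - trapOp ν f = coord := by
    have h1 : coord * (p • invFun p hp + coord * invFun p hp) = coord := by
      rw [mul_invFun, mul_one]
    have h2 : p • f - trapOp ν f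
        = q⁻¹ • (coord * (p • invFun p hp + coord * invFun p hp)) - (q⁻¹ * c) • coord := by
      rw [trapOp_apply, hνf, hf]
      ext x
      simp
      ring
    rw [h2, h1, ← sub_smul, show q⁻¹ - q⁻¹ * c = 1 by field_simp; linarith, one_smul]
  have hder : ∀ u ∈ Ici (0 : ℝ), HasDerivAt (fun u => -(Real.exp (-(p * u)) * ν (semi ν u f)))
      (Real.exp (-(p * u)) * jumpDensity ν u) u := by
    intro u _
    have h1 := ν.hasFDerivAt.comp_hasDerivAt u
      ((hasDerivAt_semi ν u).clm_apply (hasDerivAt_const u f))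
    have h2 := ((hasDerivAt_exp_neg_mul p u).mul h1).neg
    convert! h2 using 1
    have h3 : jumpDensity ν u = p * ν (semi ν u f) - ν ((semi ν u * trapOp ν) f) := by
      rw [jumpDensity]
      conv_lhs => rw [← hres]
      rw [map_sub, map_sub, map_smul, map_smul]
      rfl
    simp only [h3, Function.comp, map_zero, add_zero]
    ring
  have h := integral_Ioi_of_hasDerivAt_of_nonneg' hder
    (fun u hu => mul_nonneg (Real.exp_nonneg _) (hν.jumpDensity_nonneg (le_of_lt hu)))
    (tendsto_exp_neg_mul_of_bounded hp fun u hu => hν.abs_semi_le hu f)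
  rw [h]
  simp only [mul_zero, neg_zero, Real.exp_zero, one_mul, semi_zero, zero_sub, neg_neg]
  rw [one_apply_eq_self, hνf]
  field_simp
  linarith

lemma IsMean.integral_exp_mul_expFun (hν : IsMean ν) {p : ℝ} (hp : 0 < p) :
    ∫ u in Ioi (0 : ℝ), Real.exp (-(p * u)) * ν (expFun u) = ν (invFun p hp) := by
  have hder : ∀ u ∈ Ici (0 : ℝ), HasDerivAt
      (fun u => -(Real.exp (-(p * u)) * ν (expFun u * invFun p hp)))
      (Real.exp (-(p * u)) * ν (expFun u)) u := by
    intro u _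
    have h1 := ν.hasFDerivAt.comp_hasDerivAt u ((hasDerivAt_expFun u).mul_const (invFun p hp))
    have h2 := ((hasDerivAt_exp_neg_mul p u).mul h1).neg
    convert! h2 using 1
    have h3 : ν (expFun u)
        = p * ν (expFun u * invFun p hp) + ν (coord * expFun u * invFun p hp) := by
      rw [← smul_eq_mul p, ← map_smul, ← map_add]
      congr 1
      calc expFun u = expFun u * (p • invFun p hp + coord * invFun p hp) := by
            rw [mul_invFun, mul_one]
        _ = _ := by rw [mul_add, mul_smul_comm]; ring
    rw [h3]
    simp only [Function.comp, neg_mul, map_neg]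
    ring
  have h := integral_Ioi_of_hasDerivAt_of_nonneg' hder
    (fun u _ => mul_nonneg (Real.exp_nonneg _) (hν.nonneg _ (expFun_nonneg u)))
    (tendsto_exp_neg_mul_of_bounded (C := ‖invFun p hp‖) hp fun u hu => ?_)
  · rw [h]
    have h1 : expFun 0 = 1 := by ext x; simp
    simp [h1]
  · have h1 : ‖expFun u‖ ≤ 1 := (ContinuousMap.norm_le _ zero_le_one).2 fun x => by
      rw [Real.norm_of_nonneg (show 0 ≤ (expFun u) x from expFun_nonneg u x)]
      exact expFun_le_one hu x
    calc |ν (expFun u * invFun p hp)| ≤ ‖ν‖ * ‖expFun u * invFun p hp‖ := ν.le_opNorm _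
      _ ≤ 1 * (1 * ‖invFun p hp‖) := by
        refine mul_le_mul hν.norm_le_one ((norm_mul_le _ _).trans ?_) (norm_nonneg _) zero_le_one
        exact mul_le_mul_of_nonneg_right h1 (norm_nonneg _)
      _ = _ := by ring

/-! ### Regular variation for the limiting mean -/

section

variable {α : ℝ}

/-- By scaling, the mean of `e^{-r X}` is an incomplete Gamma integral. -/
lemma betaMean_expFun_mul (hα : 0 < α) {r : ℝ} (hr : 0 < r) :
    r ^ α * betaMean α hα (expFun r)
      = α * ∫ y in (0 : ℝ)..r, Real.exp (-y) * y ^ (α - 1) := by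
  rw [betaMean_eq hα (g := fun x => Real.exp (-(r * x))) fun x => by simp]
  have h := intervalIntegral.integral_comp_mul_left (a := 0) (b := 1)
    (fun y : ℝ => Real.exp (-y) * y ^ (α - 1)) hr.ne'
  rw [mul_zero, mul_one] at h
  have h2 : ∫ x in (0 : ℝ)..1, Real.exp (-(r * x)) * (r * x) ^ (α - 1)
      = r ^ (α - 1) * ∫ x in (0 : ℝ)..1, Real.exp (-(r * x)) * x ^ (α - 1) := by
    rw [← intervalIntegral.integral_const_mul]
    refine intervalIntegral.integral_congr fun x hx => ?_
    rw [uIcc_of_le zero_le_one] at hx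
    simp only [Real.mul_rpow hr.le hx.1]
    ring
  rw [h2] at h
  have h3 : r ^ α = r * r ^ (α - 1) := by
    rw [Real.rpow_sub_one hr.ne']; field_simp
  rw [h3]
  have h4 : ∫ y in (0 : ℝ)..r, Real.exp (-y) * y ^ (α - 1)
      = r * (r ^ (α - 1) * ∫ x in (0 : ℝ)..1, Real.exp (-(r * x)) * x ^ (α - 1)) := by
    rw [h, smul_eq_mul]; field_simp
  rw [h4]
  ring

lemma betaMean_expFun_mul_le (hα : 0 < α) {r : ℝ} (hr : 0 < r) :
    r ^ α * betaMean α hα (expFun r) ≤ Real.Gamma (1 + α) := by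
  rw [betaMean_expFun_mul hα hr, add_comm, Real.Gamma_add_one hα.ne', Real.Gamma_eq_integral hα,
    intervalIntegral.integral_of_le hr.le]
  refine mul_le_mul_of_nonneg_left ?_ hα.le
  refine setIntegral_mono_set (Real.GammaIntegral_convergent hα) ?_
    Ioc_subset_Ioi_self.eventuallyLE
  filter_upwards [ae_restrict_mem measurableSet_Ioi] with y hy
  exact mul_nonneg (Real.exp_nonneg _) (Real.rpow_nonneg (le_of_lt hy) _)

lemma tendsto_betaMean_expFun_mul (hα : 0 < α) :
    Tendsto (fun r => r ^ α * betaMean α hα (expFun r)) atTop (𝓝 (Real.Gamma (1 + α))) := by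
  rw [add_comm, Real.Gamma_add_one hα.ne', Real.Gamma_eq_integral hα]
  have h := (intervalIntegral_tendsto_integral_Ioi 0 (Real.GammaIntegral_convergent hα)
    tendsto_id).const_mul α
  refine h.congr' ?_
  filter_upwards [eventually_gt_atTop 0] with r hr
  rw [betaMean_expFun_mul hα hr]
  rfl

/-- The Abelian theorem for `r ↦ ν(e^{-r X})`, by dominated convergence after rescaling. -/
lemma tendsto_rpow_mul_laplace_betaMean_expFun (hα : 0 < α) (hα1 : α < 1) :
    Tendsto (fun p => p ^ (1 - α) *
        ∫ u in Ioi (0 : ℝ), Real.exp (-(p * u)) * betaMean α hα (expFun u))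
      (𝓝[>] 0) (𝓝 (Real.Gamma (1 + α) * Real.Gamma (1 - α))) := by
  set ν := betaMean α hα
  have hν : IsMean ν := isMean_betaMean hα
  have hα' : 0 < 1 - α := by linarith
  set g : ℝ → ℝ := fun r => r ^ α * ν (expFun r) with hg
  have hgamma := Real.GammaIntegral_convergent hα'
  have hgc : Measurable g :=
    (measurable_id.pow_const α).mul continuous_mean_expFun.measurable
  have hlim : Tendsto (fun p => ∫ v in Ioi (0 : ℝ),
      (Real.exp (-v) * v ^ (1 - α - 1)) * g (p⁻¹ * v)) (𝓝[>] 0)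
      (𝓝 (∫ v in Ioi (0 : ℝ), (Real.exp (-v) * v ^ (1 - α - 1)) * Real.Gamma (1 + α))) := by
    refine tendsto_integral_filter_of_dominated_convergence
      (fun v => (Real.exp (-v) * v ^ (1 - α - 1)) * Real.Gamma (1 + α)) ?_ ?_
      (hgamma.mul_const _) ?_
    · refine Eventually.of_forall fun p => Measurable.aestronglyMeasurable ?_
      exact ((by fun_prop : Measurable fun v : ℝ => Real.exp (-v)).mul
        (measurable_id.pow_const _)).mul (hgc.comp (measurable_const_mul _))
    · filter_upwards [self_mem_nhdsWithin] with p hp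
      filter_upwards [ae_restrict_mem measurableSet_Ioi] with v hv
      have hpv : 0 < p⁻¹ * v := mul_pos (inv_pos.2 hp) hv
      have h1 : 0 ≤ g (p⁻¹ * v) :=
        mul_nonneg (Real.rpow_nonneg hpv.le _) (hν.nonneg _ (expFun_nonneg _))
      have h2 : 0 ≤ Real.exp (-v) * v ^ (1 - α - 1) :=
        mul_nonneg (Real.exp_nonneg _) (Real.rpow_nonneg (le_of_lt hv) _)
      rw [Real.norm_of_nonneg (mul_nonneg h2 h1)]
      exact mul_le_mul_of_nonneg_left (betaMean_expFun_mul_le hα hpv) h2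
    · filter_upwards [ae_restrict_mem measurableSet_Ioi] with v hv
      refine Tendsto.const_mul _ ?_
      exact (tendsto_betaMean_expFun_mul hα).comp
        (tendsto_inv_nhdsGT_zero.atTop_mul_const hv)
  rw [integral_mul_const, ← Real.Gamma_eq_integral hα', mul_comm] at hlim
  refine hlim.congr' ?_
  filter_upwards [self_mem_nhdsWithin] with p hp
  have hp' : 0 < p := hp
  have h := integral_comp_mul_left_Ioi (fun u => Real.exp (-(p * u)) * ν (expFun u)) 0
    (inv_pos.2 hp')
  rw [mul_zero, inv_inv, smul_eq_mul] at h
  have h1 : p ^ (1 - α) = p ^ (-α) * p := by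
    rw [← Real.rpow_add_one hp'.ne']; ring_nf
  rw [h1, mul_assoc, ← h, ← integral_const_mul]
  refine setIntegral_congr_fun measurableSet_Ioi fun v hv => ?_
  have hv' : 0 < v := hv
  have h2 : (p⁻¹ * v) ^ α = p ^ (-α) * v ^ α := by
    rw [Real.mul_rpow (inv_pos.2 hp').le hv'.le, Real.inv_rpow hp'.le, Real.rpow_neg hp'.le]
  have h3 : v ^ (1 - α - 1) * v ^ α = 1 := by
    rw [← Real.rpow_add hv']; simp
  have h4 : p * (p⁻¹ * v) = v := by field_simp
  simp only [hg, h2, h4]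
  linear_combination (Real.exp (-v) * p ^ (-α) * ν (expFun (p⁻¹ * v))) * h3

/-- The Laplace transform of the renewal density is regularly varying at `0` with exponent `-α`; the
constant is the inverse of the one for `p^{1 - α} ν(1 / (p + X))`. -/
lemma tendsto_laplace_jumpDensity (hα : 0 < α) (hα1 : α < 1) :
    Tendsto (fun p => p ^ α * ∫ u in Ioi (0 : ℝ),
        Real.exp (-(p * u)) * jumpDensity (betaMean α hα) u) (𝓝[>] 0)
      (𝓝 (Real.Gamma (1 + α) * Real.Gamma (1 - α))⁻¹) := by
  have hν := isMean_betaMean hα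
  have hpos : 0 < Real.Gamma (1 + α) * Real.Gamma (1 - α) :=
    mul_pos (Real.Gamma_pos_of_pos (by linarith)) (Real.Gamma_pos_of_pos (by linarith))
  have h1 := (tendsto_rpow_mul_laplace_betaMean_expFun hα hα1).inv₀ hpos.ne'
  have h2 : Tendsto (fun p : ℝ => p ^ α) (𝓝[>] 0) (𝓝 0) := by
    have h := (Real.continuousAt_rpow_const 0 α (Or.inr hα.le)).tendsto
    rw [Real.zero_rpow hα.ne'] at h
    exact h.mono_left nhdsWithin_le_nhds
  have h3 := h1.sub h2
  rw [sub_zero] at h3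
  refine h3.congr' ?_
  filter_upwards [self_mem_nhdsWithin] with p hp
  have hp' : 0 < p := hp
  rw [hν.integral_exp_mul_jumpDensity hp', hν.integral_exp_mul_expFun hp']
  have h4 := hν.invFun_pos hp'
  rw [Real.rpow_sub hp', Real.rpow_one]
  have h5 := Real.rpow_pos_of_pos hp' α
  field_simp

end

/-! ### Karamata's Tauberian argument -/

lemma IntegrableOn.mul_bounded_continuous {W F : ℝ → ℝ} {C : ℝ} (hW : IntegrableOn W (Ioi 0))
    (hF : Continuous F) (hC : ∀ v, |F v| ≤ C) : IntegrableOn (fun v => W v * F v) (Ioi 0) :=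
  Integrable.mul_bdd (c := C) hW hF.aestronglyMeasurable (ae_of_all _ hC)

lemma integrableOn_mul_IccExtend {W : ℝ → ℝ} (hW : IntegrableOn W (Ioi 0)) (f : UnitFun) :
    IntegrableOn (fun v => W v * IccExtend zero_le_one f (Real.exp (-v))) (Ioi 0) := by
  refine IntegrableOn.mul_bounded_continuous hW ?_ fun v => f.norm_coe_le_norm _
  exact f.continuous.Icc_extend'.comp (by fun_prop)

open Classical in
/-- The functional `ψ ↦ ∫₀^∞ W(v) ψ(e^{-v}) dv` on `C([0, 1])`, whose moments are values of the
Laplace transform of `W`; it is zero by convention if `W` is not integrable. -/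
def weightFunctional (W : ℝ → ℝ) : UnitFun →L[ℝ] ℝ :=
  if hW : IntegrableOn W (Ioi 0) then
    LinearMap.mkContinuous
      { toFun := fun ψ => ∫ v in Ioi (0 : ℝ), W v * IccExtend zero_le_one ψ (Real.exp (-v))
        map_add' := fun f g => by
          rw [← integral_add (integrableOn_mul_IccExtend hW f) (integrableOn_mul_IccExtend hW g)]
          simp only [IccExtend, Function.comp, ContinuousMap.add_apply, mul_add]
        map_smul' := fun c f => by
          simp only [IccExtend, Function.comp, ContinuousMap.smul_apply, smul_eq_mul,
            RingHom.id_apply, ← integral_const_mul]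
          congr 1
          ext v
          ring }
      (∫ v in Ioi (0 : ℝ), |W v|) fun f => by
        rw [← integral_mul_const]
        refine norm_integral_le_of_norm_le (hW.abs.mul_const _) (ae_of_all _ fun v => ?_)
        rw [norm_mul, Real.norm_eq_abs]
        exact mul_le_mul_of_nonneg_left (f.norm_coe_le_norm _) (abs_nonneg _)
  else 0

lemma weightFunctional_apply {W : ℝ → ℝ} (hW : IntegrableOn W (Ioi 0)) (ψ : UnitFun) :
    weightFunctional W ψ = ∫ v in Ioi (0 : ℝ), W v * IccExtend zero_le_one ψ (Real.exp (-v)) := by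
  rw [weightFunctional, dif_pos hW]
  rfl

lemma norm_weightFunctional_le {W : ℝ → ℝ} (hW : IntegrableOn W (Ioi 0)) :
    ‖weightFunctional W‖ ≤ ∫ v in Ioi (0 : ℝ), |W v| := by
  rw [weightFunctional, dif_pos hW]
  exact LinearMap.mkContinuous_norm_le _ (integral_nonneg fun _ => abs_nonneg _) _

section

variable {ι : Type*} {l : Filter ι} {W : ι → ℝ → ℝ} {W₀ : ℝ → ℝ}

/-- Convergence of the Laplace transforms at the natural numbers implies convergence of the
integrals of a continuous function which vanishes far out, and therefore is a continuous function of
`e^{-v}`. -/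
lemma tendsto_integral_mul_of_laplace
    (hW : ∀ᶠ i in l, IntegrableOn (W i) (Ioi 0) ∧ ∀ v, 0 < v → 0 ≤ W i v)
    (hW₀ : IntegrableOn W₀ (Ioi 0))
    (hlim : ∀ k : ℕ, Tendsto (fun i => ∫ v in Ioi (0 : ℝ), W i v * Real.exp (-(k * v))) l
      (𝓝 (∫ v in Ioi (0 : ℝ), W₀ v * Real.exp (-(k * v)))))
    {H : ℝ → ℝ} (hH : Continuous H) (hH2 : ∀ v, 2 ≤ v → H v = 0) :
    Tendsto (fun i => ∫ v in Ioi (0 : ℝ), W i v * H v) l (𝓝 (∫ v in Ioi (0 : ℝ), W₀ v * H v)) := by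
  -- `H` as a function of `x = e^{-v}`
  set ψ : UnitFun := ⟨fun x => H (-Real.log (max (x : ℝ) (Real.exp (-2)))),
    hH.comp (Continuous.neg (Continuous.log (by fun_prop)
      fun x => ((Real.exp_pos (-2)).trans_le (le_max_right _ _)).ne'))⟩ with hψ
  have hexp : ∀ v ∈ Ioi (0 : ℝ), Real.exp (-v) ∈ Icc (0 : ℝ) 1 := fun v hv =>
    ⟨(Real.exp_pos _).le, by simpa using le_of_lt hv⟩
  have hψH : ∀ v ∈ Ioi (0 : ℝ), IccExtend zero_le_one ψ (Real.exp (-v)) = H v := by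
    intro v hv
    rw [IccExtend_of_mem _ _ (hexp v hv)]
    show H (-Real.log (max (Real.exp (-v)) (Real.exp (-2)))) = H v
    rcases le_total v 2 with h | h
    · rw [max_eq_left (Real.exp_le_exp.2 (by linarith)), Real.log_exp, neg_neg]
    · rw [max_eq_right (Real.exp_le_exp.2 (by linarith)), Real.log_exp, neg_neg, hH2 v h,
        hH2 2 le_rfl]
  have happly : ∀ {w : ℝ → ℝ}, IntegrableOn w (Ioi 0) →
      weightFunctional w ψ = ∫ v in Ioi (0 : ℝ), w v * H v := by
    intro w hw
    rw [weightFunctional_apply hw]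
    exact setIntegral_congr_fun measurableSet_Ioi fun v hv => by simp only [hψH v hv]
  have hmono : ∀ {w : ℝ → ℝ}, IntegrableOn w (Ioi 0) → ∀ k : ℕ,
      weightFunctional w (coord ^ k) = ∫ v in Ioi (0 : ℝ), w v * Real.exp (-(k * v)) := by
    intro w hw k
    rw [weightFunctional_apply hw]
    refine setIntegral_congr_fun measurableSet_Ioi fun v hv => ?_
    simp only [IccExtend_of_mem _ _ (hexp v hv), ContinuousMap.pow_apply, coord_apply]
    rw [← Real.exp_nat_mul]
    ring_nf
  have hbound : ∀ᶠ i in l, ‖weightFunctional (W i)‖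
      ≤ (∫ v in Ioi (0 : ℝ), W₀ v * Real.exp (-((0 : ℕ) * v))) + 1 := by
    filter_upwards [hW, (hlim 0).eventually_le_const (lt_add_one _)] with i hi hi2
    refine (norm_weightFunctional_le hi.1).trans (le_trans (le_of_eq ?_) hi2)
    refine setIntegral_congr_fun measurableSet_Ioi fun v hv => ?_
    simp [abs_of_nonneg (hi.2 v hv)]
  have h := tendsto_of_tendsto_monomials (ν := fun i => weightFunctional (W i))
    (μ := weightFunctional W₀) hbound (fun k => ?_) ψ
  · rw [happly hW₀] at h
    refine h.congr' ?_
    filter_upwards [hW] with i hi using happly hi.1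
  · rw [hmono hW₀]
    refine (hlim k).congr' ?_
    filter_upwards [hW] with i hi using (hmono hi.1 k).symm

/-- The continuous function equal to `1` up to `a - 1 / n`, to `0` from `a` on, and affine in
between. -/
def ramp (a : ℝ) (n : ℕ) (v : ℝ) : ℝ := max 0 (min 1 (n * (a - v)))

lemma continuous_ramp (a : ℝ) (n : ℕ) : Continuous (ramp a n) := by
  unfold ramp; fun_prop

lemma ramp_nonneg (a : ℝ) (n : ℕ) (v : ℝ) : 0 ≤ ramp a n v := le_max_left _ _

lemma ramp_le_one (a : ℝ) (n : ℕ) (v : ℝ) : ramp a n v ≤ 1 := max_le zero_le_one (min_le_left _ _)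

lemma ramp_of_ge {a v : ℝ} (n : ℕ) (h : a ≤ v) : ramp a n v = 0 := by
  have : (n : ℝ) * (a - v) ≤ 0 := mul_nonpos_of_nonneg_of_nonpos n.cast_nonneg (by linarith)
  rw [ramp, max_eq_left ((min_le_right _ _).trans this)]

lemma ramp_of_le {a v : ℝ} {n : ℕ} (h : 1 ≤ n * (a - v)) : ramp a n v = 1 := by
  rw [ramp, min_eq_left h, max_eq_right zero_le_one]

/-- Ramps whose steep parts shrink to the point `1` approximate the cutoff at `1`. -/
lemma tendsto_integral_mul_ramp {w : ℝ → ℝ} (hw : IntegrableOn w (Ioi 0)) {h : ℝ → ℝ}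
    (hc : Continuous h) {C : ℝ} (hC : ∀ v, |h v| ≤ C) {a : ℕ → ℝ}
    (hlt : ∀ v < 1, ∀ᶠ n : ℕ in atTop, 1 ≤ n * (a n - v)) (hgt : ∀ v > 1, ∀ᶠ n in atTop, a n ≤ v) :
    Tendsto (fun n => ∫ v in Ioi (0 : ℝ), w v * (h v * ramp (a n) n v)) atTop
      (𝓝 (∫ v in (0 : ℝ)..1, w v * h v)) := by
  have hrhs : ∫ v in (0 : ℝ)..1, w v * h v
      = ∫ v in Ioi (0 : ℝ), (Iic (1 : ℝ)).indicator (fun v => w v * h v) v := by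
    rw [intervalIntegral.integral_of_le zero_le_one, setIntegral_indicator measurableSet_Iic,
      Ioi_inter_Iic]
  rw [hrhs]
  refine tendsto_integral_of_dominated_convergence (fun v => |w v| * C) (fun n => ?_)
    (hw.abs.mul_const C) (fun n => ae_of_all _ fun v => ?_) ?_
  · exact hw.aestronglyMeasurable.mul (hc.mul (continuous_ramp _ _)).aestronglyMeasurable
  · rw [norm_mul, norm_mul, Real.norm_eq_abs, Real.norm_eq_abs,
      Real.norm_of_nonneg (ramp_nonneg _ _ _)]
    refine mul_le_mul_of_nonneg_left ?_ (abs_nonneg _)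
    calc |h v| * ramp (a n) n v ≤ C * 1 :=
          mul_le_mul (hC v) (ramp_le_one _ _ _) (ramp_nonneg _ _ _) ((abs_nonneg _).trans (hC v))
      _ = C := mul_one C
  · filter_upwards [compl_mem_ae_iff.2 (measure_singleton (1 : ℝ) (μ := volume.restrict (Ioi 0)))]
      with v hv
    rcases lt_or_gt_of_ne (show v ≠ 1 from hv) with hv1 | hv1
    · rw [indicator_of_mem (mem_Iic.2 hv1.le)]
      refine tendsto_const_nhds.congr' ?_
      filter_upwards [hlt v hv1] with n hn
      rw [ramp_of_le hn, mul_one]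
    · rw [indicator_of_notMem (by simpa using hv1)]
      refine tendsto_const_nhds.congr' ?_
      filter_upwards [hgt v hv1] with n hn
      rw [ramp_of_ge n hn, mul_zero, mul_zero]

/-- Karamata's theorem: convergence of the Laplace transforms of nonnegative weights implies
convergence of the weighted integrals over `[0, 1]` of a nonnegative bounded continuous function, by
approximating the cutoff from below and from above by ramps. -/
theorem tendsto_intervalIntegral_of_laplace
    (hW : ∀ᶠ i in l, IntegrableOn (W i) (Ioi 0) ∧ ∀ v, 0 < v → 0 ≤ W i v)
    (hW₀ : IntegrableOn W₀ (Ioi 0))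
    (hlim : ∀ k : ℕ, Tendsto (fun i => ∫ v in Ioi (0 : ℝ), W i v * Real.exp (-(k * v))) l
      (𝓝 (∫ v in Ioi (0 : ℝ), W₀ v * Real.exp (-(k * v)))))
    {h : ℝ → ℝ} (hc : Continuous h) (h0 : ∀ v, 0 ≤ h v) {C : ℝ} (hC : ∀ v, h v ≤ C) :
    Tendsto (fun i => ∫ v in (0 : ℝ)..1, W i v * h v) l (𝓝 (∫ v in (0 : ℝ)..1, W₀ v * h v)) := by
  have habs : ∀ v, |h v| ≤ C := fun v => by rw [abs_of_nonneg (h0 v)]; exact hC v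
  -- the approximations from below and from above
  have hlow := tendsto_integral_mul_ramp hW₀ hc habs (a := fun _ => 1) (fun v hv => by
      have h1 : 0 < 1 - v := by linarith
      filter_upwards [(tendsto_natCast_atTop_atTop (R := ℝ)).eventually_ge_atTop (1 - v)⁻¹]
        with n hn
      rwa [inv_le_iff_one_le_mul₀ h1] at hn)
    (fun v hv => Eventually.of_forall fun _ => le_of_lt hv)
  have hupp := tendsto_integral_mul_ramp hW₀ hc habs (a := fun n => 1 + (n : ℝ)⁻¹) (fun v hv => by
      filter_upwards [eventually_gt_atTop 0] with n hn
      have hn' : (0 : ℝ) < n := by exact_mod_cast hn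
      have h1 : (n : ℝ) * (1 + (n : ℝ)⁻¹ - v) = n * (1 - v) + 1 := by field_simp; ring
      rw [h1]
      have : 0 ≤ (n : ℝ) * (1 - v) := mul_nonneg hn'.le (by linarith)
      linarith)
    (fun v hv => by
      have h1 : Tendsto (fun n : ℕ => 1 + (n : ℝ)⁻¹) atTop (𝓝 (1 + 0)) :=
        tendsto_inv_atTop_nhds_zero_nat.const_add 1
      rw [add_zero] at h1
      exact h1.eventually_le_const hv)
  have hconv : ∀ (a : ℝ) (n : ℕ), a ≤ 2 → Tendsto
      (fun i => ∫ v in Ioi (0 : ℝ), W i v * (h v * ramp a n v)) l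
      (𝓝 (∫ v in Ioi (0 : ℝ), W₀ v * (h v * ramp a n v))) := fun a n ha =>
    tendsto_integral_mul_of_laplace hW hW₀ hlim (hc.mul (continuous_ramp a n)) fun v hv => by
      rw [ramp_of_ge n (ha.trans hv), mul_zero]
  have hint : ∀ {w : ℝ → ℝ} (a : ℝ) (n : ℕ), IntegrableOn w (Ioi 0) →
      IntegrableOn (fun v => w v * (h v * ramp a n v)) (Ioi 0) := fun a n hw =>
    IntegrableOn.mul_bounded_continuous hw (hc.mul (continuous_ramp a n)) (C := C) fun v => by
      rw [abs_of_nonneg (mul_nonneg (h0 v) (ramp_nonneg _ _ _))]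
      calc h v * ramp a n v ≤ h v * 1 := mul_le_mul_of_nonneg_left (ramp_le_one _ _ _) (h0 v)
        _ ≤ C := by rw [mul_one]; exact hC v
  have hrhs : ∀ w : ℝ → ℝ, ∫ v in (0 : ℝ)..1, w v * h v
      = ∫ v in Ioi (0 : ℝ), (Iic (1 : ℝ)).indicator (fun v => w v * h v) v := by
    intro w
    rw [intervalIntegral.integral_of_le zero_le_one, setIntegral_indicator measurableSet_Iic,
      Ioi_inter_Iic]
  have hint' : ∀ {w : ℝ → ℝ}, IntegrableOn w (Ioi 0) →
      IntegrableOn ((Iic (1 : ℝ)).indicator (fun v => w v * h v)) (Ioi 0) := fun hw =>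
    (IntegrableOn.mul_bounded_continuous hw hc habs).indicator measurableSet_Iic
  refine tendsto_order.2 ⟨fun b hb => ?_, fun b hb => ?_⟩
  · obtain ⟨n, hn⟩ := (hlow.eventually_const_lt hb).exists
    filter_upwards [(hconv 1 n one_le_two).eventually_const_lt hn, hW] with i hi hWi
    refine hi.trans_le ?_
    rw [hrhs]
    refine setIntegral_mono_on (hint 1 n hWi.1) (hint' hWi.1) measurableSet_Ioi fun v hv => ?_
    by_cases hv1 : v ≤ 1
    · rw [indicator_of_mem (mem_Iic.2 hv1)]
      refine mul_le_mul_of_nonneg_left ?_ (hWi.2 v hv)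
      exact mul_le_of_le_one_right (h0 v) (ramp_le_one _ _ _)
    · rw [indicator_of_notMem (by simpa using hv1), ramp_of_ge n (not_le.1 hv1).le, mul_zero,
        mul_zero]
  · obtain ⟨n, hn, hn0⟩ := ((hupp.eventually_lt_const hb).and (eventually_gt_atTop 0)).exists
    have hn1 : (1 : ℝ) ≤ n := by exact_mod_cast hn0
    have ha2 : 1 + (n : ℝ)⁻¹ ≤ 2 := by linarith [inv_le_one_of_one_le₀ hn1]
    filter_upwards [(hconv _ n ha2).eventually_lt_const hn, hW] with i hi hWi
    refine lt_of_le_of_lt ?_ hi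
    rw [hrhs]
    refine setIntegral_mono_on (hint' hWi.1) (hint _ n hWi.1) measurableSet_Ioi fun v hv => ?_
    by_cases hv1 : v ≤ 1
    · have h1 : (n : ℝ) * (1 + (n : ℝ)⁻¹ - v) = n * (1 - v) + 1 := by field_simp; ring
      have h2 : 0 ≤ (n : ℝ) * (1 - v) := mul_nonneg (by linarith) (by linarith)
      rw [indicator_of_mem (mem_Iic.2 hv1), ramp_of_le (by rw [h1]; linarith), mul_one]
    · rw [indicator_of_notMem (by simpa using hv1)]
      exact mul_nonneg (hWi.2 v hv) (mul_nonneg (h0 v) (ramp_nonneg _ _ _))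

end

/-! ### Ageing -/

section

variable {α : ℝ}

/-- The rescaled weight `s^{1 - α} m(s v)`; the factor `e^{-v}` makes it integrable on the half
line. -/
def scaledWeight (α : ℝ) (m : ℝ → ℝ) (s v : ℝ) : ℝ := s ^ (1 - α) * m (s * v) * Real.exp (-v)

/-- The limit of the rescaled renewal densities: a multiple of `v^{α - 1}`, with the same factor
`e^{-v}` as in `scaledWeight`. -/
def limitWeight (α : ℝ) (v : ℝ) : ℝ :=
  (Real.Gamma (1 + α) * Real.Gamma (1 - α))⁻¹ / Real.Gamma α * (Real.exp (-v) * v ^ (α - 1))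

lemma integrableOn_limitWeight (hα : 0 < α) : IntegrableOn (limitWeight α) (Ioi 0) :=
  (Real.GammaIntegral_convergent hα).const_mul _

lemma scaledWeight_nonneg_integrableOn {m : ℝ → ℝ} (hm : Continuous m)
    (hm0 : ∀ u, 0 ≤ u → 0 ≤ m u) (hm1 : ∀ u, 0 ≤ u → m u ≤ 1) {s : ℝ} (hs : 0 < s) :
    IntegrableOn (scaledWeight α m s) (Ioi 0) ∧ ∀ v, 0 < v → 0 ≤ scaledWeight α m s v := by
  have h0 : ∀ v, 0 < v → 0 ≤ scaledWeight α m s v := fun v hv =>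
    mul_nonneg (mul_nonneg (Real.rpow_nonneg hs.le _) (hm0 _ (mul_pos hs hv).le))
      (Real.exp_nonneg _)
  have hexp : IntegrableOn (fun v : ℝ => Real.exp (-v)) (Ioi 0) := by
    simpa using exp_neg_integrableOn_Ioi 0 one_pos
  refine ⟨Integrable.mono' (hexp.const_mul (s ^ (1 - α))) ?_ ?_, h0⟩
  · unfold scaledWeight
    exact (by fun_prop : Continuous _).aestronglyMeasurable
  · filter_upwards [ae_restrict_mem measurableSet_Ioi] with v hv
    rw [Real.norm_of_nonneg (h0 v hv), scaledWeight]
    refine mul_le_mul_of_nonneg_right ?_ (Real.exp_nonneg _)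
    exact mul_le_of_le_one_right (Real.rpow_nonneg hs.le _) (hm1 _ (mul_pos hs hv).le)

/-- The factor `e^{-v}` shifts the argument of the Laplace transform, so that only the behavior of
the transform of the renewal density at `(k + 1) / s`, with `k + 1 > 0`, matters. -/
lemma tendsto_laplace_scaledWeight (hα : 0 < α) (hα1 : α < 1) (k : ℕ) :
    Tendsto (fun s => ∫ v in Ioi (0 : ℝ),
        scaledWeight α (jumpDensity (betaMean α hα)) s v * Real.exp (-(k * v))) atTop
      (𝓝 (∫ v in Ioi (0 : ℝ), limitWeight α v * Real.exp (-(k * v)))) := by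
  set m := jumpDensity (betaMean α hα) with hm
  set κ := (Real.Gamma (1 + α) * Real.Gamma (1 - α))⁻¹ with hκ
  have hk : (0 : ℝ) < (k : ℝ) + 1 := by positivity
  have hΓ : 0 < Real.Gamma α := Real.Gamma_pos_of_pos hα
  have hval : ∫ v in Ioi (0 : ℝ), limitWeight α v * Real.exp (-(k * v))
      = ((k : ℝ) + 1) ^ (-α) * κ := by
    have h1 : ∀ v : ℝ, limitWeight α v * Real.exp (-(k * v))
        = κ / Real.Gamma α * (v ^ (α - 1) * Real.exp (-(((k : ℝ) + 1) * v))) := by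
      intro v
      rw [limitWeight, show -(((k : ℝ) + 1) * v) = -v + -(k * v) by ring, Real.exp_add, ← hκ]
      ring
    simp only [h1]
    rw [integral_const_mul, Real.integral_rpow_mul_exp_neg_mul_Ioi hα hk, one_div,
      Real.inv_rpow hk.le, Real.rpow_neg hk.le]
    field_simp
  have hp : Tendsto (fun s : ℝ => ((k : ℝ) + 1) / s) atTop (𝓝[>] 0) := by
    refine tendsto_nhdsWithin_iff.2 ⟨tendsto_const_nhds.div_atTop tendsto_id, ?_⟩
    filter_upwards [eventually_gt_atTop 0] with s hs using div_pos hk hs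
  have hlim := ((tendsto_laplace_jumpDensity hα hα1).comp hp).const_mul (((k : ℝ) + 1) ^ (-α))
  rw [hval]
  refine hlim.congr' ?_
  filter_upwards [eventually_gt_atTop 0] with s hs
  have h := integral_comp_mul_left_Ioi
    (fun u => Real.exp (-(((k : ℝ) + 1) / s * u)) * m u) 0 hs
  rw [mul_zero, smul_eq_mul] at h
  have h2 : ∀ v : ℝ, scaledWeight α m s v * Real.exp (-(k * v))
      = s ^ (1 - α) * (Real.exp (-(((k : ℝ) + 1) / s * (s * v))) * m (s * v)) := by
    intro v
    rw [scaledWeight, show -(((k : ℝ) + 1) / s * (s * v)) = -v + -(k * v) by field_simp; ring,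
      Real.exp_add]
    ring
  simp only [h2, Function.comp]
  rw [integral_const_mul, h, Real.div_rpow hk.le hs.le, Real.rpow_neg hk.le, Real.rpow_sub hs,
    Real.rpow_one]
  have h3 := Real.rpow_pos_of_pos hk α
  have h4 := Real.rpow_pos_of_pos hs α
  field_simp
  rfl

/-- The function `e^v (1 + θ - v)^{-α}`, with `v` replaced by `min v 1`: this does not change it on
`[0, 1]` and makes it bounded and continuous on the line. The factor `e^v` undoes the one in
`scaledWeight`. -/
def profile (α θ v : ℝ) : ℝ := Real.exp (min v 1) * (1 + θ - min v 1) ^ (-α)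

lemma continuous_profile {θ : ℝ} (hθ : 0 < θ) : Continuous (profile α θ) := by
  refine Continuous.mul (by fun_prop) (Continuous.rpow_const (by fun_prop) fun v => Or.inl ?_)
  have := min_le_right v 1
  linarith

lemma profile_nonneg {θ : ℝ} (hθ : 0 < θ) (v : ℝ) : 0 ≤ profile α θ v :=
  mul_nonneg (Real.exp_nonneg _) (Real.rpow_nonneg (by linarith [min_le_right v 1]) _)

lemma profile_le (hα : 0 < α) {θ : ℝ} (hθ : 0 < θ) (v : ℝ) :
    profile α θ v ≤ Real.exp 1 * θ ^ (-α) := by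
  have := min_le_right v 1
  refine mul_le_mul (Real.exp_le_exp.2 this) ?_ (Real.rpow_nonneg (by linarith) _)
    (Real.exp_nonneg _)
  exact Real.rpow_le_rpow_of_nonpos hθ (by linarith) (by linarith)

/-- The substitution `u = 1 - v / (1 + θ)` and Euler's reflection formula. -/
lemma integral_limitWeight_mul_profile (hα : 0 < α) (hα1 : α < 1) {θ : ℝ} (hθ : 0 < θ) :
    Real.Gamma (1 + α) * ∫ v in (0 : ℝ)..1, limitWeight α v * profile α θ v = ageing α θ := by
  have hc : 0 < 1 + θ := by linarith
  have h1 := intervalIntegral.integral_comp_sub_div (a := 0) (b := 1)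
    (fun u : ℝ => u ^ (-α) * (1 - u) ^ (α - 1)) hc.ne' 1
  rw [zero_div, sub_zero, show 1 - 1 / (1 + θ) = θ / (1 + θ) by field_simp; ring, smul_eq_mul] at h1
  have h2 : ∫ v in (0 : ℝ)..1, limitWeight α v * profile α θ v
      = (Real.Gamma (1 + α) * Real.Gamma (1 - α))⁻¹ / Real.Gamma α * ((1 + θ)⁻¹ *
        ∫ v in (0 : ℝ)..1, (1 - v / (1 + θ)) ^ (-α) * (1 - (1 - v / (1 + θ))) ^ (α - 1)) := by
    rw [← intervalIntegral.integral_const_mul, ← intervalIntegral.integral_const_mul]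
    refine intervalIntegral.integral_congr fun v hv => ?_
    rw [uIcc_of_le zero_le_one] at hv
    have h3 : 1 - v / (1 + θ) = (1 + θ - v) / (1 + θ) := by field_simp
    have h4 : 1 - (1 - v / (1 + θ)) = v / (1 + θ) := by ring
    have h5 : Real.exp (-v) * Real.exp v = 1 := by rw [← Real.exp_add]; simp
    simp only [limitWeight, profile, min_eq_left hv.2]
    rw [h4, h3, Real.div_rpow (by linarith [hv.2]) hc.le, Real.div_rpow hv.1 hc.le,
      Real.rpow_sub_one hc.ne', Real.rpow_neg hc.le]
    have h6 := Real.rpow_pos_of_pos hc α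
    field_simp
    linear_combination (v ^ (α - 1) * (1 + θ - v) ^ (-α) * (Real.Gamma (1 - α))⁻¹) * h5
  have hΓ := Real.Gamma_mul_Gamma_one_sub α
  have hΓ1 : 0 < Real.Gamma (1 + α) := Real.Gamma_pos_of_pos (by linarith)
  have hΓ2 : 0 < Real.Gamma (1 - α) := Real.Gamma_pos_of_pos (by linarith)
  have hΓ3 : 0 < Real.Gamma α := Real.Gamma_pos_of_pos hα
  have hsin : Real.sin (Real.pi * α) / Real.pi = (Real.Gamma α * Real.Gamma (1 - α))⁻¹ := by
    rw [hΓ, inv_div]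
  rw [h2, h1, ageing, hsin]
  field_simp

/-- The limit of the correlation function over the window `(s, s + θ s]` as `s → ∞`. In the
last-jump decomposition, `G(r) = r^{-α} g(r)` with `g → Γ(1 + α)`, and the arguments `s - u + θ s ≥
θ s` tend to infinity uniformly in `u ≤ s`, so that `g` may be replaced by its limit. -/
theorem tendsto_betaMean_semi_ageing (hα : 0 < α) (hα1 : α < 1) {θ : ℝ} (hθ : 0 < θ) :
    Tendsto (fun s => betaMean α hα (semi (betaMean α hα) s (expFun (θ * s)))) atTop
      (𝓝 (ageing α θ)) := by
  set ν := betaMean α hα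
  have hν : IsMean ν := isMean_betaMean hα
  set m := jumpDensity ν with hm
  set W := scaledWeight α m with hW
  set h := profile α θ with hh
  set Γ := Real.Gamma (1 + α) with hΓ
  set g : ℝ → ℝ := fun r => r ^ α * ν (expFun r) with hg
  have hgt : Tendsto g atTop (𝓝 Γ) := tendsto_betaMean_expFun_mul hα
  have hgc : Continuous g :=
    (continuous_id.rpow_const fun _ => Or.inr hα.le).mul continuous_mean_expFun
  have hG : ∀ r, 0 < r → ν (expFun r) = r ^ (-α) * g r := fun r hr => by
    have := Real.rpow_pos_of_pos hr α
    rw [hg, Real.rpow_neg hr.le]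
    field_simp
  have hWev : ∀ᶠ s in atTop, IntegrableOn (W s) (Ioi 0) ∧ ∀ v, 0 < v → 0 ≤ W s v := by
    filter_upwards [eventually_gt_atTop 0] with s hs
    exact scaledWeight_nonneg_integrableOn continuous_jumpDensity
      (fun u hu => hν.jumpDensity_nonneg hu) (fun u hu => hν.jumpDensity_le_one hu) hs
  have hWc : ∀ s, Continuous (W s) := fun s => by
    have : Continuous m := continuous_jumpDensity
    show Continuous fun v => s ^ (1 - α) * m (s * v) * Real.exp (-v)
    fun_prop
  have hhc : Continuous h := continuous_profile hθ
  have hmain : Tendsto (fun s => ∫ v in (0 : ℝ)..1, W s v * h v) atTop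
      (𝓝 (∫ v in (0 : ℝ)..1, limitWeight α v * h v)) :=
    tendsto_intervalIntegral_of_laplace hWev (integrableOn_limitWeight hα)
      (tendsto_laplace_scaledWeight hα hα1) hhc (profile_nonneg hθ) (profile_le hα hθ)
  -- the error made in replacing `g` by its limit
  have herr : Tendsto (fun s => ∫ v in (0 : ℝ)..1, W s v * h v * (g (s * (1 + θ - v)) - Γ)) atTop
      (𝓝 0) := by
    rw [Metric.tendsto_nhds]
    intro δ hδ
    set B := (∫ v in (0 : ℝ)..1, limitWeight α v * h v) + 1 with hB
    set ε := δ / (2 * (|B| + 1)) with hε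
    have hε0 : 0 < ε := by positivity
    obtain ⟨R, hR⟩ := eventually_atTop.1 ((Metric.tendsto_nhds.1 hgt) ε hε0)
    filter_upwards [hWev, hmain.eventually_lt_const (lt_add_one _), eventually_ge_atTop (R / θ),
      eventually_gt_atTop 0] with s hWs hBs hs hs0
    have hle : ‖∫ v in (0 : ℝ)..1, W s v * h v * (g (s * (1 + θ - v)) - Γ)‖
        ≤ ∫ v in (0 : ℝ)..1, W s v * h v * ε := by
      refine intervalIntegral.norm_integral_le_of_norm_le zero_le_one (ae_of_all _ fun v hv => ?_)
        (((hWc s).mul hhc).mul continuous_const |>.intervalIntegrable _ _)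
      have h1 : 0 ≤ W s v * h v := mul_nonneg (hWs.2 v hv.1) (profile_nonneg hθ v)
      rw [norm_mul, Real.norm_of_nonneg h1]
      refine mul_le_mul_of_nonneg_left ?_ h1
      refine (hR _ ?_).le
      rw [div_le_iff₀ hθ] at hs
      nlinarith [hv.2]
    rw [intervalIntegral.integral_mul_const] at hle
    rw [dist_zero_right]
    refine hle.trans_lt ?_
    have h2 : (∫ v in (0 : ℝ)..1, W s v * h v) * ε ≤ (|B| + 1) * ε := by
      refine mul_le_mul_of_nonneg_right ?_ hε0.le
      linarith [le_abs_self B]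
    refine h2.trans_lt ?_
    have h3 : (|B| + 1) * ε = δ / 2 := by rw [hε]; field_simp
    linarith
  -- the contribution of the event of no jump before time `s + θ s`
  have hfirst : Tendsto (fun s => ν (expFun (s + θ * s))) atTop (𝓝 0) := by
    have h1 : Tendsto (fun r => r ^ (-α) * g r) atTop (𝓝 (0 * Γ)) :=
      (tendsto_rpow_neg_atTop hα).mul hgt
    rw [zero_mul] at h1
    have h2 : Tendsto (fun s : ℝ => s + θ * s) atTop atTop :=
      (tendsto_id.const_mul_atTop (by linarith : 0 < 1 + θ)).congr fun s => by
        simp only [id]; ring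
    refine (h1.comp h2).congr' ?_
    filter_upwards [eventually_gt_atTop 0] with s hs
    exact (hG _ (by positivity)).symm
  have htot := hfirst.add (herr.add (hmain.const_mul Γ))
  rw [integral_limitWeight_mul_profile hα hα1 hθ, zero_add, zero_add] at htot
  refine htot.congr' ?_
  filter_upwards [eventually_gt_atTop 0] with s hs
  rw [mean_semi_expFun]
  congr 1
  have hscale := intervalIntegral.smul_integral_comp_mul_left (a := 0) (b := 1)
    (fun u => m u * ν (expFun (s - u + θ * s))) s
  rw [mul_zero, mul_one, smul_eq_mul] at hscale
  have hgs : Continuous fun v : ℝ => g (s * (1 + θ - v)) := hgc.comp (by fun_prop)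
  have hWs := hWc s
  have hint1 : Continuous fun v => W s v * h v * (g (s * (1 + θ - v)) - Γ) := by fun_prop
  have hint2 : Continuous fun v => Γ * (W s v * h v) := by fun_prop
  rw [← hscale, ← intervalIntegral.integral_const_mul, ← intervalIntegral.integral_const_mul,
    ← intervalIntegral.integral_add (hint1.intervalIntegrable _ _) (hint2.intervalIntegrable _ _)]
  refine intervalIntegral.integral_congr fun v hv => ?_
  rw [uIcc_of_le zero_le_one] at hv
  have hcv : 0 < 1 + θ - v := by linarith [hv.2]
  have h1 : s - s * v + θ * s = s * (1 + θ - v) := by ring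
  have h5 : Real.exp (-v) * Real.exp v = 1 := by rw [← Real.exp_add]; simp
  have h6 := Real.rpow_pos_of_pos hs α
  simp only [h1]
  rw [hG _ (mul_pos hs hcv), Real.mul_rpow hs.le hcv.le, hW, scaledWeight, hh, profile,
    min_eq_left hv.2, Real.rpow_sub hs, Real.rpow_one, Real.rpow_neg hs.le]
  generalize g (s * (1 + θ - v)) = y
  generalize (1 + θ - v) ^ (-α) = c
  field_simp
  linear_combination (m (s * v) * c * y) * h5

end

/-! ### The limits along almost every landscape -/

lemma IsLandscape.ae_isTypical {Ω : Type*} [MeasurableSpace Ω] {P : Measure Ω} {α : ℝ}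
    (hα : 0 < α) {E : ℕ → Ω → ℝ} (hE : IsLandscape P α E) :
    ∀ᵐ ω ∂P, IsTypical α fun i => E i ω := by
  filter_upwards [hE.decreasing, ae_eventually_numSites_level hα hE] with ω h1 h2
  exact ⟨h1, h2⟩

end

end REMTrap

theorem proposition4p4 {Ω : Type*} [MeasurableSpace Ω] (P : Measure Ω) [IsProbabilityMeasure P]
    (α : ℝ) (hα0 : 0 < α) (hα1 : α < 1) (E : ℕ → Ω → ℝ) (hE : REMTrap.IsLandscape P α E) :
    (∀ᵐ ω ∂P, ∀ t tw : ℝ, 0 ≤ t → 0 ≤ tw →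
      ∀ γ : ℝ → ℂ, REMTrap.IsLoopAroundUnitSegment γ →
        Tendsto
          (fun e : ℝ => ((REMTrap.landscapeCorr (Real.exp e) (fun i => E i ω) e t tw : ℝ) : ℂ))
          atBot (𝓝 (REMTrap.limitCorr α γ t tw))) ∧
    (∀ᵐ ω ∂P, ∀ θ : ℝ, 0 < θ →
      ∃ L : ℝ → ℝ,
        (∀ tw : ℝ, 0 ≤ tw →
          Tendsto
            (fun e : ℝ => REMTrap.landscapeCorr (Real.exp e) (fun i => E i ω) e (θ * tw) tw)
            atBot (𝓝 (L tw))) ∧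
        Tendsto L atTop (𝓝 (REMTrap.ageing α θ))) := by
  refine ⟨?_, ?_⟩
  · filter_upwards [hE.ae_isTypical hα0] with ω hω t tw ht htw γ hγ
    rw [REMTrap.limitCorr_eq hα0 hγ]
    exact (Complex.continuous_ofReal.tendsto _).comp (hω.tendsto_landscapeCorr hα0 ht htw)
  · filter_upwards [hE.ae_isTypical hα0] with ω hω θ hθ
    exact ⟨_, fun tw htw => hω.tendsto_landscapeCorr hα0 (mul_nonneg hθ.le htw) htw,
      REMTrap.tendsto_betaMean_semi_ageing hα0 hα1 hθ⟩
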